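/- **Theorem.** For $n=1,2,\dots$ let $w_{n,1},\dots,w_{n,p_n}$ ($p_n\ge 1$) be similarities of $\mathbb R^N$ which all have the same contraction ratio $\lambda_n\in(0,1)$, with $\sup_n\lambda_n<1$. Assume the countably ramified open set condition: there is a non-empty bounded open set $V\subset\mathbb R^N$ with $w_{n,j}(V)\subset V$ for all $n,j$ and $\overline{w_{n,i}(V)}\cap\overline{w_{n,j}(V)}$ at most countable for all $n$ and $i\neq j$. Let $F$ be the associated translation limit fractal, i.e. the limit in the Hausdorff metric of $W_1\circ\cdots\circ W_n(K)$, where $W_n(K)=\bigcup_j w_{n,j}(K)$, for every non-empty compact $K$. For a finite word $\sigma$ of length $n\ge 0$ with letters $\sigma(k)\in\{1,\dots,p_k\}$ put $w_\sigma=w_{1,\sigma(1)}\circ\cdots\circ w_{n,\sigma(n)}$. Fix two points $x\ne y$ of $V$, let $x_\sigma=w_\sigma(x)$, $y_\sigma=w_\sigma(y)$, and let $(\mathcal A,D,\mathcal H)$ be the spectral triple in which $\mathcal H=\bigoplus_\sigma\ell^2(\{x_\sigma,y_\sigma\})$, $D=\bigoplus_\sigma \frac1{|x_\sigma-y_\sigma|}\begin{pmatrix}0&1\\1&0\end{pmatrix}$,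 and $\mathcal A$ is the algebra of complex Lipschitz functions on $\overline V$, acting on $\mathcal H$ by multiplication. Let $d=\inf\{s>0:|D|^{-s}\in\mathcal L^{1,\infty}_0\}$ be the dimension of the triple, where $\mathcal L^{1,\infty}_0$ is the set of compact operators $T$ with $\sum_{k\le n}\mu_k(T)=o(\log n)$, $\mu_k(T)$ being the eigenvalues of $|T|$ in non-increasing order with multiplicity. 1. $d<\infty$ and $$d=\limsup_{n\to\infty}\frac{\sum_{k=1}^n\log p_k}{\sum_{k=1}^n\log(1/\lambda_k)}.$$ 2. Call $\tau$ a singular trace if it is a tracial weight on $B(\mathcal H)$ (an additive, positively homogeneous map $B(\mathcal H)_+\to[0,\infty]$ with $\tau(T^*T)=\tau(TT^*)$) that vanishes on the finite rank projections. If $d>0$, there is a singular trace $\tau$ with $\tau(|D|^{-d})=1$, so that the Hausdorff–Besicovitch functional $f\mapsto\tau(f|D|^{-d})$ on $\mathcal A$ exists. Whenever $\alpha>0$ and $\tau$ is a singular trace with $\tau(|D|^{-\alpha})=1$ (in particular for $\alpha=d$ if $d>0$), there is exactly one Borel probability measure $\mu$ on $\mathbb R^N$ carried by $F$ that is invariant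 under the internal isometries $w_{\sigma\cdot j}\circ w_{\sigma\cdot i}^{-1}:w_{\sigma\cdot i}(\overline V)\to w_{\sigma\cdot j}(\overline V)$ (for all words $\sigma$ of length $n\ge 0$ and all $i,j\in\{1,\dots,p_{n+1}\}$, where $\sigma\cdot i$ is $\sigma$ followed by the letter $i$), that is, $\mu(w_{\sigma\cdot i}(B))=\mu(w_{\sigma\cdot j}(B))$ for every Borel set $B\subset\overline V$; and $$\tau(f|D|^{-\alpha})=\int_F f\,d\mu\qquad\text{for all } f\in\mathcal A .$$ -/

import Mathlib

open Filter Topology MeasureTheory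
open scoped ENNReal NNReal

noncomputable section

namespace FractalNCG

/-! ### Singular values, singular traces and spectral triples -/

section General

variable {H : Type} [NormedAddCommGroup H] [InnerProductSpace ℂ H] [CompleteSpace H]

/-- `μ` lists the eigenvalues of `|T|` in non-increasing order, counted with multiplicity and
completed by zeros if there are only finitely many positive ones
(`μ n` is the `(n + 1)`-st eigenvalue). -/
def IsSingularValueSeq (T : H →L[ℂ] H) (μ : ℕ → ℝ) : Prop :=
  Antitone μ ∧ Tendsto μ atTop (𝓝 0) ∧
    ∀ s : ℝ, 0 < s → {n | μ n = s}.encard =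
      Cardinal.toENat (Module.rank ℂ
        (Module.End.eigenspace ((CFC.abs T : H →L[ℂ] H) : H →ₗ[ℂ] H) (s : ℂ)))

/-- The ideal `𝓛₀^{1,∞}`: compact operators with `∑_{k ≤ n} μ_k(T) = o(log n)`. -/
def InLogIdealZero (T : H →L[ℂ] H) : Prop :=
  IsCompactOperator T ∧ ∃ μ : ℕ → ℝ, IsSingularValueSeq T μ ∧
    (fun n : ℕ => ∑ k ∈ Finset.range n, μ k) =o[atTop] fun n : ℕ => Real.log n

/-- A singular trace on `B(H)`: an additive, positively homogeneous functional
`τ : B(H)₊ → [0, ∞]` with `τ(T*T) = τ(TT*)` that vanishes on the finite rank projections.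
Only the values of `τ` at positive operators matter. -/
structure IsSingularTrace (τ : (H →L[ℂ] H) → ℝ≥0∞) : Prop where
  map_add : ∀ S T : H →L[ℂ] H, S.IsPositive → T.IsPositive → τ (S + T) = τ S + τ T
  map_smul : ∀ (c : ℝ≥0) (T : H →L[ℂ] H), T.IsPositive → τ (((c : ℝ) : ℂ) • T) = c * τ T
  tracial : ∀ T : H →L[ℂ] H, τ (star T * T) = τ (T * star T)
  singular : ∀ P : H →L[ℂ] H, IsStarProjection P →
    FiniteDimensional ℂ (LinearMap.range (P : H →ₗ[ℂ] H)) → τ P = 0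

/-- The linear extension of a weight: `T ↦ τ(T)` for `T = (T₁ - T₂) + i (T₃ - T₄)`, the `T_j ≥ 0`
being the positive and negative parts of the real and imaginary parts of `T`. -/
def linearExtension (τ : (H →L[ℂ] H) → ℝ≥0∞) (T : H →L[ℂ] H) : ℂ :=
  (((τ ((realPart T : H →L[ℂ] H)⁺)).toReal - (τ ((realPart T : H →L[ℂ] H)⁻)).toReal : ℝ) : ℂ) +
    (((τ ((imaginaryPart T : H →L[ℂ] H)⁺)).toReal -
      (τ ((imaginaryPart T : H →L[ℂ] H)⁻)).toReal : ℝ) : ℂ) * Complex.I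

/-- A spectral triple `(A, D, H)` with `0` not an eigenvalue of `D`: a `*`-algebra `A` acting on
the Hilbert space `H`, and an (unbounded) self-adjoint operator `D` on `H` such that `[D, a]` is
bounded for every `a ∈ A` and such that `D` has a compact everywhere defined inverse, which says
that `D` has compact resolvent and trivial kernel. -/
structure SpectralTriple (A : Type) [Ring A] [StarRing A] [Algebra ℂ A]
    (H : Type) [NormedAddCommGroup H] [InnerProductSpace ℂ H] [CompleteSpace H] where
  rep : A →⋆ₐ[ℂ] (H →L[ℂ] H)
  D : H →ₗ.[ℂ] H
  selfAdjoint : IsSelfAdjoint D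
  rep_mem : ∀ (a : A) (ξ : D.domain), rep a ξ ∈ D.domain
  commutator_bounded : ∀ a : A, ∃ C : ℝ, ∀ ξ : D.domain,
    ‖D ⟨rep a ξ, rep_mem a ξ⟩ - rep a (D ξ)‖ ≤ C * ‖(ξ : H)‖
  inv : H →L[ℂ] H
  inv_mem : ∀ η : H, inv η ∈ D.domain
  apply_inv : ∀ η : H, D ⟨inv η, inv_mem η⟩ = η
  inv_apply : ∀ ξ : D.domain, inv (D ξ) = ξ
  inv_compact : IsCompactOperator inv

variable {A : Type} [Ring A] [StarRing A] [Algebra ℂ A]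

/-- `|D|^{-α}`, computed as `|D⁻¹|^α` by the continuous functional calculus (for `α > 0`). -/
def SpectralTriple.absPowNeg (T : SpectralTriple A H) (α : ℝ) : H →L[ℂ] H :=
  (CFC.abs T.inv) ^ α

/-- The (Hausdorff, or spectral) dimension `inf {d > 0 : |D|^{-d} ∈ 𝓛₀^{1,∞}}`. -/
def SpectralTriple.dimension (T : SpectralTriple A H) : ℝ≥0∞ :=
  ⨅ (d : ℝ) (_ : 0 < d) (_ : InLogIdealZero (T.absPowNeg d)), ENNReal.ofReal d

/-- `τ` is a singular trace witnessing that `α` is an exponent of singular traceability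
of `|D|⁻¹`. -/
def SpectralTriple.IsTraceOfExponent (T : SpectralTriple A H) (α : ℝ)
    (τ : (H →L[ℂ] H) → ℝ≥0∞) : Prop :=
  0 < α ∧ IsSingularTrace τ ∧ τ (T.absPowNeg α) = 1

/-- The Hausdorff-Besicovitch functional `a ↦ τ(a |D|^{-α})`. -/
def SpectralTriple.hausdorffBesicovitch (T : SpectralTriple A H) (α : ℝ)
    (τ : (H →L[ℂ] H) → ℝ≥0∞) (a : A) : ℂ :=
  linearExtension τ (T.rep a * T.absPowNeg α)

end General

/-! ### Weighted permutation operators on `ℓ²` -/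

section Weighted

variable {ι : Type}

/-- The Hilbert space `ℓ²(ι)`. -/
abbrev L2 (ι : Type) : Type := lp (fun _ : ι => ℂ) 2

lemma memℓp_comp_perm (e : Equiv.Perm ι) {f : ι → ℂ} (hf : Memℓp f 2) :
    Memℓp (fun i => f (e i)) 2 := by
  rw [memℓp_gen_iff (by simp)] at hf ⊢
  exact e.summable_iff.2 hf

lemma memℓp_weighted (e : Equiv.Perm ι) {c : ι → ℂ} (hc : ∃ C : ℝ, ∀ i, ‖c i‖ ≤ C)
    {f : ι → ℂ} (hf : Memℓp f 2) : Memℓp (fun i => c i * f (e i)) 2 := by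
  obtain ⟨C, hC⟩ := hc
  have h := memℓp_comp_perm e hf
  rw [memℓp_gen_iff (by simp)] at h ⊢
  refine Summable.of_nonneg_of_le (fun i => by positivity) (fun i => ?_)
    (h.mul_left (C ^ (2 : ℝ≥0∞).toReal))
  rw [norm_mul, Real.mul_rpow (norm_nonneg _) (norm_nonneg _)]
  gcongr
  exact hC i

lemma norm_weighted_le (e : Equiv.Perm ι) {c : ι → ℂ} {C : ℝ} (h0 : 0 ≤ C)
    (hC : ∀ i, ‖c i‖ ≤ C) (ξ η : L2 ι) (h : ∀ i, η i = c i * ξ (e i)) :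
    ‖η‖ ≤ C * ‖ξ‖ := by
  have hc : ‖(⟨fun i => ξ (e i), memℓp_comp_perm e ξ.2⟩ : L2 ι)‖ = ‖ξ‖ := by
    rw [lp.norm_eq_tsum_rpow (by simp), lp.norm_eq_tsum_rpow (by simp)]
    congr 1
    exact e.tsum_eq fun i => ‖ξ i‖ ^ (2 : ℝ≥0∞).toReal
  rw [← hc, ← abs_of_nonneg h0, ← Real.norm_eq_abs, ← Complex.norm_real, ← norm_smul]
  refine lp.norm_mono (by simp) fun i => ?_
  rw [h]
  simp only [lp.coeFn_smul, Pi.smul_apply, norm_smul, norm_mul, Complex.norm_real,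
    Real.norm_eq_abs, abs_of_nonneg h0]
  gcongr
  exact hC i

/-- The bounded operator `(T ξ)(i) = c(i) ξ(e(i))` on `ℓ²(ι)`. -/
def weighted (e : Equiv.Perm ι) (c : ι → ℂ) (hc : ∃ C : ℝ, ∀ i, ‖c i‖ ≤ C) :
    L2 ι →L[ℂ] L2 ι :=
  LinearMap.mkContinuousOfExistsBound
    { toFun := fun ξ => ⟨fun i => c i * ξ (e i), memℓp_weighted e hc ξ.2⟩
      map_add' := fun ξ η => by ext i; exact mul_add _ _ _
      map_smul' := fun a ξ => by ext i; simp [mul_left_comm] }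
    (by
      obtain ⟨C, hC⟩ := hc
      exact ⟨max C 0, fun ξ => norm_weighted_le e (le_max_right _ _)
        (fun i => (hC i).trans (le_max_left _ _)) ξ _ fun i => rfl⟩)

@[simp] lemma weighted_apply (e : Equiv.Perm ι) (c : ι → ℂ) (hc : ∃ C : ℝ, ∀ i, ‖c i‖ ≤ C)
    (ξ : L2 ι) (i : ι) : weighted e c hc ξ i = c i * ξ (e i) := rfl

lemma isCompactOperator_weighted (e : Equiv.Perm ι) (c : ι → ℂ) (hc : ∃ C : ℝ, ∀ i, ‖c i‖ ≤ C)
    (hfin : ∀ ε > 0, {i | ε ≤ ‖c i‖}.Finite) : IsCompactOperator (weighted e c hc) := by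
  classical
  have key : weighted e c hc ∈
      closure {T : L2 ι →L[ℂ] L2 ι | IsCompactOperator T} := by
    rw [Metric.mem_closure_iff]
    intro ε hε
    set s := (hfin (ε / 2) (by positivity)).toFinset with hs
    refine ⟨∑ i ∈ s, (lp.singleContinuousLinearMap ℂ (fun _ : ι => ℂ) 2 i).comp
      (c i • lp.evalCLM ℂ (fun _ : ι => ℂ) 2 (e i)), ?_, ?_⟩
    · refine (compactOperator (RingHom.id ℂ) (L2 ι) (L2 ι)).sum_mem fun i _ => ?_
      have h : IsCompactOperator (c i • lp.evalCLM ℂ (fun _ : ι => ℂ) 2 (e i)) :=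
        isCompactOperator_of_locallyCompactSpace_dom _
      exact h.clm_comp (lp.singleContinuousLinearMap ℂ (fun _ : ι => ℂ) 2 i)
    · rw [dist_eq_norm]
      refine lt_of_le_of_lt (ContinuousLinearMap.opNorm_le_bound _ (by positivity)
        (M := ε / 2) fun ξ => ?_) (by linarith)
      refine norm_weighted_le e (c := fun i => if i ∈ s then 0 else c i) (by positivity)
        (fun i => ?_) ξ _ fun i => ?_
      · split_ifs with h
        · simpa using (by positivity : 0 ≤ ε / 2)
        · simp only [hs, Set.Finite.mem_toFinset, Set.mem_ofPred_eq, not_le] at h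
          exact h.le
      · have h : (∑ j ∈ s, (lp.singleContinuousLinearMap ℂ (fun _ : ι => ℂ) 2 j).comp
            (c j • lp.evalCLM ℂ (fun _ : ι => ℂ) 2 (e j))) ξ i =
            ∑ j ∈ s, if i = j then c j * ξ (e j) else 0 := by
          rw [sum_apply]
          change lp.evalCLM ℂ (fun _ : ι => ℂ) 2 i (∑ j ∈ s, _) = _
          rw [map_sum]
          refine Finset.sum_congr rfl fun j _ => ?_
          change (lp.single 2 j (c j * ξ (e j)) : L2 ι) i = _
          by_cases hij : i = j
          · subst hij; simp
          · simp [hij]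
        change c i * ξ (e i) - (∑ j ∈ s, (lp.singleContinuousLinearMap ℂ (fun _ : ι => ℂ) 2 j).comp
            (c j • lp.evalCLM ℂ (fun _ : ι => ℂ) 2 (e j))) ξ i = _
        rw [h]
        split_ifs with hi <;> simp [hi]
  exact isClosed_setOfPred_isCompactOperator.closure_subset key

lemma weighted_symm (e : Equiv.Perm ι) (he : ∀ i, e (e i) = i) (c : ι → ℝ)
    (hce : ∀ i, c (e i) = c i) (hc : ∃ C : ℝ, ∀ i, ‖(c i : ℂ)‖ ≤ C) (ξ η : L2 ι) :
    inner ℂ (weighted e (fun i => (c i : ℂ)) hc ξ) η =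
      inner ℂ ξ (weighted e (fun i => (c i : ℂ)) hc η) := by
  rw [lp.inner_eq_tsum, lp.inner_eq_tsum, ← e.tsum_eq]
  refine tsum_congr fun i => ?_
  simp [he, hce]
  ring

lemma isSelfAdjoint_of_inverse {H : Type} [NormedAddCommGroup H] [InnerProductSpace ℂ H]
    [CompleteSpace H] (D : H →ₗ.[ℂ] H) (B : H →L[ℂ] H)
    (symm : ∀ ξ η, inner ℂ (B ξ) η = inner ℂ ξ (B η)) (mem : ∀ η, B η ∈ D.domain)
    (right : ∀ η, D ⟨B η, mem η⟩ = η) (left : ∀ ξ : D.domain, B (D ξ) = ξ) :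
    IsSelfAdjoint D := by
  have hinj : ∀ η, B η = 0 → η = 0 := fun η h => by
    have h1 := right η
    have h2 : (⟨B η, mem η⟩ : D.domain) = 0 := Subtype.ext h
    rw [h2, D.map_zero] at h1
    exact h1.symm
  have hd : Dense (D.domain : Set H) := by
    rw [Submodule.dense_iff_topologicalClosure_eq_top, Submodule.topologicalClosure_eq_top_iff,
      Submodule.eq_bot_iff]
    intro η hη
    refine hinj η (ext_inner_right ℂ fun ξ => ?_)
    rw [symm, inner_zero_left]
    exact Submodule.inner_left_of_mem_orthogonal (mem ξ) hη
  have hsym : D.IsFormalAdjoint D := fun ξ η => by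
    have h := symm (D ξ) (D η)
    rw [left, left] at h
    exact h.symm
  refine (LinearPMap.eq_of_le_of_domain_eq (hsym.le_adjoint hd) (le_antisymm
    (hsym.le_adjoint hd).1 fun η hη => ?_)).symm
  suffices h : η = B (D.adjoint ⟨η, hη⟩) by rw [h]; exact mem _
  refine ext_inner_right ℂ fun ξ => ?_
  have h := D.adjoint_isFormalAdjoint hd ⟨η, hη⟩ ⟨B ξ, mem ξ⟩
  rw [right] at h
  rw [symm]
  exact h.symm

end Weighted

/-! ### Limit fractals -/

/-- Contracting similarities `w n j`, `j = 1, …, p n`, of `ℝ^N` with contraction parameters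
`ratio n j`; the index `n = 0, 1, 2, …` stands for the step number `n + 1`. -/
structure LimitSystem (N : ℕ) where
  p : ℕ → ℕ
  p_pos : ∀ n, 0 < p n
  w : (n : ℕ) → Fin (p n) → EuclideanSpace ℝ (Fin N) → EuclideanSpace ℝ (Fin N)
  ratio : (n : ℕ) → Fin (p n) → ℝ
  ratio_pos : ∀ n j, 0 < ratio n j
  dist_eq : ∀ n j x y, dist (w n j x) (w n j y) = ratio n j * dist x y
  ratio_bound : ∃ c < 1, ∀ n j, ratio n j ≤ c

namespace LimitSystem

variable {N : ℕ} (S : LimitSystem N)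

/-- The finite words `σ` with `σ(k) ∈ {1, …, p k}` (`σ.1` is the length). -/
abbrev Word : Type := Σ n : ℕ, ((k : Fin n) → Fin (S.p k))

/-- `w_σ = w_{1σ(1)} ∘ ⋯ ∘ w_{nσ(n)}` for a word of length `n`. -/
def wordMap : (n : ℕ) → ((k : Fin n) → Fin (S.p k)) →
    EuclideanSpace ℝ (Fin N) → EuclideanSpace ℝ (Fin N)
  | 0, _ => id
  | n + 1, σ => wordMap n (fun k => σ k.castSucc) ∘ S.w n (σ (Fin.last n))

lemma continuous_w (n : ℕ) (j : Fin (S.p n)) : Continuous (S.w n j) :=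
  (LipschitzWith.of_dist_le_mul (K := ⟨S.ratio n j, (S.ratio_pos n j).le⟩)
    fun x y => (S.dist_eq n j x y).le).continuous

/-- The map `W_n : K ↦ ⋃_j w_{nj}(K)` on non-empty compact sets. -/
def W (n : ℕ) (K : TopologicalSpace.NonemptyCompacts (EuclideanSpace ℝ (Fin N))) :
    TopologicalSpace.NonemptyCompacts (EuclideanSpace ℝ (Fin N)) where
  carrier := ⋃ j : Fin (S.p n), S.w n j '' K
  isCompact' := isCompact_iUnion fun j => K.isCompact.image (S.continuous_w n j)
  nonempty' := by
    obtain ⟨x, hx⟩ := K.nonempty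
    exact ⟨S.w n ⟨0, S.p_pos n⟩ x, Set.mem_iUnion.2 ⟨_, x, hx, rfl⟩⟩

/-- `W_1 ∘ ⋯ ∘ W_n`. -/
def iterW : ℕ → TopologicalSpace.NonemptyCompacts (EuclideanSpace ℝ (Fin N)) →
    TopologicalSpace.NonemptyCompacts (EuclideanSpace ℝ (Fin N))
  | 0 => id
  | n + 1 => iterW n ∘ S.W n

/-- `F` is the limit fractal of the system: `W_1 ∘ ⋯ ∘ W_n (K) → F` in the Hausdorff metric, for
every non-empty compact `K`. -/
def IsLimitFractal (F : TopologicalSpace.NonemptyCompacts (EuclideanSpace ℝ (Fin N))) : Prop :=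
  ∀ K, Tendsto (fun n => S.iterW n K) atTop (𝓝 F)

/-- The countably ramified open set condition with respect to `V`. -/
structure IsCountablyRamifiedOSC (V : Set (EuclideanSpace ℝ (Fin N))) : Prop where
  nonempty : V.Nonempty
  bounded : Bornology.IsBounded V
  isOpen : IsOpen V
  image_subset : ∀ n j, S.w n j '' V ⊆ V
  countable_inter : ∀ n i j, i ≠ j →
    (closure (S.w n i '' V) ∩ closure (S.w n j '' V)).Countable

/-- `μ` is carried by `F` and invariant under the internal isometries
`w_{σ·j} ∘ w_{σ·i}⁻¹ : w_{σ·i} V̄ → w_{σ·j} V̄`, for all words `σ` and all letters `i`, `j`. -/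
def IsInvariantOn (V : Set (EuclideanSpace ℝ (Fin N)))
    (F : TopologicalSpace.NonemptyCompacts (EuclideanSpace ℝ (Fin N)))
    (μ : Measure (EuclideanSpace ℝ (Fin N))) : Prop :=
  μ (F : Set (EuclideanSpace ℝ (Fin N)))ᶜ = 0 ∧
    ∀ (σ : S.Word) (i j : Fin (S.p σ.1)) (B : Set (EuclideanSpace ℝ (Fin N))),
      MeasurableSet B → B ⊆ closure V →
        μ (S.wordMap σ.1 σ.2 ∘ S.w σ.1 i '' B) = μ (S.wordMap σ.1 σ.2 ∘ S.w σ.1 j '' B)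

/-! ### The spectral triple of a limit fractal -/

/-- The algebra of complex Lipschitz functions on the (bounded) set `V̄`. -/
def lipschitzAlgebra {V : Set (EuclideanSpace ℝ (Fin N))} (hV : Bornology.IsBounded V) :
    StarSubalgebra ℂ (closure V → ℂ) where
  carrier := {f | ∃ K, LipschitzWith K f}
  mul_mem' := by
    rintro f g ⟨K, hf⟩ ⟨L, hg⟩
    have : CompactSpace (closure V) := isCompact_iff_compactSpace.1 hV.isCompact_closure
    obtain ⟨a, ha⟩ := isCompact_univ.exists_bound_of_continuousOn hf.continuous.continuousOn
    obtain ⟨b, hb⟩ := isCompact_univ.exists_bound_of_continuousOn hg.continuous.continuousOn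
    refine ⟨Real.toNNReal (a * L + b * K), LipschitzWith.of_dist_le_mul fun u v => ?_⟩
    have h1 := hf.dist_le_mul u v
    have h2 := hg.dist_le_mul u v
    have h3 := ha u trivial
    have h4 := hb v trivial
    have h5 : 0 ≤ a := (norm_nonneg _).trans h3
    rw [dist_eq_norm] at h1 h2 ⊢
    calc ‖(f * g) u - (f * g) v‖ = ‖f u * (g u - g v) + (f u - f v) * g v‖ := by
          congr 1; simp only [Pi.mul_apply]; ring
      _ ≤ ‖f u‖ * ‖g u - g v‖ + ‖f u - f v‖ * ‖g v‖ :=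
          (norm_add_le _ _).trans (by rw [norm_mul, norm_mul])
      _ ≤ a * (L * dist u v) + (K * dist u v) * b := by gcongr
      _ = (a * L + b * K) * dist u v := by ring
      _ ≤ _ := by gcongr; exact Real.le_coe_toNNReal _
  add_mem' := by
    rintro f g ⟨K, hf⟩ ⟨L, hg⟩
    exact ⟨K + L, hf.add hg⟩
  algebraMap_mem' := fun r => ⟨0, LipschitzWith.const r⟩
  star_mem' := by
    rintro f ⟨K, hf⟩
    refine ⟨K, LipschitzWith.of_dist_le_mul fun a b => ?_⟩
    have := hf.dist_le_mul a b
    rw [dist_eq_norm] at this ⊢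
    simpa [← map_sub] using this

variable {S}

lemma IsCountablyRamifiedOSC.wordMap_mem {V : Set (EuclideanSpace ℝ (Fin N))}
    (hV : S.IsCountablyRamifiedOSC V) : ∀ (n : ℕ) (σ : (k : Fin n) → Fin (S.p k))
    {x : EuclideanSpace ℝ (Fin N)}, x ∈ V → S.wordMap n σ x ∈ V
  | 0, _, _, hx => hx
  | n + 1, _, _, hx => wordMap_mem hV n _ (hV.image_subset n _ ⟨_, hx, rfl⟩)

variable (S)

lemma wordMap_dist_pos : ∀ (n : ℕ) (σ : (k : Fin n) → Fin (S.p k))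
    {x y : EuclideanSpace ℝ (Fin N)}, x ≠ y → 0 < dist (S.wordMap n σ x) (S.wordMap n σ y)
  | 0, _, _, _, h => dist_pos.2 h
  | n + 1, σ, x, y, h => wordMap_dist_pos n _ (dist_pos.1 (by
      rw [S.dist_eq]; exact mul_pos (S.ratio_pos _ _) (dist_pos.2 h)))

lemma wordMap_dist_le {c : ℝ} (hc0 : 0 ≤ c) (hc : ∀ n j, S.ratio n j ≤ c) :
    ∀ (n : ℕ) (σ : (k : Fin n) → Fin (S.p k)) (x y : EuclideanSpace ℝ (Fin N)),
      dist (S.wordMap n σ x) (S.wordMap n σ y) ≤ c ^ n * dist x y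
  | 0, _, _, _ => by simp [wordMap]
  | n + 1, σ, x, y => by
      refine (wordMap_dist_le hc0 hc n _ _ _).trans ?_
      rw [S.dist_eq, pow_succ, mul_assoc]
      gcongr
      exact hc _ _

/-- The points `x_σ = w_σ(x)` (index `(σ, false)`) and `y_σ = w_σ(y)` (index `(σ, true)`). -/
def pt (x y : EuclideanSpace ℝ (Fin N)) (i : S.Word × Bool) : EuclideanSpace ℝ (Fin N) :=
  S.wordMap i.1.1 i.1.2 (if i.2 then y else x)

/-- `d(x_σ, y_σ)`. -/
def gap (x y : EuclideanSpace ℝ (Fin N)) (σ : S.Word) : ℝ :=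
  dist (S.wordMap σ.1 σ.2 x) (S.wordMap σ.1 σ.2 y)

/-- The permutation exchanging the indices of `x_σ` and `y_σ`, for all `σ`. -/
def swap : Equiv.Perm (S.Word × Bool) :=
  (Equiv.refl _).prodCongr Equiv.boolNot

variable {V : Set (EuclideanSpace ℝ (Fin N))} {x y : EuclideanSpace ℝ (Fin N)}

/-- `D = ⨁_σ D_σ`, where `D_σ = d(x_σ, y_σ)⁻¹ (0 1; 1 0)`, on its maximal domain in
`⨁_σ ℓ²({x_σ, y_σ}) = ℓ²(Word × Bool)`. -/
def dirac (x y : EuclideanSpace ℝ (Fin N)) : L2 (S.Word × Bool) →ₗ.[ℂ] L2 (S.Word × Bool) where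
  domain :=
    { carrier := {ξ | Memℓp (fun i => ((S.gap x y i.1 : ℝ) : ℂ)⁻¹ * ξ (S.swap i)) 2}
      add_mem' := fun {ξ η} hξ hη => by
        have h := Memℓp.add hξ hη
        have e : (fun i => ((S.gap x y i.1 : ℝ) : ℂ)⁻¹ * (ξ + η) (S.swap i)) =
            (fun i => ((S.gap x y i.1 : ℝ) : ℂ)⁻¹ * ξ (S.swap i)) +
              fun i => ((S.gap x y i.1 : ℝ) : ℂ)⁻¹ * η (S.swap i) := by
          ext i; exact mul_add _ _ _
        change Memℓp _ 2
        rw [e]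
        exact h
      zero_mem' := by
        have h : Memℓp (0 : S.Word × Bool → ℂ) 2 := zero_memℓp
        have e : (fun i => ((S.gap x y i.1 : ℝ) : ℂ)⁻¹ *
            (0 : L2 (S.Word × Bool)) (S.swap i)) = 0 := by
          ext i; exact mul_zero _
        change Memℓp _ 2
        rw [e]
        exact h
      smul_mem' := fun a ξ hξ => by
        simpa [mul_left_comm] using Memℓp.const_mul hξ a }
  toFun :=
    { toFun := fun ξ => ⟨fun i => ((S.gap x y i.1 : ℝ) : ℂ)⁻¹ * (ξ : L2 _) (S.swap i), ξ.2⟩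
      map_add' := fun ξ η => by ext i; exact mul_add _ _ _
      map_smul' := fun a ξ => by ext i; simp [mul_left_comm] }

lemma gap_pos (h : x ≠ y) (σ : S.Word) : 0 < S.gap x y σ := S.wordMap_dist_pos _ _ h

lemma gap_nonneg (x y : EuclideanSpace ℝ (Fin N)) (σ : S.Word) : 0 ≤ S.gap x y σ := dist_nonneg

lemma gap_bounded (x y : EuclideanSpace ℝ (Fin N)) :
    ∃ C : ℝ, ∀ i : S.Word × Bool, ‖((S.gap x y i.1 : ℝ) : ℂ)‖ ≤ C := by
  obtain ⟨c, hc1, hc⟩ := S.ratio_bound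
  have hc0 : 0 ≤ c := (S.ratio_pos 0 ⟨0, S.p_pos 0⟩).le.trans (hc _ _)
  refine ⟨dist x y, fun i => ?_⟩
  rw [Complex.norm_real, Real.norm_eq_abs, abs_of_nonneg (S.gap_nonneg _ _ _)]
  exact (S.wordMap_dist_le hc0 hc _ _ _ _).trans
    (mul_le_of_le_one_left dist_nonneg (pow_le_one₀ hc0 hc1.le))

lemma gap_finite (x y : EuclideanSpace ℝ (Fin N)) (ε : ℝ) (hε : 0 < ε) :
    {i : S.Word × Bool | ε ≤ ‖((S.gap x y i.1 : ℝ) : ℂ)‖}.Finite := by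
  obtain ⟨c, hc1, hc⟩ := S.ratio_bound
  have hc0 : 0 ≤ c := (S.ratio_pos 0 ⟨0, S.p_pos 0⟩).le.trans (hc _ _)
  have ht : Tendsto (fun n : ℕ => c ^ n * dist x y) atTop (𝓝 0) := by
    simpa using (tendsto_pow_atTop_nhds_zero_of_lt_one hc0 hc1).mul_const (dist x y)
  obtain ⟨M, hM⟩ := eventually_atTop.1 (ht.eventually_lt_const hε)
  have hf : (Set.range fun z : (Σ n : Fin M, ((k : Fin n) → Fin (S.p k))) × Bool =>
      ((⟨z.1.1, z.1.2⟩, z.2) : S.Word × Bool)).Finite := Set.finite_range _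
  refine hf.subset ?_
  rintro ⟨⟨n, σ⟩, b⟩ h
  have hn : n < M := by
    by_contra hn
    rw [Set.mem_ofPred_eq, Complex.norm_real, Real.norm_eq_abs, abs_of_nonneg (S.gap_nonneg _ _ _)] at h
    exact absurd (h.trans (S.wordMap_dist_le hc0 hc _ _ _ _)) (not_le.2 (hM n (not_lt.1 hn)))
  exact ⟨(⟨⟨n, hn⟩, σ⟩, b), rfl⟩

/-- The compact operator `D⁻¹ = ⨁_σ d(x_σ, y_σ) (0 1; 1 0)`. -/
def diracInv (x y : EuclideanSpace ℝ (Fin N)) :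
    L2 (S.Word × Bool) →L[ℂ] L2 (S.Word × Bool) :=
  weighted S.swap (fun i => ((S.gap x y i.1 : ℝ) : ℂ)) (S.gap_bounded x y)

lemma swap_swap (i : S.Word × Bool) : S.swap (S.swap i) = i := by
  obtain ⟨σ, b⟩ := i
  cases b <;> rfl

lemma gap_cancel (h : x ≠ y) (i : S.Word × Bool) (z : ℂ) :
    ((S.gap x y i.1 : ℝ) : ℂ)⁻¹ * (((S.gap x y (S.swap i).1 : ℝ) : ℂ) * z) = z := by
  have h0 : ((S.gap x y i.1 : ℝ) : ℂ) ≠ 0 := by exact_mod_cast (S.gap_pos h i.1).ne'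
  exact inv_mul_cancel_left₀ h0 z

lemma diracInv_mem (h : x ≠ y) (η : L2 (S.Word × Bool)) :
    S.diracInv x y η ∈ (S.dirac x y).domain := by
  have e : (fun i => ((S.gap x y i.1 : ℝ) : ℂ)⁻¹ * (S.diracInv x y η) (S.swap i)) = ⇑η := by
    ext i
    simp only [diracInv, weighted_apply, swap_swap]
    exact S.gap_cancel h i _
  change Memℓp _ 2
  rw [e]
  exact η.2

lemma dirac_diracInv (h : x ≠ y) (η : L2 (S.Word × Bool)) :
    S.dirac x y ⟨S.diracInv x y η, S.diracInv_mem h η⟩ = η := by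
  ext i
  change ((S.gap x y i.1 : ℝ) : ℂ)⁻¹ * (S.diracInv x y η) (S.swap i) = η i
  simp only [diracInv, weighted_apply, swap_swap]
  exact S.gap_cancel h i _

lemma diracInv_dirac (h : x ≠ y) (ξ : (S.dirac x y).domain) :
    S.diracInv x y (S.dirac x y ξ) = ξ := by
  ext i
  change ((S.gap x y i.1 : ℝ) : ℂ) * (((S.gap x y (S.swap i).1 : ℝ) : ℂ)⁻¹ *
    (ξ : L2 (S.Word × Bool)) (S.swap (S.swap i))) = _
  rw [swap_swap]
  have h0 : ((S.gap x y i.1 : ℝ) : ℂ) ≠ 0 := by exact_mod_cast (S.gap_pos h i.1).ne'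
  exact mul_inv_cancel_left₀ h0 _

variable {S}

/-- The point `x_σ` or `y_σ` as a point of `V̄`. -/
def ptV (hV : S.IsCountablyRamifiedOSC V) (hx : x ∈ V) (hy : y ∈ V) (i : S.Word × Bool) :
    closure V :=
  ⟨S.pt x y i, subset_closure (hV.wordMap_mem _ _ (by split_ifs <;> assumption))⟩

lemma lipschitz_bounded (hV : S.IsCountablyRamifiedOSC V) (hx : x ∈ V) (hy : y ∈ V)
    (f : lipschitzAlgebra hV.bounded) : ∃ C : ℝ, ∀ i, ‖f.1 (ptV hV hx hy i)‖ ≤ C := by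
  obtain ⟨K, hf⟩ := f.2
  have : CompactSpace (closure V) := isCompact_iff_compactSpace.1 hV.bounded.isCompact_closure
  obtain ⟨a, ha⟩ := isCompact_univ.exists_bound_of_continuousOn hf.continuous.continuousOn
  exact ⟨a, fun i => ha _ trivial⟩

/-- The action of Lipschitz functions by left multiplication: `(f ξ)(i) = f(i) ξ(i)` for
`i ∈ {x_σ, y_σ}`. -/
def lipschitzRep (hV : S.IsCountablyRamifiedOSC V) (hx : x ∈ V) (hy : y ∈ V) :
    lipschitzAlgebra hV.bounded →⋆ₐ[ℂ] (L2 (S.Word × Bool) →L[ℂ] L2 (S.Word × Bool)) where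
  toFun f := weighted (Equiv.refl _) (fun i => f.1 (ptV hV hx hy i))
    (lipschitz_bounded hV hx hy f)
  map_one' := by ext ξ i; simp
  map_mul' f g := by ext ξ i; simp [mul_assoc]
  map_zero' := by ext ξ i; simp
  map_add' f g := by ext ξ i; simp [add_mul]
  commutes' r := by
    ext ξ i
    simp [Algebra.algebraMap_eq_smul_one]
  map_star' f := by
    rw [ContinuousLinearMap.star_eq_adjoint, ContinuousLinearMap.eq_adjoint_iff]
    intro ξ η
    rw [lp.inner_eq_tsum, lp.inner_eq_tsum]
    refine tsum_congr fun i => ?_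
    simp
    ring

/-- The spectral triple of a limit fractal, for the starting points `x ≠ y` in `V`: the Lipschitz
functions on `V̄` acting on `ℓ²(Word × Bool) = ⨁_σ ℓ²({x_σ, y_σ})`, with `D = ⨁_σ D_σ`. -/
def spectralTriple (hV : S.IsCountablyRamifiedOSC V) (hx : x ∈ V) (hy : y ∈ V) (hxy : x ≠ y) :
    SpectralTriple (lipschitzAlgebra hV.bounded) (L2 (S.Word × Bool)) where
  rep := lipschitzRep hV hx hy
  D := S.dirac x y
  selfAdjoint := isSelfAdjoint_of_inverse _ (S.diracInv x y)
    (weighted_symm S.swap S.swap_swap (fun i => S.gap x y i.1) (fun i => rfl) _)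
    (S.diracInv_mem hxy) (S.dirac_diracInv hxy) (S.diracInv_dirac hxy)
  rep_mem f ξ := by
    obtain ⟨C, hC⟩ := lipschitz_bounded hV hx hy f
    have h := memℓp_weighted (Equiv.refl _)
      (c := fun i => f.1 (ptV hV hx hy (S.swap i))) ⟨C, fun i => hC _⟩ ξ.2
    change Memℓp _ 2
    convert h using 2 with i
    change _ * (f.1 (ptV hV hx hy (S.swap i)) * _) = _ * (_ * _)
    exact mul_left_comm _ _ _
  commutator_bounded f := by
    obtain ⟨K, hK⟩ := f.2
    refine ⟨K, fun ξ => norm_weighted_le S.swap K.2 (c := fun i =>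
      ((S.gap x y i.1 : ℝ) : ℂ)⁻¹ *
        (f.1 (ptV hV hx hy (S.swap i)) - f.1 (ptV hV hx hy i))) (fun i => ?_) ξ _ fun i => ?_⟩
    · have h := hK.dist_le_mul (ptV hV hx hy (S.swap i)) (ptV hV hx hy i)
      have hd : dist (ptV hV hx hy (S.swap i)) (ptV hV hx hy i) = S.gap x y i.1 := by
        obtain ⟨σ, b⟩ := i
        cases b
        · exact dist_comm _ _
        · rfl
      rw [hd, dist_eq_norm] at h
      rw [norm_mul, norm_inv, Complex.norm_real, Real.norm_eq_abs, abs_of_pos (S.gap_pos hxy _),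
        inv_mul_le_iff₀ (S.gap_pos hxy _), mul_comm]
      exact h
    · change ((S.gap x y i.1 : ℝ) : ℂ)⁻¹ * (f.1 (ptV hV hx hy (S.swap i)) * (ξ : L2 _) (S.swap i))
        - f.1 (ptV hV hx hy i) * (((S.gap x y i.1 : ℝ) : ℂ)⁻¹ * (ξ : L2 _) (S.swap i)) = _
      ring
  inv := S.diracInv x y
  inv_mem := S.diracInv_mem hxy
  apply_inv := S.dirac_diracInv hxy
  inv_apply := S.diracInv_dirac hxy
  inv_compact := isCompactOperator_weighted _ _ _ (S.gap_finite x y)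

end LimitSystem
end FractalNCG

end

noncomputable section

namespace FractalNCG

/-! ### Ky Fan sums -/

section KyFan

variable {H : Type} [NormedAddCommGroup H] [InnerProductSpace ℂ H]

/-! All maps of one step have the same ratio, so `|D|^{-α}` is a diagonal operator that depends on
the level alone: on words of length n its entry is `t_n = (λ_1 ⋯ λ_n |x - y|)^α`, with multiplicity
`2 P_n`, where `P_n = p_1 ⋯ p_n`.

Dimension. If the limsup is below s, then `∑ P_n t_n` is dominated by a geometric series at exponent
s, and summable singular values lie in the ideal. Conversely, membership forces `2 P_n t_n ≤ log (2
P_n)` for large `P_n`, while a limsup above s makes the left side at least a positive power of `P_n`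
infinitely often (`dimension_eq`). Packing the images of V into V gives `P_n (λ_1 ⋯ λ_n)^N ≤ 1`, so
the dimension is finite.

Existence of a trace. The trace is an ultrafilter limit of quotients of increments of Ky Fan sums
over long stretches of indices. Ky Fan sums σ satisfy `σ_n(A + B) ≤ σ_n(A) + σ_n(B)` and `σ_n(A) +
σ_m(B) ≤ σ_{n+m}(A + B)`, so increments are additive up to boundary terms of the form (index) ×
(singular value) at the two ends. `LevelData.exists_stretch` supplies stretches on which these terms
are negligible against the increment of `|D|^{-d}`. If there were none, the series at exponent d
would converge or diverge exponentially fast, and would keep doing so at a nearby exponent, although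
d separates convergence from divergence.

Representation. Let τ be any singular trace with `τ(|D|^{-α}) = 1`. Permutations of letters are
unitary, so all cylinders of level n carry the same trace; finitely many indices do not count, so
that trace is `1 / P_n`. A continuous function is nearly constant on the pieces of a late level.
Therefore `τ(f |D|^{-α})` is the limit of the means of f over the points of level n, and so is the
integral of f against any measure giving each piece of level n mass `1 / P_n`
(`diagTrace_eq_of_tendsto_levelMean`, `IsEquidistributed.tendsto_levelMean`).

Invariant measures. Existence of τ forces `P_n → ∞` (`tendsto_numWords_atTop`), and by volume a
point lies in at most M pieces of one level. An atom of an invariant measure thus has mass at most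
`M / P_n` for all n, so there are no atoms, the countable overlaps are null, and the measure is
equidistributed over the pieces; this determines it. One such measure is the image of the uniform
product measure on infinite words under the coding map (`exists_isInvariantOn`). -/

/-- The sum `∑ ⟪A v, v⟫` over a finite set of vectors. -/
def diagSum (A : H →L[ℂ] H) (u : Finset H) : ℝ := ∑ v ∈ u, A.reApplyInnerSelf v

/-- The finite set `u` is an orthonormal system of at most `n` vectors. -/
def IsOrthoSystem (n : ℕ) (u : Finset H) : Prop :=
  u.card ≤ n ∧ Orthonormal ℂ (Subtype.val : u → H)

/-- The Ky Fan sum `∑_{k < n} μ_k(A)` of a positive operator `A`, as the maximum of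
`∑ ⟪A v, v⟫` over the orthonormal systems of at most `n` vectors. -/
def kyFan (A : H →L[ℂ] H) (n : ℕ) : ℝ :=
  sSup (diagSum A '' {u | IsOrthoSystem n u})

/-- `A ≤ t` holds on the orthogonal complement of a subspace of dimension at most `n`. -/
def BoundedOffDim (A : H →L[ℂ] H) (n : ℕ) (t : ℝ) : Prop :=
  ∃ E : Submodule ℂ H, FiniteDimensional ℂ E ∧ Module.finrank ℂ E ≤ n ∧
    ∀ ξ ∈ Eᗮ, A.reApplyInnerSelf ξ ≤ t * ‖ξ‖ ^ 2

lemma isOrthoSystem_empty (n : ℕ) : IsOrthoSystem n (∅ : Finset H) :=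
  ⟨by simp, ⟨fun i => absurd i.2 (Finset.notMem_empty _),
    fun i => absurd i.2 (Finset.notMem_empty _)⟩⟩

lemma IsOrthoSystem.mono {n m : ℕ} {u : Finset H} (hu : IsOrthoSystem n u) (h : n ≤ m) :
    IsOrthoSystem m u := ⟨hu.1.trans h, hu.2⟩

lemma IsOrthoSystem.norm_eq {n : ℕ} {u : Finset H} (hu : IsOrthoSystem n u) {v : H} (hv : v ∈ u) :
    ‖v‖ = 1 := hu.2.1 ⟨v, hv⟩

lemma IsOrthoSystem.subset {n m : ℕ} {u w : Finset H} (hu : IsOrthoSystem n u) (h : w ⊆ u)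
    (hw : w.card ≤ m) : IsOrthoSystem m w :=
  ⟨hw, hu.2.comp (fun v : w => (⟨v, h v.2⟩ : u)) fun _ _ hab =>
    Subtype.ext (congrArg (fun c : u => (c : H)) hab)⟩

lemma reApplyInnerSelf_le_norm (A : H →L[ℂ] H) (v : H) :
    A.reApplyInnerSelf v ≤ ‖A‖ * ‖v‖ ^ 2 := by
  rw [ContinuousLinearMap.reApplyInnerSelf_apply]
  calc _ ≤ ‖A v‖ * ‖v‖ := re_inner_le_norm _ _
    _ ≤ ‖A‖ * ‖v‖ * ‖v‖ := by gcongr; exact A.le_opNorm v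
    _ = _ := by ring

lemma diagSum_le {A : H →L[ℂ] H} {n : ℕ} {u : Finset H} (hu : IsOrthoSystem n u) {t : ℝ}
    (ht : ∀ v ∈ u, A.reApplyInnerSelf v ≤ t * ‖v‖ ^ 2) : diagSum A u ≤ u.card * t := by
  rw [← nsmul_eq_mul]
  refine Finset.sum_le_card_nsmul _ _ _ fun v hv => ?_
  simpa [hu.norm_eq hv] using ht v hv

lemma bddAbove_diagSum (A : H →L[ℂ] H) (n : ℕ) :
    BddAbove (diagSum A '' {u | IsOrthoSystem n u}) := by
  refine ⟨n * ‖A‖, ?_⟩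
  rintro _ ⟨u, hu, rfl⟩
  refine (diagSum_le hu fun v _ => reApplyInnerSelf_le_norm A v).trans ?_
  gcongr
  exact hu.1

lemma diagSum_le_kyFan (A : H →L[ℂ] H) {n : ℕ} {u : Finset H} (hu : IsOrthoSystem n u) :
    diagSum A u ≤ kyFan A n := le_csSup (bddAbove_diagSum A n) ⟨u, hu, rfl⟩

lemma kyFan_le {A : H →L[ℂ] H} {n : ℕ} {c : ℝ}
    (h : ∀ u, IsOrthoSystem n u → diagSum A u ≤ c) : kyFan A n ≤ c := by
  refine csSup_le ⟨_, ∅, isOrthoSystem_empty n, rfl⟩ ?_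
  rintro _ ⟨u, hu, rfl⟩
  exact h u hu

lemma kyFan_mono (A : H →L[ℂ] H) {n m : ℕ} (h : n ≤ m) : kyFan A n ≤ kyFan A m :=
  kyFan_le fun _ hu => diagSum_le_kyFan A (hu.mono h)

lemma kyFan_zero_right (A : H →L[ℂ] H) : kyFan A 0 = 0 := by
  refine le_antisymm (kyFan_le fun u hu => ?_) ?_
  · rw [Finset.card_eq_zero.1 (Nat.le_zero.1 hu.1)]; simp [diagSum]
  · simpa [diagSum] using diagSum_le_kyFan A (isOrthoSystem_empty 0)

lemma reApplyInnerSelf_add (A B : H →L[ℂ] H) (v : H) :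
    (A + B).reApplyInnerSelf v = A.reApplyInnerSelf v + B.reApplyInnerSelf v := by
  simp [ContinuousLinearMap.reApplyInnerSelf_apply, inner_add_left]

lemma reApplyInnerSelf_real_smul (c : ℝ) (A : H →L[ℂ] H) (v : H) :
    ((c : ℂ) • A).reApplyInnerSelf v = c * A.reApplyInnerSelf v := by
  rw [ContinuousLinearMap.reApplyInnerSelf_apply, ContinuousLinearMap.reApplyInnerSelf_apply,
    smul_apply, inner_smul_left, Complex.conj_ofReal]
  exact Complex.re_ofReal_mul _ _

lemma diagSum_add (A B : H →L[ℂ] H) (u : Finset H) :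
    diagSum (A + B) u = diagSum A u + diagSum B u := by
  simp [diagSum, reApplyInnerSelf_add, Finset.sum_add_distrib]

lemma kyFan_add_le (A B : H →L[ℂ] H) (n : ℕ) : kyFan (A + B) n ≤ kyFan A n + kyFan B n :=
  kyFan_le fun u hu => by
    rw [diagSum_add]
    exact add_le_add (diagSum_le_kyFan A hu) (diagSum_le_kyFan B hu)

lemma kyFan_real_smul {c : ℝ} (hc : 0 ≤ c) (A : H →L[ℂ] H) (n : ℕ) :
    kyFan ((c : ℂ) • A) n = c * kyFan A n := by
  have h : ∀ u, diagSum ((c : ℂ) • A) u = c * diagSum A u := fun u => by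
    simp only [diagSum, reApplyInnerSelf_real_smul, Finset.mul_sum]
  rw [kyFan, kyFan, ← smul_eq_mul, ← Real.sSup_smul_of_nonneg hc]
  congr 1
  ext r
  simp only [Set.mem_smul_set, Set.mem_image, h, exists_exists_and_eq_and, smul_eq_mul]

/-- An orthonormal system in a finite-dimensional subspace extends to an orthonormal basis of it. -/
lemma exists_orthoBasis_extension (G : Submodule ℂ H) [FiniteDimensional ℂ G] {u : Finset H}
    {n : ℕ} (hu : IsOrthoSystem n u) (huG : ∀ v ∈ u, v ∈ G) :
    ∃ w : Finset H, u ⊆ w ∧ IsOrthoSystem (Module.finrank ℂ G) w ∧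
      w.card = Module.finrank ℂ G ∧ (∀ v ∈ w, v ∈ G) ∧
      ∀ A : H →L[ℂ] H, diagSum A w = ((LinearMap.trace ℂ G)
        ((G.orthogonalProjectionOnto.toLinearMap ∘ₗ A.toLinearMap) ∘ₗ G.subtype)).re := by
  classical
  have ho : Orthonormal ℂ ((↑) : ({v : G | (v : H) ∈ u} : Set G) → G) := by
    have := hu.2.comp (fun v : ({v : G | (v : H) ∈ u} : Set G) => (⟨v.1, v.2⟩ : u))
      (fun a b hab => Subtype.ext (Subtype.ext (congrArg (fun c : u => (c : H)) hab)))
    refine (LinearIsometry.orthonormal_comp_iff G.subtypeₗᵢ).1 ?_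
    exact this
  obtain ⟨w, b, hw, hb⟩ := ho.exists_orthonormalBasis_extension
  have hcard : (w.map (Function.Embedding.subtype _)).card = Module.finrank ℂ G := by
    rw [Finset.card_map, Module.finrank_eq_card_basis b.toBasis, Fintype.card_coe]
  refine ⟨w.map (Function.Embedding.subtype _), fun v hv => ?_, ⟨hcard.le, ?_⟩, hcard, fun v hv => ?_,
    fun A => ?_⟩
  · exact Finset.mem_map.2 ⟨⟨v, huG v hv⟩, hw hv, rfl⟩
  · have h1 := G.subtypeₗᵢ.orthonormal_comp_iff.2 b.orthonormal
    rw [hb] at h1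
    have hmem : ∀ v : (w.map (Function.Embedding.subtype (· ∈ G)) : Finset H),
        ∃ h : (v : H) ∈ G, (⟨v, h⟩ : G) ∈ w := by
      rintro ⟨v, hv⟩
      obtain ⟨a, ha, rfl⟩ := Finset.mem_map.1 hv
      exact ⟨a.2, ha⟩
    exact h1.comp (fun v : (w.map (Function.Embedding.subtype (· ∈ G)) : Finset H) =>
      (⟨⟨(v : H), (hmem v).1⟩, (hmem v).2⟩ : w)) fun a b hab =>
      Subtype.ext (congrArg (fun c : w => ((c : G) : H)) hab)
  · obtain ⟨a, -, rfl⟩ := Finset.mem_map.1 hv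
    exact a.2
  -- The trace does not mention the basis, so `diagSum` over an orthonormal basis of `G` depends on
  -- `G` alone; this is how bases get exchanged below.
  · rw [LinearMap.trace_eq_sum_inner _ b, diagSum, Finset.sum_map, Complex.re_sum, 
      ← Finset.sum_coe_sort w]
    refine Finset.sum_congr rfl fun v _ => ?_
    rw [hb, ContinuousLinearMap.reApplyInnerSelf_apply]
    change _ = (inner ℂ (v : G) (G.orthogonalProjectionOnto (A (v : G)))).re
    rw [Submodule.inner_orthogonalProjectionOnto_eq_of_mem_left, ← inner_conj_symm]
    exact Complex.conj_re _

lemma diagSum_mono {A : H →L[ℂ] H} (hA : ∀ v, 0 ≤ A.reApplyInnerSelf v) {u w : Finset H} 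
    (h : u ⊆ w) : diagSum A u ≤ diagSum A w :=
  Finset.sum_le_sum_of_subset_of_nonneg h fun v _ _ => hA v

/-- Systems for `A` and for `B` together span a space of dimension at most `n + m`. By positivity,
enlarging each to an orthonormal basis of that span only increases its sum, and by basis
independence of the trace both sums can then be evaluated on one basis. -/
lemma kyFan_add_kyFan_le {A B : H →L[ℂ] H} (hA : ∀ v, 0 ≤ A.reApplyInnerSelf v)
    (hB : ∀ v, 0 ≤ B.reApplyInnerSelf v) (n m : ℕ) :
    kyFan A n + kyFan B m ≤ kyFan (A + B) (n + m) := by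
  classical
  suffices h : ∀ u w, IsOrthoSystem n u → IsOrthoSystem m w →
      diagSum A u + diagSum B w ≤ kyFan (A + B) (n + m) by
    rw [← le_sub_iff_add_le]
    refine kyFan_le fun u hu => ?_
    rw [le_sub_comm]
    refine kyFan_le fun w hw => ?_
    have := h u w hu hw
    linarith
  intro u w hu hw
  set G : Submodule ℂ H := Submodule.span ℂ ((u ∪ w : Finset H) : Set H) with hG
  have hfin : FiniteDimensional ℂ G := FiniteDimensional.span_finset ℂ _
  have hrank : Module.finrank ℂ G ≤ n + m :=
    (finrank_span_finset_le_card _).trans ((Finset.card_union_le _ _).trans (add_le_add hu.1 hw.1))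
  obtain ⟨u', hu', hu'o, -, -, hu't⟩ := exists_orthoBasis_extension G hu fun v hv =>
    Submodule.subset_span (by simp [hv])
  obtain ⟨w', hw', -, -, -, hw't⟩ := exists_orthoBasis_extension G hw fun v hv =>
    Submodule.subset_span (by simp [hv])
  calc diagSum A u + diagSum B w ≤ diagSum A u' + diagSum B w' :=
        add_le_add (diagSum_mono hA hu') (diagSum_mono hB hw')
    _ = diagSum (A + B) u' := by rw [hw't, ← hu't, diagSum_add]
    _ ≤ _ := diagSum_le_kyFan _ (hu'o.mono hrank)

/-- The orthogonal projection `G → E` has kernel `G ⊓ Eᗮ`; this is rank-nullity. -/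
lemma finrank_le_inf_orthogonal (G E : Submodule ℂ H) [FiniteDimensional ℂ G]
    [FiniteDimensional ℂ E] : 
    Module.finrank ℂ G ≤ Module.finrank ℂ (G ⊓ Eᗮ : Submodule ℂ H) + Module.finrank ℂ E := by
  set f : G →ₗ[ℂ] E := E.orthogonalProjectionOnto.toLinearMap ∘ₗ G.subtype with hf
  have h1 := LinearMap.finrank_range_add_finrank_ker f
  have h2 : Module.finrank ℂ (LinearMap.range f) ≤ Module.finrank ℂ E := Submodule.finrank_le _
  have h3 : Module.finrank ℂ (LinearMap.ker f) ≤ 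
      Module.finrank ℂ (G ⊓ Eᗮ : Submodule ℂ H) := by
    refine LinearMap.finrank_le_finrank_of_injective 
      (f := LinearMap.codRestrict (G ⊓ Eᗮ) (G.subtype ∘ₗ (LinearMap.ker f).subtype) ?_) ?_
    · rintro ⟨v, hv⟩
      refine ⟨v.2, ?_⟩
      exact E.orthogonalProjectionOnto_eq_zero_iff.1 (LinearMap.mem_ker.1 hv)
    · intro a b hab
      exact Subtype.ext (Subtype.ext (congrArg (fun c : (G ⊓ Eᗮ : Submodule ℂ H) => (c : H)) hab))
  omega

/-- Inside a test space, vectors orthogonal to the exceptional subspace contribute at most `t` each,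
and an adapted basis has at most `n` others. In other words, every singular value after the first
`n` is at most `t`. -/
lemma kyFan_add_nat_le {A : H →L[ℂ] H} {n : ℕ} {t : ℝ} (ht : 0 ≤ t)
    (hA : BoundedOffDim A n t) (l : ℕ) : kyFan A (n + l) ≤ kyFan A n + l * t := by
  classical
  obtain ⟨E, hE, hEn, hEt⟩ := hA
  refine kyFan_le fun u hu => ?_
  set G : Submodule ℂ H := Submodule.span ℂ (u : Set H) with hG
  have hfin : FiniteDimensional ℂ G := FiniteDimensional.span_finset ℂ _
  have hrank : Module.finrank ℂ G ≤ n + l := (finrank_span_finset_le_card _).trans hu.1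
  have huG : Module.finrank ℂ G = u.card := by
    rw [hG]
    exact finrank_span_finset_eq_card hu.2.linearIndependent
  obtain ⟨u', hu', -, hu'c, -, hu't⟩ := exists_orthoBasis_extension G hu fun v hv =>
    Submodule.subset_span (by simpa using hv)
  have huu : u = u' := Finset.eq_of_subset_of_card_le hu' (by omega)
  set G₁ : Submodule ℂ H := G ⊓ Eᗮ
  have hfin₁ : FiniteDimensional ℂ G₁ := Submodule.finiteDimensional_inf_left _ _
  obtain ⟨v, -, hv, hvc, hvG, -⟩ :=
    exists_orthoBasis_extension G₁ (isOrthoSystem_empty 0) (by simp)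
  obtain ⟨w, hvw, hwo, hwc, -, hwt⟩ := exists_orthoBasis_extension G hv fun a ha => (hvG a ha).1
  -- Both `l` and `dim G₁` are at least `dim G - n`, so after removing `min l (dim G₁)` vectors at
  -- most `n` remain. There may be fewer than `l` removed vectors, which is where `0 ≤ t` enters.
  obtain ⟨v₁, hv₁, hv₁c⟩ := Finset.exists_subset_card_eq (min_le_right l v.card)
  have hdim := finrank_le_inf_orthogonal G E
  have hc : (w \ v₁).card ≤ n := by
    rw [Finset.card_sdiff_of_subset (hv₁.trans hvw), hwc, hv₁c, hvc]
    change Module.finrank ℂ G ≤ Module.finrank ℂ G₁ + _ at hdim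
    omega
  have h1 : diagSum A (w \ v₁) ≤ kyFan A n :=
    diagSum_le_kyFan A (hwo.subset Finset.sdiff_subset hc)
  have h2 : diagSum A v₁ ≤ l * t := by
    refine (diagSum_le (hv.subset hv₁ le_rfl) fun a ha => hEt a (hvG a (hv₁ ha)).2).trans ?_
    gcongr
    omega
  rw [huu, hu't, ← hwt, diagSum, ← Finset.sum_sdiff (hv₁.trans hvw)]
  exact add_le_add h1 h2

lemma BoundedOffDim.add {A B : H →L[ℂ] H} {n m : ℕ} {s t : ℝ} (hA : BoundedOffDim A n s)
    (hB : BoundedOffDim B m t) : BoundedOffDim (A + B) (n + m) (s + t) := by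
  obtain ⟨E, hE, hEn, hEs⟩ := hA
  obtain ⟨F, hF, hFm, hFt⟩ := hB
  refine ⟨E ⊔ F, inferInstance, (Submodule.finrank_add_le_finrank_add_finrank E F).trans
    (add_le_add hEn hFm), fun ξ hξ => ?_⟩
  rw [← Submodule.inf_orthogonal] at hξ
  rw [reApplyInnerSelf_add, add_mul]
  exact add_le_add (hEs ξ hξ.1) (hFt ξ hξ.2)

lemma BoundedOffDim.of_le {A B : H →L[ℂ] H} {n : ℕ} {t : ℝ} (hB : BoundedOffDim B n t)
    (h : ∀ v, A.reApplyInnerSelf v ≤ B.reApplyInnerSelf v) : BoundedOffDim A n t := by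
  obtain ⟨E, hE, hEn, hEt⟩ := hB
  exact ⟨E, hE, hEn, fun ξ hξ => (h ξ).trans (hEt ξ hξ)⟩

lemma BoundedOffDim.mono {A : H →L[ℂ] H} {n m : ℕ} {s t : ℝ} (hA : BoundedOffDim A n s)
    (hnm : n ≤ m) (hst : s ≤ t) : BoundedOffDim A m t := by
  obtain ⟨E, hE, hEn, hEt⟩ := hA
  exact ⟨E, hE, hEn.trans hnm, fun ξ hξ => (hEt ξ hξ).trans (by gcongr)⟩

lemma BoundedOffDim.real_smul {A : H →L[ℂ] H} {n : ℕ} {t c : ℝ} (hc : 0 ≤ c)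
    (hA : BoundedOffDim A n t) : BoundedOffDim ((c : ℂ) • A) n (c * t) := by
  obtain ⟨E, hE, hEn, hEt⟩ := hA
  refine ⟨E, hE, hEn, fun ξ hξ => ?_⟩
  rw [reApplyInnerSelf_real_smul, mul_assoc]
  exact mul_le_mul_of_nonneg_left (hEt ξ hξ) hc

variable [CompleteSpace H]

lemma reApplyInnerSelf_star_mul (T : H →L[ℂ] H) (v : H) :
    (star T * T).reApplyInnerSelf v = ‖T v‖ ^ 2 := by
  rw [ContinuousLinearMap.reApplyInnerSelf_apply, ContinuousLinearMap.star_eq_adjoint]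
  exact T.apply_norm_sq_eq_inner_adjoint_left v |>.symm

/-- If `η` is orthogonal to `T(E)`, then `T* η` is orthogonal to `E`, and Cauchy–Schwarz gives `‖T*
η‖⁴ ≤ ‖T T* η‖² ‖η‖² ≤ t ‖T* η‖² ‖η‖²`. This makes the trace ideal symmetric in `T* T` and `T T*`.
-/
lemma BoundedOffDim.star_mul {T : H →L[ℂ] H} {n : ℕ} {t : ℝ} (ht : 0 ≤ t)
    (hT : BoundedOffDim (star T * T) n t) : BoundedOffDim (T * star T) n t := by
  obtain ⟨E, hE, hEn, hEt⟩ := hT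
  refine ⟨E.map (T : H →ₗ[ℂ] H), inferInstance, (Submodule.finrank_map_le _ _).trans hEn,
    fun η hη => ?_⟩
  have h := reApplyInnerSelf_star_mul (star T) η
  rw [star_star] at h
  rw [h]
  have hmem : star T η ∈ Eᗮ := by
    rw [Submodule.mem_orthogonal]
    intro u hu
    rw [ContinuousLinearMap.star_eq_adjoint, ContinuousLinearMap.adjoint_inner_right]
    exact (Submodule.mem_orthogonal _ _).1 hη _ ⟨u, hu, rfl⟩
  have h1 := hEt _ hmem
  rw [reApplyInnerSelf_star_mul] at h1
  have h2 : ‖star T η‖ ^ 2 ≤ ‖T (star T η)‖ * ‖η‖ := by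
    rw [← h, ContinuousLinearMap.reApplyInnerSelf_apply]
    exact re_inner_le_norm _ _
  by_cases h0 : star T η = 0
  · rw [h0]; simp; positivity
  have h3 : 0 < ‖star T η‖ ^ 2 := by positivity
  have h4 : (‖star T η‖ ^ 2) * ‖star T η‖ ^ 2 ≤ (t * ‖η‖ ^ 2) * ‖star T η‖ ^ 2 := by
    calc _ ≤ (‖T (star T η)‖ * ‖η‖) * (‖T (star T η)‖ * ‖η‖) := by gcongr
      _ = ‖T (star T η)‖ ^ 2 * ‖η‖ ^ 2 := by ring
      _ ≤ (t * ‖star T η‖ ^ 2) * ‖η‖ ^ 2 := by gcongr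
      _ = _ := by ring
  exact le_of_mul_le_mul_right h4 h3

/-- Expand each `‖T a‖²` in an orthonormal basis of the span of these image vectors, exchange the
two sums, and apply Bessel's inequality to the vectors `T* v`. -/
lemma kyFan_star_mul_le (T : H →L[ℂ] H) (n : ℕ) : kyFan (star T * T) n ≤ kyFan (T * star T) n := by
  classical
  refine kyFan_le fun u hu => ?_
  set G : Submodule ℂ H := Submodule.span ℂ ((u.image T : Finset H) : Set H) with hG
  have hfin : FiniteDimensional ℂ G := FiniteDimensional.span_finset ℂ _
  have hrank : Module.finrank ℂ G ≤ n :=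
    (finrank_span_finset_le_card _).trans (Finset.card_image_le.trans hu.1)
  obtain ⟨w, -, hw, hwc, hwG, -⟩ := exists_orthoBasis_extension G (isOrthoSystem_empty 0) (by simp)
  have hspan : ∀ ξ ∈ G, ‖ξ‖ ^ 2 = ∑ v : w, ‖inner ℂ (v : H) ξ‖ ^ 2 := by
    intro ξ hξ
    have ho : Orthonormal ℂ fun v : w => (⟨v, hwG v v.2⟩ : G) :=
      (LinearIsometry.orthonormal_comp_iff G.subtypeₗᵢ).1 hw.2
    have hc : Fintype.card w = Module.finrank ℂ G := by rw [Fintype.card_coe, hwc]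
    -- An orthonormal family with `finrank G` members is already a basis, so this is Parseval's
    -- identity.
    obtain ⟨b, hb⟩ := Orthonormal.exists_orthonormalBasis_extension_of_card_eq hc.symm
      (v := fun v : w => (⟨v, hwG v v.2⟩ : G)) (s := Set.univ)
      (ho.comp (fun v : (Set.univ : Set w) => v.1) Subtype.val_injective)
    have := b.sum_sq_norm_inner_right ⟨ξ, hξ⟩
    change ‖(⟨ξ, hξ⟩ : G)‖ ^ 2 = _
    rw [← this]
    refine Finset.sum_congr rfl fun v _ => ?_
    rw [hb v trivial]
    rfl
  calc diagSum (star T * T) u = ∑ a : u, ‖T a‖ ^ 2 := by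
        rw [diagSum, ← Finset.sum_coe_sort u]
        exact Finset.sum_congr rfl fun a _ => reApplyInnerSelf_star_mul T a
    _ = ∑ a : u, ∑ v : w, ‖inner ℂ (v : H) (T a)‖ ^ 2 := Finset.sum_congr rfl fun a _ =>
        hspan _ (Submodule.subset_span (by simpa using ⟨(a : H), a.2, rfl⟩))
    _ = ∑ v : w, ∑ a : u, ‖inner ℂ (a : H) (star T (v : H))‖ ^ 2 := by
        rw [Finset.sum_comm]
        refine Finset.sum_congr rfl fun v _ => Finset.sum_congr rfl fun a _ => ?_
        rw [ContinuousLinearMap.star_eq_adjoint, ContinuousLinearMap.adjoint_inner_right,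
          norm_inner_symm]
    _ ≤ ∑ v : w, ‖star T (v : H)‖ ^ 2 :=
        Finset.sum_le_sum fun v _ => hu.2.sum_inner_products_le _
    _ = diagSum (T * star T) w := by
        rw [diagSum, ← Finset.sum_coe_sort w]
        refine Finset.sum_congr rfl fun a _ => ?_
        have h := reApplyInnerSelf_star_mul (star T) (a : H)
        rw [star_star] at h
        exact h.symm
    _ ≤ _ := diagSum_le_kyFan _ (hw.mono hrank)

lemma kyFan_star_mul (T : H →L[ℂ] H) (n : ℕ) : kyFan (star T * T) n = kyFan (T * star T) n := by
  refine le_antisymm (kyFan_star_mul_le T n) ?_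
  have h := kyFan_star_mul_le (star T) n
  rwa [star_star] at h

end KyFan
end FractalNCG

namespace FractalNCG

/-! ### A Dixmier type trace from increments of Ky Fan sums -/

section KyFanTrace

variable {H : Type} [NormedAddCommGroup H] [InnerProductSpace ℂ H]

/-- The operators whose singular values are dominated by those of an operator that is `≤ s j` off a
subspace of dimension `Q j`. -/
def traceIdeal (Q : ℕ → ℕ) (s : ℕ → ℝ) : Set (H →L[ℂ] H) :=
  {A | ∃ (m : ℕ) (C : ℝ), 0 ≤ C ∧ ∀ᶠ j in atTop, BoundedOffDim A (m * Q j) (C * s j)}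

/-- The increment of the Ky Fan sums of `A` between `n k` and `n' k`. -/
def kyFanIncrement (n n' : ℕ → ℕ) (A : H →L[ℂ] H) (k : ℕ) : ℝ := kyFan A (n' k) - kyFan A (n k)

open Classical in
/-- The limit along an ultrafilter of the quotients of the increments of the Ky Fan sums of an
operator and those of `T`, on the ideal `J`. -/
def kyFanTrace (J : Set (H →L[ℂ] H)) (n n' : ℕ → ℕ) (T A : H →L[ℂ] H) : ℝ≥0∞ :=
  if A ∈ J then
    lim (((hyperfilter ℕ).map fun k =>
      ENNReal.ofReal (kyFanIncrement n n' A k / kyFanIncrement n n' T k) : Ultrafilter ℝ≥0∞) :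
        Filter ℝ≥0∞)
  else ⊤

lemma tendsto_kyFanTrace {J : Set (H →L[ℂ] H)} (n n' : ℕ → ℕ) (T : H →L[ℂ] H) {A : H →L[ℂ] H}
    (hA : A ∈ J) : Tendsto (fun k =>
      ENNReal.ofReal (kyFanIncrement n n' A k / kyFanIncrement n n' T k)) (hyperfilter ℕ)
      (𝓝 (kyFanTrace J n n' T A)) := by
  rw [kyFanTrace, if_pos hA]
  exact Ultrafilter.le_nhds_lim _

lemma kyFanTrace_eq_of_tendsto {J : Set (H →L[ℂ] H)} {n n' : ℕ → ℕ} {T A : H →L[ℂ] H}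
    (hA : A ∈ J) {c : ℝ≥0∞} (h : Tendsto (fun k =>
      ENNReal.ofReal (kyFanIncrement n n' A k / kyFanIncrement n n' T k)) atTop (𝓝 c)) :
    kyFanTrace J n n' T A = c :=
  tendsto_nhds_unique (tendsto_kyFanTrace n n' T hA) (h.mono_left Nat.hyperfilter_le_atTop)

lemma kyFanIncrement_nonneg {n n' : ℕ → ℕ} (h : ∀ k, n k ≤ n' k) (A : H →L[ℂ] H) (k : ℕ) :
    0 ≤ kyFanIncrement n n' A k := sub_nonneg.2 (kyFan_mono A (h k))

variable {Q : ℕ → ℕ} {s : ℕ → ℝ}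

lemma mem_traceIdeal_of_le {A B : H →L[ℂ] H} (hB : B ∈ traceIdeal Q s)
    (h : ∀ v, A.reApplyInnerSelf v ≤ B.reApplyInnerSelf v) : A ∈ traceIdeal Q s := by
  obtain ⟨m, C, hC, hm⟩ := hB
  exact ⟨m, C, hC, hm.mono fun j hj => hj.of_le h⟩

lemma add_mem_traceIdeal {A B : H →L[ℂ] H} (hA : A ∈ traceIdeal Q s) (hB : B ∈ traceIdeal Q s) :
    A + B ∈ traceIdeal Q s := by
  obtain ⟨m, C, hC, hm⟩ := hA
  obtain ⟨m', C', hC', hm'⟩ := hB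
  refine ⟨m + m', C + C', add_nonneg hC hC', ?_⟩
  filter_upwards [hm, hm'] with j h h'
  rw [add_mul, add_mul]
  exact h.add h'

lemma smul_mem_traceIdeal {A : H →L[ℂ] H} {c : ℝ} (hc : 0 ≤ c) (hA : A ∈ traceIdeal Q s) :
    (c : ℂ) • A ∈ traceIdeal Q s := by
  obtain ⟨m, C, hC, hm⟩ := hA
  refine ⟨m, c * C, mul_nonneg hc hC, hm.mono fun j hj => ?_⟩
  rw [mul_assoc]
  exact hj.real_smul hc

/-- The defect of additivity at `n`: superadditivity reaches index `2 n`, and the `n` extra singular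
values of `A + B` are at most `t`. -/
lemma kyFan_add_sub_abs_le {A B : H →L[ℂ] H} (hA : ∀ v, 0 ≤ A.reApplyInnerSelf v)
    (hB : ∀ v, 0 ≤ B.reApplyInnerSelf v) {n : ℕ} {t : ℝ} (ht : 0 ≤ t)
    (hAB : BoundedOffDim (A + B) n t) :
    kyFan A n + kyFan B n ≤ kyFan (A + B) n + n * t :=
  (kyFan_add_kyFan_le hA hB n n).trans (kyFan_add_nat_le ht hAB n)

/-- The positions and the step sizes along which the Ky Fan sums of `T` grow slowly at both ends
of the interval `[k Q_{a k}, k Q_{b k})`, compared with the increment over it. -/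
structure IsAdapted (Q : ℕ → ℕ) (s : ℕ → ℝ) (a b : ℕ → ℕ) (T : H →L[ℂ] H) : Prop where
  monotone : Monotone Q
  pos : ∀ j, 0 < s j
  unbounded : ∀ᶠ j in atTop, 0 < Q j
  le : ∀ k, k ≤ a k
  lt : ∀ k, a k ≤ b k
  mem : T ∈ traceIdeal Q s
  increment_pos : ∀ᶠ k in atTop,
    0 < kyFanIncrement (fun k => k * Q (a k)) (fun k => k * Q (b k)) T k
  tendsto : Tendsto (fun k : ℕ => (k * (Q (a k) * s (a k) + Q (b k) * s (b k)) : ℝ) /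
    kyFanIncrement (fun k => k * Q (a k)) (fun k => k * Q (b k)) T k) atTop (𝓝 0)

variable {a b : ℕ → ℕ} {T : H →L[ℂ] H}

lemma IsAdapted.index_le (h : IsAdapted Q s a b T) (k : ℕ) : k * Q (a k) ≤ k * Q (b k) :=
  Nat.mul_le_mul_left _ (h.monotone (h.lt k))

lemma IsAdapted.tendsto_a (h : IsAdapted Q s a b T) : Tendsto a atTop atTop :=
  tendsto_atTop_mono h.le tendsto_id

lemma IsAdapted.tendsto_b (h : IsAdapted Q s a b T) : Tendsto b atTop atTop :=
  tendsto_atTop_mono h.lt h.tendsto_a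

lemma IsAdapted.map_add (h : IsAdapted Q s a b T) {A B : H →L[ℂ] H}
    (hA : ∀ v, 0 ≤ A.reApplyInnerSelf v) (hB : ∀ v, 0 ≤ B.reApplyInnerSelf v) :
    kyFanTrace (traceIdeal Q s) (fun k => k * Q (a k)) (fun k => k * Q (b k)) T (A + B) =
      kyFanTrace (traceIdeal Q s) (fun k => k * Q (a k)) (fun k => k * Q (b k)) T A +
      kyFanTrace (traceIdeal Q s) (fun k => k * Q (a k)) (fun k => k * Q (b k)) T B := by
  by_cases hAB : A + B ∈ traceIdeal Q s
  swap
  · have : A ∉ traceIdeal Q s ∨ B ∉ traceIdeal Q s := by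
      by_contra! hc
      exact hAB (add_mem_traceIdeal hc.1 hc.2)
    rcases this with h' | h' <;> simp [kyFanTrace, hAB, h']
  have hAJ : A ∈ traceIdeal Q s := mem_traceIdeal_of_le hAB fun v => by
    rw [reApplyInnerSelf_add]; linarith [hB v]
  have hBJ : B ∈ traceIdeal Q s := mem_traceIdeal_of_le hAB fun v => by
    rw [reApplyInnerSelf_add]; linarith [hA v]
  set n : ℕ → ℕ := fun k => k * Q (a k) with hn
  set n' : ℕ → ℕ := fun k => k * Q (b k) with hn'
  set g := kyFanIncrement n n' T with hg
  obtain ⟨m, C, hC, hm⟩ := hAB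
  set e : ℕ → ℝ := fun k => C * ((k * (Q (a k) * s (a k) + Q (b k) * s (b k)) : ℝ) / g k) with he
  have he0 : Tendsto (fun k => ENNReal.ofReal (e k)) (hyperfilter ℕ) (𝓝 0) := by
    have := (h.tendsto.const_mul C)
    rw [mul_zero] at this
    simpa using (ENNReal.tendsto_ofReal this).mono_left Nat.hyperfilter_le_atTop
  have key : ∀ᶠ k in atTop, 0 < g k ∧
      |kyFanIncrement n n' (A + B) k - (kyFanIncrement n n' A k + kyFanIncrement n n' B k)| ≤
        e k * g k := by
    -- The factor `k` in the positions `k * Q (a k)` and `k * Q (b k)` serves this step: it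
    -- eventually exceeds the multiplier `m` attached to `A + B`, whatever that is.
    filter_upwards [h.increment_pos, h.tendsto_a.eventually hm, h.tendsto_b.eventually hm,
      eventually_ge_atTop m] with k hk h1 h2 hmk
    refine ⟨hk, ?_⟩
    have hsa := h.pos (a k)
    have hsb := h.pos (b k)
    have h1' := kyFan_add_sub_abs_le hA hB (mul_nonneg hC hsa.le)
      (h1.mono (Nat.mul_le_mul_right _ hmk) le_rfl)
    have h2' := kyFan_add_sub_abs_le hA hB (mul_nonneg hC hsb.le)
      (h2.mono (Nat.mul_le_mul_right _ hmk) le_rfl)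
    have h3 := kyFan_add_le A B (n k)
    have h4 := kyFan_add_le A B (n' k)
    have h5 : e k * g k = C * (k * (Q (a k) * s (a k) + Q (b k) * s (b k))) := by
      have hk' : 0 < g k := hk
      simp only [he]
      rw [mul_assoc, div_mul_cancel₀ _ hk'.ne']
    have e1 : ((k * Q (a k) : ℕ) : ℝ) * (C * s (a k)) = C * (k * (Q (a k) * s (a k))) := by
      push_cast; ring
    have e2 : ((k * Q (b k) : ℕ) : ℝ) * (C * s (b k)) = C * (k * (Q (b k) * s (b k))) := by
      push_cast; ring
    have p1 : 0 ≤ C * (k * (Q (a k) * s (a k))) := by positivity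
    have p2 : 0 ≤ C * (k * (Q (b k) * s (b k))) := by positivity
    rw [e1] at h1'
    rw [e2] at h2'
    rw [h5, abs_le]
    simp only [kyFanIncrement, hn, hn'] at h3 h4 ⊢
    constructor <;> linarith
  have hsum : Tendsto (fun k => ENNReal.ofReal (kyFanIncrement n n' A k / g k) +
      ENNReal.ofReal (kyFanIncrement n n' B k / g k)) (hyperfilter ℕ)
      (𝓝 (kyFanTrace (traceIdeal Q s) n n' T A + kyFanTrace (traceIdeal Q s) n n' T B)) :=
    (tendsto_kyFanTrace n n' T hAJ).add (tendsto_kyFanTrace n n' T hBJ)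
  have htot := tendsto_kyFanTrace (J := traceIdeal Q s) n n' T (A := A + B) ⟨m, C, hC, hm⟩
  have hev := key.filter_mono Nat.hyperfilter_le_atTop
  have hpos := kyFanIncrement_nonneg h.index_le (H := H)
  refine le_antisymm ?_ ?_
  · have := hsum.add he0
    rw [add_zero] at this
    refine le_of_tendsto_of_tendsto htot this (hev.mono fun k hk => ?_)
    have hAk : 0 ≤ kyFanIncrement n n' A k / g k := div_nonneg (hpos A k) hk.1.le
    have hBk : 0 ≤ kyFanIncrement n n' B k / g k := div_nonneg (hpos B k) hk.1.le
    beta_reduce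
    rw [← ENNReal.ofReal_add hAk hBk]
    refine (ENNReal.ofReal_le_ofReal ?_).trans ENNReal.ofReal_add_le
    rw [← add_div, div_add' _ _ _ hk.1.ne']
    have h0 := hk.1
    have := (abs_le.1 hk.2).2
    exact div_le_div_of_nonneg_right (by linarith) h0.le
  · have := htot.add he0
    rw [add_zero] at this
    refine le_of_tendsto_of_tendsto hsum this (hev.mono fun k hk => ?_)
    have hAk : 0 ≤ kyFanIncrement n n' A k / g k := div_nonneg (hpos A k) hk.1.le
    have hBk : 0 ≤ kyFanIncrement n n' B k / g k := div_nonneg (hpos B k) hk.1.le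
    beta_reduce
    rw [← ENNReal.ofReal_add hAk hBk]
    refine (ENNReal.ofReal_le_ofReal ?_).trans ENNReal.ofReal_add_le
    rw [← add_div, div_add' _ _ _ hk.1.ne']
    have h0 := hk.1
    have := (abs_le.1 hk.2).1
    exact div_le_div_of_nonneg_right (by linarith) h0.le

lemma kyFanTrace_real_smul (n n' : ℕ → ℕ) (c : ℝ≥0) (T A : H →L[ℂ] H) :
    kyFanTrace (traceIdeal Q s) n n' T (((c : ℝ) : ℂ) • A) =
      c * kyFanTrace (traceIdeal Q s) n n' T A := by
  rcases eq_or_ne c 0 with rfl | hc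
  -- `A` may lie outside the ideal while `0 • A` lies in it; the convention `0 * ⊤ = 0` fits.
  · have h0 : (0 : H →L[ℂ] H) ∈ traceIdeal Q s :=
      ⟨0, 0, le_rfl, Eventually.of_forall fun j => ⟨⊥, inferInstance, by simp, fun ξ _ => by
        simp [ContinuousLinearMap.reApplyInnerSelf_apply]⟩⟩
    have h1 : ∀ m, kyFan (0 : H →L[ℂ] H) m = 0 := fun m => by
      simpa using kyFan_real_smul (c := 0) le_rfl (0 : H →L[ℂ] H) m
    have h2 : kyFanTrace (traceIdeal Q s) n n' T 0 = 0 :=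
      kyFanTrace_eq_of_tendsto h0 (by simp [kyFanIncrement, h1])
    simp [h2]
  by_cases hA : A ∈ traceIdeal Q s
  · refine tendsto_nhds_unique (tendsto_kyFanTrace n n' T (smul_mem_traceIdeal c.2 hA)) ?_
    have := ENNReal.Tendsto.const_mul (a := (c : ℝ≥0∞)) (tendsto_kyFanTrace n n' T hA)
      (Or.inr ENNReal.coe_ne_top)
    refine this.congr fun k => ?_
    rw [← ENNReal.ofReal_coe_nnreal, ← ENNReal.ofReal_mul c.coe_nonneg]
    congr 1
    simp only [kyFanIncrement, kyFan_real_smul c.coe_nonneg]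
    ring
  · have hcA : ((c : ℝ) : ℂ) • A ∉ traceIdeal Q s := fun hmem => hA (by
      have := smul_mem_traceIdeal (c := ((c⁻¹ : ℝ≥0) : ℝ)) (NNReal.coe_nonneg _) hmem
      rwa [smul_smul, ← Complex.ofReal_mul, ← NNReal.coe_mul, inv_mul_cancel₀ hc, NNReal.coe_one,
        Complex.ofReal_one, one_smul] at this)
    rw [kyFanTrace, kyFanTrace, if_neg hA, if_neg hcA, ENNReal.mul_top (by simpa using hc)]

lemma boundedOffDim_zero_of_finiteDimensional_range (P : H →L[ℂ] H)
    [FiniteDimensional ℂ (LinearMap.range (P : H →ₗ[ℂ] H))] :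
    BoundedOffDim P (Module.finrank ℂ (LinearMap.range (P : H →ₗ[ℂ] H))) 0 := by
  refine ⟨_, inferInstance, le_rfl, fun ξ hξ => ?_⟩
  rw [ContinuousLinearMap.reApplyInnerSelf_apply, zero_mul,
    (Submodule.mem_orthogonal _ _).1 hξ (P ξ) ⟨ξ, rfl⟩]
  simp

variable [CompleteSpace H]

lemma star_mul_mem_traceIdeal (hs : ∀ j, 0 < s j) {T : H →L[ℂ] H}
    (hT : star T * T ∈ traceIdeal Q s) : T * star T ∈ traceIdeal Q s := by
  obtain ⟨m, C, hC, hm⟩ := hT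
  exact ⟨m, C, hC, hm.mono fun j hj => hj.star_mul (mul_nonneg hC (hs j).le)⟩

/-- An adapted operator `T` admits a singular trace with value `1` at `T`. -/
theorem IsAdapted.exists_singularTrace (h : IsAdapted Q s a b T) :
    ∃ τ : (H →L[ℂ] H) → ℝ≥0∞, IsSingularTrace τ ∧ τ T = 1 := by
  refine ⟨kyFanTrace (traceIdeal Q s) (fun k => k * Q (a k)) (fun k => k * Q (b k)) T,
    ⟨fun A B hA hB => h.map_add hA.re_inner_nonneg_left hB.re_inner_nonneg_left,
      fun c A _ => kyFanTrace_real_smul _ _ c T A, fun A => ?_, fun P hP hfin => ?_⟩, ?_⟩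
  · have hmem : star A * A ∈ traceIdeal Q s ↔ A * star A ∈ traceIdeal Q s :=
      ⟨star_mul_mem_traceIdeal h.pos, fun hm => by
        have := star_mul_mem_traceIdeal (T := star A) h.pos (by rwa [star_star])
        rwa [star_star] at this⟩
    have hinc : kyFanIncrement (fun k => k * Q (a k)) (fun k => k * Q (b k)) (star A * A) =
        kyFanIncrement (fun k => k * Q (a k)) (fun k => k * Q (b k)) (A * star A) := by
      funext k
      simp only [kyFanIncrement, kyFan_star_mul]
    by_cases hA : A * star A ∈ traceIdeal Q s
    · rw [kyFanTrace, kyFanTrace, if_pos hA, if_pos (hmem.2 hA), hinc]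
    · rw [kyFanTrace, kyFanTrace, if_neg hA, if_neg (mt hmem.1 hA)]
  · have hb := boundedOffDim_zero_of_finiteDimensional_range P
    set r := Module.finrank ℂ (LinearMap.range (P : H →ₗ[ℂ] H))
    have hJ : P ∈ traceIdeal Q s := by
      refine ⟨r, 0, le_rfl, h.unbounded.mono fun j hj => ?_⟩
      rw [zero_mul]
      exact hb.mono (Nat.le_mul_of_pos_right r hj) le_rfl
    refine kyFanTrace_eq_of_tendsto hJ (tendsto_const_nhds.congr' ?_)
    filter_upwards [h.tendsto_a.eventually h.unbounded, eventually_ge_atTop r] with k hk hrk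
    -- The Ky Fan sums of a finite rank projection are constant from its rank on, so its increments
    -- vanish eventually.
    have h1 : ∀ m, r ≤ m → kyFan P m = kyFan P r := fun m hm => by
      obtain ⟨l, rfl⟩ := Nat.exists_eq_add_of_le hm
      refine le_antisymm ?_ (kyFan_mono P hm)
      simpa using kyFan_add_nat_le le_rfl hb l
    have h2 : r ≤ k * Q (a k) := hrk.trans (Nat.le_mul_of_pos_right k hk)
    simp [kyFanIncrement, h1 _ h2, h1 _ (h2.trans (h.index_le k))]
  · refine kyFanTrace_eq_of_tendsto h.mem (tendsto_const_nhds.congr' ?_)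
    filter_upwards [h.increment_pos] with k hk
    rw [div_self hk.ne', ENNReal.ofReal_one]

end KyFanTrace
end FractalNCG

namespace FractalNCG

/-! ### Functional calculus of diagonal operators -/

section Eigenvector

variable {H : Type} [NormedAddCommGroup H] [InnerProductSpace ℂ H] [CompleteSpace H]

/-- The continuous functional calculus acts on eigenvectors by evaluation at the eigenvalue. -/
lemma cfc_apply_eigenvector {T : H →L[ℂ] H} (hT : IsSelfAdjoint T) {t : ℝ} {ξ : H}
    (h0 : ξ ≠ 0) (hξ : T ξ = (t : ℂ) • ξ) {f : ℝ → ℝ} (hf : ContinuousOn f (spectrum ℝ T)) :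
    cfc f T ξ = (f t : ℂ) • ξ := by
  have ht : t ∈ spectrum ℝ T := by
    rw [spectrum.mem_iff]
    intro hu
    obtain ⟨u, hu⟩ := hu
    have h1 : (u : H →L[ℂ] H) ξ = 0 := by
      rw [hu, sub_apply, hξ, sub_eq_zero]
      simp [Algebra.algebraMap_eq_smul_one]
    apply h0
    calc ξ = ((↑u⁻¹ : H →L[ℂ] H) * (u : H →L[ℂ] H)) ξ := by rw [u.inv_mul]; rfl
      _ = (↑u⁻¹ : H →L[ℂ] H) ((u : H →L[ℂ] H) ξ) := rfl
      _ = 0 := by rw [h1, map_zero]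
  rw [cfc_apply f T]
  -- Both sides are continuous in `g` and compatible with sums and products, so Stone–Weierstrass
  -- reduces the claim to constants and the identity.
  have key : ∀ g : C(spectrum ℝ T, ℝ), cfcHom hT g ξ = (g ⟨t, ht⟩ : ℂ) • ξ := by
    intro g
    induction g using ContinuousMap.induction_on_of_compact with
    | const r =>
      have : (ContinuousMap.const (spectrum ℝ T) r) = algebraMap ℝ C(spectrum ℝ T, ℝ) r := rfl
      rw [this, AlgHomClass.commutes]
      simp [Algebra.algebraMap_eq_smul_one]
    | id =>
      rw [cfcHom_id hT, hξ]
      rfl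
    | star_id =>
      rw [star_trivial, cfcHom_id hT, hξ]
      rfl
    | add f g hf hg =>
      rw [map_add, add_apply, hf, hg, ← add_smul]
      simp
    | mul f g hf hg =>
      rw [map_mul, mul_apply_eq_comp, hg, map_smul, hf, smul_smul]
      simp [mul_comm]
    | frequently f hf =>
      refine hf.mem_of_closed (isClosed_eq ?_ ?_)
      · exact (ContinuousLinearMap.apply ℂ H ξ).continuous.comp (cfcHom_continuous hT)
      · exact (Complex.continuous_ofReal.comp (continuous_eval_const _)).smul continuous_const
  exact key _

/-- The power `|T|^α`, computed on the eigenvectors of an operator `B ≥ 0` with `B² = T*T`. -/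
lemma abs_rpow_apply_eigenvector {T B : H →L[ℂ] H} (hB : B.IsPositive) (hBT : B * B = star T * T)
    {α : ℝ} (hα : 0 < α) : IsSelfAdjoint ((CFC.abs T) ^ α) ∧
      ∀ (t : ℝ) (ξ : H), ξ ≠ 0 → B ξ = (t : ℂ) • ξ →
        ((CFC.abs T) ^ α) ξ = ((t ^ α : ℝ) : ℂ) • ξ := by
  have hB0 : 0 ≤ B := (ContinuousLinearMap.nonneg_iff_isPositive _).2 hB
  rw [show CFC.abs T = B from CFC.sqrt_unique hBT hB0]
  refine ⟨.of_nonneg CFC.rpow_nonneg, fun t ξ h0 hξ => ?_⟩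
  rw [CFC.rpow_eq_cfc_real (ha := hB0)]
  exact cfc_apply_eigenvector hB.isSelfAdjoint h0 hξ
    (Real.continuous_rpow_const hα.le).continuousOn

/-- A decomposition of a self-adjoint operator into positive operators with product zero is unique,
so any such decomposition computes the extension. -/
lemma linearExtension_eq (τ : (H →L[ℂ] H) → ℝ≥0∞) {T a b c d : H →L[ℂ] H}
    (hT : T = (a - b) + Complex.I • (c - d)) (ha : a.IsPositive) (hb : b.IsPositive)
    (hc : c.IsPositive) (hd : d.IsPositive) (hab : a * b = 0) (hcd : c * d = 0) :
    linearExtension τ T = (((τ a).toReal - (τ b).toReal : ℝ) : ℂ) +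
      (((τ c).toReal - (τ d).toReal : ℝ) : ℂ) * Complex.I := by
  have hsab : IsSelfAdjoint (a - b) := ha.isSelfAdjoint.sub hb.isSelfAdjoint
  have hscd : IsSelfAdjoint (c - d) := hc.isSelfAdjoint.sub hd.isSelfAdjoint
  have hre : (realPart T : H →L[ℂ] H) = a - b := by
    rw [hT, map_add, realPart_I_smul, AddSubgroup.coe_add, NegMemClass.coe_neg,
      hscd.imaginaryPart, hsab.coe_realPart]
    simp
  have him : (imaginaryPart T : H →L[ℂ] H) = c - d := by
    rw [hT, map_add, imaginaryPart_I_smul, AddSubgroup.coe_add, hsab.imaginaryPart,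
      hscd.coe_realPart]
    simp
  have h1 := CFC.posPart_negPart_unique (a := a - b) rfl hab
    ((ContinuousLinearMap.nonneg_iff_isPositive _).2 ha)
    ((ContinuousLinearMap.nonneg_iff_isPositive _).2 hb)
  have h2 := CFC.posPart_negPart_unique (a := c - d) rfl hcd
    ((ContinuousLinearMap.nonneg_iff_isPositive _).2 hc)
    ((ContinuousLinearMap.nonneg_iff_isPositive _).2 hd)
  rw [linearExtension, hre, him, h1.1, h1.2, h2.1, h2.2]

end Eigenvector

section Diagonal

variable {ι : Type}

/-- The diagonal operator with real entries. -/
def realDiag (c : ι → ℝ) (hc : ∃ C : ℝ, ∀ i, ‖(c i : ℂ)‖ ≤ C) : L2 ι →L[ℂ] L2 ι :=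
  weighted (Equiv.refl ι) (fun i => (c i : ℂ)) hc

@[simp] lemma realDiag_apply (c : ι → ℝ) (hc : ∃ C : ℝ, ∀ i, ‖(c i : ℂ)‖ ≤ C) (ξ : L2 ι) (i : ι) :
    realDiag c hc ξ i = c i * ξ i := rfl

lemma bounded_star_comp (e : Equiv.Perm ι) {c : ι → ℂ} (hc : ∃ C : ℝ, ∀ i, ‖c i‖ ≤ C) :
    ∃ C : ℝ, ∀ i, ‖star (c (e.symm i))‖ ≤ C := by
  obtain ⟨C, hC⟩ := hc
  exact ⟨C, fun i => by rw [norm_star]; exact hC _⟩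

lemma star_weighted (e : Equiv.Perm ι) (c : ι → ℂ) (hc : ∃ C : ℝ, ∀ i, ‖c i‖ ≤ C) :
    star (weighted e c hc) =
      weighted e.symm (fun i => star (c (e.symm i))) (bounded_star_comp e hc) := by
  rw [ContinuousLinearMap.star_eq_adjoint, eq_comm, ContinuousLinearMap.eq_adjoint_iff]
  intro ξ η
  rw [lp.inner_eq_tsum, lp.inner_eq_tsum, ← e.tsum_eq]
  refine tsum_congr fun i => ?_
  simp
  ring

lemma hasSum_reApplyInnerSelf_realDiag (c : ι → ℝ) (hc : ∃ C : ℝ, ∀ i, ‖(c i : ℂ)‖ ≤ C)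
    (ξ : L2 ι) :
    HasSum (fun i => c i * ‖ξ i‖ ^ 2) ((realDiag c hc).reApplyInnerSelf ξ) := by
  have h : HasSum _ ((realDiag c hc).reApplyInnerSelf ξ) :=
    Complex.hasSum_re (lp.hasSum_inner (𝕜 := ℂ) (realDiag c hc ξ) ξ)
  convert h using 2 with i
  symm
  rw [realDiag_apply, ← smul_eq_mul, inner_smul_left, Complex.conj_ofReal, Complex.re_ofReal_mul,
    inner_self_eq_norm_sq_to_K]
  norm_cast

lemma bounded_mul {c d : ι → ℝ} (hc : ∃ C : ℝ, ∀ i, ‖(c i : ℂ)‖ ≤ C)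
    (hd : ∃ C : ℝ, ∀ i, ‖(d i : ℂ)‖ ≤ C) : ∃ C : ℝ, ∀ i, ‖((c i * d i : ℝ) : ℂ)‖ ≤ C := by
  obtain ⟨C, hC⟩ := hc
  obtain ⟨D, hD⟩ := hd
  refine ⟨C * D, fun i => ?_⟩
  have := (norm_nonneg _).trans (hC i)
  rw [Complex.ofReal_mul, norm_mul]
  gcongr
  exacts [hC i, hD i]

lemma bounded_add {c d : ι → ℝ} (hc : ∃ C : ℝ, ∀ i, ‖(c i : ℂ)‖ ≤ C)
    (hd : ∃ C : ℝ, ∀ i, ‖(d i : ℂ)‖ ≤ C) : ∃ C : ℝ, ∀ i, ‖((c i + d i : ℝ) : ℂ)‖ ≤ C := by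
  obtain ⟨C, hC⟩ := hc
  obtain ⟨D, hD⟩ := hd
  refine ⟨C + D, fun i => ?_⟩
  rw [Complex.ofReal_add]
  exact (norm_add_le _ _).trans (add_le_add (hC i) (hD i))

lemma bounded_of_abs_le {c d : ι → ℝ} (hd : ∃ C : ℝ, ∀ i, ‖(d i : ℂ)‖ ≤ C)
    (h : ∀ i, |c i| ≤ |d i|) : ∃ C : ℝ, ∀ i, ‖(c i : ℂ)‖ ≤ C := by
  obtain ⟨D, hD⟩ := hd
  refine ⟨D, fun i => ?_⟩
  have := hD i
  rw [Complex.norm_real, Real.norm_eq_abs] at this ⊢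
  exact (h i).trans this

lemma bounded_comp {c : ι → ℝ} (hc : ∃ C : ℝ, ∀ i, ‖(c i : ℂ)‖ ≤ C) (e : ι → ι) :
    ∃ C : ℝ, ∀ i, ‖(c (e i) : ℂ)‖ ≤ C := by
  obtain ⟨C, hC⟩ := hc
  exact ⟨C, fun i => hC _⟩

lemma bounded_rpow {c : ι → ℝ} (hc0 : ∀ i, 0 ≤ c i) (hc : ∃ C : ℝ, ∀ i, ‖(c i : ℂ)‖ ≤ C) {α : ℝ}
    (hα : 0 ≤ α) : ∃ C : ℝ, ∀ i, ‖((c i ^ α : ℝ) : ℂ)‖ ≤ C := by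
  obtain ⟨C, hC⟩ := hc
  refine ⟨C ^ α, fun i => ?_⟩
  have := hC i
  rw [Complex.norm_real, Real.norm_eq_abs, abs_of_nonneg (hc0 i)] at this
  rw [Complex.norm_real, Real.norm_eq_abs, abs_of_nonneg (Real.rpow_nonneg (hc0 i) _)]
  exact Real.rpow_le_rpow (hc0 i) this hα

lemma bounded_posPart {c : ι → ℝ} (hc : ∃ C : ℝ, ∀ i, ‖(c i : ℂ)‖ ≤ C) :
    ∃ C : ℝ, ∀ i, ‖(((c i)⁺ : ℝ) : ℂ)‖ ≤ C :=
  bounded_of_abs_le hc fun i => by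
    rw [abs_of_nonneg (posPart_nonneg _), posPart_def]
    exact max_le (le_abs_self _) (abs_nonneg _)

lemma bounded_negPart {c : ι → ℝ} (hc : ∃ C : ℝ, ∀ i, ‖(c i : ℂ)‖ ≤ C) :
    ∃ C : ℝ, ∀ i, ‖(((c i)⁻ : ℝ) : ℂ)‖ ≤ C :=
  bounded_of_abs_le hc fun i => by
    rw [abs_of_nonneg (negPart_nonneg _), negPart_def]
    exact max_le (neg_le_abs _) (abs_nonneg _)

lemma isSelfAdjoint_realDiag (c : ι → ℝ) (hc : ∃ C : ℝ, ∀ i, ‖(c i : ℂ)‖ ≤ C) :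
    IsSelfAdjoint (realDiag c hc) := by
  rw [IsSelfAdjoint, realDiag, star_weighted]
  ext ξ i
  simp

lemma isPositive_realDiag {c : ι → ℝ} (hc0 : ∀ i, 0 ≤ c i)
    (hc : ∃ C : ℝ, ∀ i, ‖(c i : ℂ)‖ ≤ C) : (realDiag c hc).IsPositive := by
  rw [ContinuousLinearMap.isPositive_def']
  exact ⟨isSelfAdjoint_realDiag c hc, fun ξ =>
    (hasSum_reApplyInnerSelf_realDiag c hc ξ).nonneg fun i => mul_nonneg (hc0 i) (by positivity)⟩

lemma realDiag_add {c d : ι → ℝ} (hc : ∃ C : ℝ, ∀ i, ‖(c i : ℂ)‖ ≤ C)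
    (hd : ∃ C : ℝ, ∀ i, ‖(d i : ℂ)‖ ≤ C) :
    realDiag (fun i => c i + d i) (bounded_add hc hd) = realDiag c hc + realDiag d hd := by
  ext ξ i
  simp [add_mul]

/-- The permutation drops out of `T* T`, which is diagonal with entries `c²`; hence `|T|` is
diagonal with entries `c`. The power acts on the basis vectors by `c ^ α`, and self-adjointness
turns this into a formula for the coordinates of every vector. -/
lemma SpectralTriple.absPowNeg_eq_realDiag {A : Type} [Ring A] [StarRing A] [Algebra ℂ A]
    (T : SpectralTriple A (L2 ι)) (e : Equiv.Perm ι) {c : ι → ℝ} (hc0 : ∀ i, 0 ≤ c i)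
    (hce : ∀ i, c (e i) = c i) (hc : ∃ C : ℝ, ∀ i, ‖(c i : ℂ)‖ ≤ C)
    (hT : T.inv = weighted e (fun i => (c i : ℂ)) hc) {α : ℝ} (hα : 0 < α) :
    T.absPowNeg α = realDiag (fun i => c i ^ α) (bounded_rpow hc0 hc hα.le) := by
  classical
  have hs : ∀ i, c (e.symm i) = c i := fun i => by rw [← hce (e.symm i), e.apply_symm_apply]
  obtain ⟨hsa, heig⟩ := abs_rpow_apply_eigenvector (T := T.inv) (isPositive_realDiag hc0 hc) (by
    rw [hT, star_weighted]
    ext ξ i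
    simp [hs]) hα
  change IsSelfAdjoint (T.absPowNeg α) at hsa
  ext ξ i
  have h1 : realDiag c hc (lp.single 2 i 1) = (c i : ℂ) • (lp.single 2 i 1 : L2 ι) := by
    ext j
    change (c j : ℂ) * (lp.single 2 i 1 : L2 ι) j = (c i : ℂ) * (lp.single 2 i 1 : L2 ι) j
    by_cases hj : j = i
    · rw [hj]
    · simp [hj]
  have h0 : (lp.single 2 i 1 : L2 ι) ≠ 0 := fun h => by
    have := congrArg (fun η : L2 ι => η i) h
    simp at this
  have h2 : T.absPowNeg α (lp.single 2 i 1) = _ := heig _ _ h0 h1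
  have h4 := ContinuousLinearMap.adjoint_inner_left (T.absPowNeg α) ξ (lp.single 2 i 1)
  rw [← ContinuousLinearMap.star_eq_adjoint, hsa.star_eq, h2, inner_smul_left,
    lp.inner_single_left, lp.inner_single_left] at h4
  simpa [mul_comm] using h4.symm

lemma bounded_re {c : ι → ℂ} (hc : ∃ C : ℝ, ∀ i, ‖c i‖ ≤ C) :
    ∃ C : ℝ, ∀ i, ‖((c i).re : ℂ)‖ ≤ C := by
  obtain ⟨C, hC⟩ := hc
  exact ⟨C, fun i => by
    rw [Complex.norm_real]; exact (Complex.abs_re_le_norm _).trans (hC i)⟩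

lemma bounded_im {c : ι → ℂ} (hc : ∃ C : ℝ, ∀ i, ‖c i‖ ≤ C) :
    ∃ C : ℝ, ∀ i, ‖((c i).im : ℂ)‖ ≤ C := by
  obtain ⟨C, hC⟩ := hc
  exact ⟨C, fun i => by
    rw [Complex.norm_real]; exact (Complex.abs_im_le_norm _).trans (hC i)⟩

lemma linearExtension_weighted_refl (τ : (L2 ι →L[ℂ] L2 ι) → ℝ≥0∞) (c : ι → ℂ)
    (hc : ∃ C : ℝ, ∀ i, ‖c i‖ ≤ C) : linearExtension τ (weighted (Equiv.refl ι) c hc) =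
      (((τ (realDiag (fun i => (c i).re⁺) (bounded_posPart (bounded_re hc)))).toReal -
        (τ (realDiag (fun i => (c i).re⁻) (bounded_negPart (bounded_re hc)))).toReal : ℝ) : ℂ) +
      (((τ (realDiag (fun i => (c i).im⁺) (bounded_posPart (bounded_im hc)))).toReal -
        (τ (realDiag (fun i => (c i).im⁻) (bounded_negPart (bounded_im hc)))).toReal : ℝ) : ℂ) *
          Complex.I := by
  have hmul : ∀ (d : ι → ℝ) (hd : ∃ C : ℝ, ∀ i, ‖(d i : ℂ)‖ ≤ C),
      realDiag (fun i => (d i)⁺) (bounded_posPart hd) *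
        realDiag (fun i => (d i)⁻) (bounded_negPart hd) = 0 := by
    intro d hd
    ext ξ i
    simp only [mul_apply_eq_comp, realDiag_apply, zero_apply, lp.coeFn_zero, Pi.zero_apply]
    have h0 : (d i)⁺ * (d i)⁻ = 0 := by
      rcases le_total 0 (d i) with h | h
      · rw [negPart_of_nonneg h, mul_zero]
      · rw [posPart_of_nonpos h, zero_mul]
    rw [← mul_assoc, ← Complex.ofReal_mul, h0]
    simp
  refine linearExtension_eq τ ?_ (isPositive_realDiag (fun i => posPart_nonneg _) _)
    (isPositive_realDiag (fun i => negPart_nonneg _) _)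
    (isPositive_realDiag (fun i => posPart_nonneg _) _)
    (isPositive_realDiag (fun i => negPart_nonneg _) _) (hmul _ (bounded_re hc))
    (hmul _ (bounded_im hc))
  ext ξ i
  change c i * ξ i = (((c i).re⁺ : ℝ) * ξ i - ((c i).re⁻ : ℝ) * ξ i) +
    Complex.I * (((c i).im⁺ : ℝ) * ξ i - ((c i).im⁻ : ℝ) * ξ i)
  rw [← sub_mul, ← sub_mul, ← Complex.ofReal_sub, ← Complex.ofReal_sub, posPart_sub_negPart,
    posPart_sub_negPart]
  nth_rw 1 [← Complex.re_add_im (c i)]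
  ring

/-- A tracial weight is invariant under permutations of the entries of a diagonal operator. -/
lemma IsSingularTrace.realDiag_comp {τ : (L2 ι →L[ℂ] L2 ι) → ℝ≥0∞} (hτ : IsSingularTrace τ)
    (e : Equiv.Perm ι) {c : ι → ℝ} (hc0 : ∀ i, 0 ≤ c i)
    (hc : ∃ C : ℝ, ∀ i, ‖(c i : ℂ)‖ ≤ C) :
    τ (realDiag (fun i => c (e i)) (bounded_comp hc e)) = τ (realDiag c hc) := by
  have hb : ∃ C : ℝ, ∀ i, ‖((c (e i) ^ (2⁻¹ : ℝ) : ℝ) : ℂ)‖ ≤ C :=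
    bounded_comp (bounded_rpow hc0 hc (by norm_num : (0 : ℝ) ≤ 2⁻¹)) e
  have hsq : ∀ i, ((c i ^ (2⁻¹ : ℝ) : ℝ) : ℂ) * ((c i ^ (2⁻¹ : ℝ) : ℝ) : ℂ) = c i := fun i => by
    rw [← Complex.ofReal_mul, ← Real.rpow_add_of_nonneg (hc0 i) (by norm_num) (by norm_num)]
    norm_num
  -- For `(T ξ)(i) = √c(e i) ξ(e i)`, the operators `T* T` and `T T*` are diagonal with entries `c
  -- i` and `c (e i)`.
  have h := hτ.tracial (weighted e (fun i => ((c (e i) ^ (2⁻¹ : ℝ) : ℝ) : ℂ)) hb)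
  rw [star_weighted] at h
  convert h.symm using 2
  · ext ξ i
    simp only [mul_apply_eq_comp, realDiag_apply, weighted_apply,
      Equiv.apply_symm_apply, Equiv.symm_apply_apply, RCLike.star_def, Complex.conj_ofReal]
    rw [← mul_assoc, hsq]
  · ext ξ i
    simp only [mul_apply_eq_comp, realDiag_apply, weighted_apply,
      Equiv.apply_symm_apply, RCLike.star_def, Complex.conj_ofReal]
    rw [← mul_assoc, hsq]

/-- A singular trace vanishes on diagonal operators with finitely many non-zero entries. -/
lemma IsSingularTrace.realDiag_eq_zero {τ : (L2 ι →L[ℂ] L2 ι) → ℝ≥0∞} (hτ : IsSingularTrace τ)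
    {c : ι → ℝ} (hc0 : ∀ i, 0 ≤ c i) (hc : ∃ C : ℝ, ∀ i, ‖(c i : ℂ)‖ ≤ C) {s : Set ι}
    (hs : s.Finite) (hcs : ∀ i ∉ s, c i = 0) : τ (realDiag c hc) = 0 := by
  classical
  induction s, hs using Set.Finite.induction_on generalizing c with
  | empty =>
    have h : realDiag c hc = ((((0 : ℝ≥0) : ℝ) : ℂ)) • realDiag c hc := by
      ext ξ i
      simp [hcs i (by simp)]
    rw [h, hτ.map_smul 0 _ (isPositive_realDiag hc0 hc)]
    simp
  | @insert a s ha hs ih =>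
    have hb1 : ∃ C : ℝ, ∀ i, ‖((if i = a then 1 else 0 : ℝ) : ℂ)‖ ≤ C :=
      ⟨1, fun i => by split_ifs <;> simp⟩
    have hb2 : ∃ C : ℝ, ∀ i, ‖((if i = a then 0 else c i : ℝ) : ℂ)‖ ≤ C :=
      bounded_of_abs_le hc fun i => by split_ifs <;> simp
    have h01 : ∀ i, (0 : ℝ) ≤ if i = a then 1 else 0 := fun i => by split_ifs <;> simp
    have h02 : ∀ i, (0 : ℝ) ≤ if i = a then 0 else c i := fun i => by
      split_ifs; exacts [le_rfl, hc0 i]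
    obtain ⟨k, hk⟩ : ∃ k : ℝ≥0, (k : ℝ) = c a := ⟨⟨c a, hc0 a⟩, rfl⟩
    have hsm : ((((k : ℝ) : ℂ)) • realDiag _ hb1).IsPositive :=
      (isPositive_realDiag h01 hb1).smul_of_nonneg (by simp)
    have h : realDiag c hc = (((k : ℝ) : ℂ)) • realDiag _ hb1 +
        realDiag _ hb2 := by
      ext ξ i
      change _ = ((k : ℝ) : ℂ) * (((if i = a then 1 else 0 : ℝ) : ℂ) * ξ i) +
        ((if i = a then 0 else c i : ℝ) : ℂ) * ξ i
      by_cases hi : i = a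
      · subst hi; simp [hk]
      · simp [hi]
    rw [h, hτ.map_add _ _ hsm (isPositive_realDiag h02 hb2),
      hτ.map_smul _ _ (isPositive_realDiag h01 hb1), ih h02 hb2, add_zero]
    · suffices h : τ (realDiag _ hb1) = 0 by rw [h, mul_zero]
      refine hτ.singular _ ⟨?_, isSelfAdjoint_realDiag _ _⟩ ?_
      · rw [IsIdempotentElem]
        ext ξ i
        by_cases hi : i = a <;> simp [hi]
      · refine Submodule.finiteDimensional_of_le
          (S₂ := Submodule.span ℂ {(lp.single 2 a 1 : L2 ι)}) ?_
        rintro _ ⟨ξ, rfl⟩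
        rw [Submodule.mem_span_singleton]
        refine ⟨ξ a, ?_⟩
        ext i
        by_cases hi : i = a
        · subst hi; simp
        · simp [hi]
    · intro i hi
      by_cases hia : i = a
      · simp [hia]
      · simp only [hia, if_false]
        exact hcs i (by simp [hia, hi])

end Diagonal
end FractalNCG

namespace FractalNCG

/-! ### Slowly varying stretches of critical sequences -/

section Critical

/-- Level data: `b j` is the contribution of level `j` to a sum, `t j` the value on level `j`, and
`h j` the value on level `j` times the number of preceding terms. -/
structure LevelData (b h t : ℕ → ℝ) (ρ : ℝ) : Prop where
  b_pos : ∀ j, 0 < b j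
  h_nonneg : ∀ j, 0 ≤ h j
  t_pos : ∀ j, 0 < t j
  step : ∀ j, h (j + 1) = t (j + 1) / t j * (h j + b j)
  ratio_le : ∀ j, t (j + 1) / t j ≤ ρ
  ratio_lt_one : ρ < 1

namespace LevelData

variable {b h t : ℕ → ℝ} {ρ : ℝ} (D : LevelData b h t ρ)
include D

lemma ratio_pos (j : ℕ) : 0 < t (j + 1) / t j := div_pos (D.t_pos _) (D.t_pos _)

lemma rho_pos : 0 < ρ := (D.ratio_pos 0).trans_le (D.ratio_le 0)

lemma t_antitone : Antitone t := antitone_nat_of_succ_le fun j => by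
  have := (D.ratio_le j).trans D.ratio_lt_one.le
  rwa [div_le_one (D.t_pos j)] at this

lemma t_le (j : ℕ) : t j ≤ ρ ^ j * t 0 := by
  induction j with
  | zero => simp
  | succ j ih =>
    have := D.ratio_le j
    rw [div_le_iff₀ (D.t_pos j)] at this
    calc t (j + 1) ≤ ρ * t j := this
      _ ≤ ρ * (ρ ^ j * t 0) := by gcongr; exact D.rho_pos.le
      _ = _ := by ring

lemma h_succ_le (j : ℕ) : h (j + 1) ≤ ρ * h j + b j := by
  have h1 := D.step j
  have h2 := D.ratio_le j
  have h3 := D.h_nonneg j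
  have h4 := (D.b_pos j).le
  rw [h1]
  calc t (j + 1) / t j * (h j + b j) ≤ ρ * (h j + b j) := by gcongr
    _ ≤ ρ * h j + 1 * b j := by rw [mul_add]; gcongr; exact D.ratio_lt_one.le
    _ = _ := by ring

lemma h_add_le (n L : ℕ) :
    h (n + L) ≤ ρ ^ L * h n +
      (∑ j ∈ Finset.range (n + L), b j - ∑ j ∈ Finset.range n, b j) := by
  induction L with
  | zero => simp
  | succ L ih =>
    have h1 := D.h_succ_le (n + L)
    have h2 : ∑ j ∈ Finset.range n, b j ≤ ∑ j ∈ Finset.range (n + L), b j :=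
      Finset.sum_le_sum_of_subset_of_nonneg (Finset.range_mono (by omega))
        fun j _ _ => (D.b_pos j).le
    have h3 := D.ratio_lt_one
    have h4 := D.rho_pos
    rw [← add_assoc, Finset.sum_range_succ, pow_succ]
    nlinarith

lemma sum_mul_le_sum_mul_rpow {η : ℝ} (hη : 0 ≤ η) (n : ℕ) :
    (∑ j ∈ Finset.range n, b j) * t n ^ η ≤ ∑ j ∈ Finset.range n, b j * t j ^ η := by
  rw [Finset.sum_mul]
  refine Finset.sum_le_sum fun j hj => ?_
  have := D.t_antitone (Finset.mem_range.1 hj).le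
  have := (D.b_pos j).le
  have := (D.t_pos n).le
  gcongr

/-- If the sums over levels are controlled by the boundary terms and diverge, then they diverge
exponentially, hence also after a small perturbation of the exponent. -/
lemma not_summable_of_divergent (hb : ¬ Summable b) {M : ℝ} (hM : 1 ≤ M) {K : ℕ}
    (hMK : ∀ n, K < n → ∑ j ∈ Finset.range n, b j - ∑ j ∈ Finset.range K, b j ≤ M * (h K + h n)) :
    ∃ η > (0 : ℝ), ¬ Summable fun j => b j * t j ^ η := by
  set A : ℕ → ℝ := fun n => ∑ j ∈ Finset.range n, b j with hA
  have hAt : Tendsto A atTop atTop :=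
    (not_summable_iff_tendsto_nat_atTop_of_nonneg fun j => (D.b_pos j).le).1 hb
  obtain ⟨n₀, hn₀⟩ := eventually_atTop.1 ((eventually_gt_atTop K).and
    ((hAt.eventually_ge_atTop (2 * (A K + M * h K))).and
      ((hAt.eventually_ge_atTop (h 0)).and (hAt.eventually_ge_atTop 1))))
  -- Once `A n` is at least twice the fixed contribution of `K`, the hypothesis bounds it by `2 M h
  -- n`. The recursion gives the reverse bound `h n ≤ 2 A n`, so `A` and `h` are comparable.
  have hlow : ∀ n, n₀ ≤ n → A n ≤ 2 * M * h n := fun n hn => by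
    obtain ⟨h1, h2, -, -⟩ := hn₀ n hn
    have := hMK n h1
    simp only [hA] at h2 ⊢
    linarith
  have hup : ∀ n, n₀ ≤ n → h n ≤ 2 * A n := fun n hn => by
    obtain ⟨-, -, h3, -⟩ := hn₀ n hn
    have := D.h_add_le 0 n
    have h5 : ρ ^ n * h 0 ≤ 1 * h 0 :=
      mul_le_mul_of_nonneg_right (pow_le_one₀ D.rho_pos.le D.ratio_lt_one.le) (D.h_nonneg 0)
    simp only [zero_add, Finset.range_zero, Finset.sum_empty, sub_zero] at this
    simp only [hA] at h3 ⊢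
    linarith
  have hApos : ∀ n, n₀ ≤ n → 1 ≤ A n := fun n hn => (hn₀ n hn).2.2.2
  -- Comparability at `n + 1`, inserted in the recursion for `h`, forces `t (n + 1) / t n ≥ 1 / (4
  -- M)`: the values cannot drop arbitrarily fast.
  set κ : ℝ := 1 / (4 * M) with hκ
  have hM0 : 0 < M := by linarith
  have hκ0 : 0 < κ := by positivity
  have hκ1 : κ < 1 := by rw [hκ, div_lt_one (by positivity)]; linarith
  have hκM : κ * M = 1 / 4 := by rw [hκ]; field_simp
  have hq : ∀ n, n₀ ≤ n → κ * t n ≤ t (n + 1) := fun n hn => by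
    have h1 := hlow (n + 1) (by omega)
    have h2 := hup n hn
    rw [D.step] at h1
    have h3 : h n + b n ≤ 2 * A (n + 1) := by
      have := D.b_pos n
      simp only [hA] at h2 ⊢
      rw [Finset.sum_range_succ]
      linarith
    have h4 := D.ratio_pos n
    have h5 := hApos (n + 1) (by omega)
    rw [← le_div_iff₀ (D.t_pos n)]
    have h6 : A (n + 1) ≤ 2 * M * (t (n + 1) / t n * (2 * A (n + 1))) := h1.trans (by gcongr)
    have h7 : 1 ≤ 4 * M * (t (n + 1) / t n) := by
      by_contra! hc
      nlinarith
    calc κ = κ * 1 := by ring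
      _ ≤ κ * (4 * M * (t (n + 1) / t n)) := by gcongr
      _ = 4 * (κ * M) * (t (n + 1) / t n) := by ring
      _ = _ := by rw [hκM]; ring
  -- After `L` levels the old part of `h` is at most `κ A n`, whereas `h (n + L) ≥ 2 κ A (n + L)`.
  -- The difference must come from new terms, so `A` grows by the factor `1 + κ` over `L` levels.
  obtain ⟨L, hL⟩ := exists_pow_lt_of_lt_one (half_pos hκ0) D.ratio_lt_one
  have hql : ∀ n, n₀ ≤ n → ∀ l, κ ^ l * t n ≤ t (n + l) := fun n hn l => by
    induction l with
    | zero => simp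
    | succ l ih =>
      have := hq (n + l) (by omega)
      calc κ ^ (l + 1) * t n = κ * (κ ^ l * t n) := by ring
        _ ≤ κ * t (n + l) := by gcongr
        _ ≤ _ := this
  have hgrow : ∀ n, n₀ ≤ n → (1 + κ) * A n ≤ A (n + L) := fun n hn => by
    have h1 := D.h_add_le n L
    have h2 := hlow (n + L) (by omega)
    have h3 := hup n hn
    have h4 := hApos n hn
    have h5 : ρ ^ L * h n ≤ κ / 2 * (2 * A n) := by
      have := D.h_nonneg n
      have := pow_pos D.rho_pos L
      gcongr
    have h6 : A n ≤ A (n + L) := Finset.sum_le_sum_of_subset_of_nonneg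
      (Finset.range_mono (by omega)) fun j _ _ => (D.b_pos j).le
    have h7 : h (n + L) ≤ κ * A n + (A (n + L) - A n) := by
      simp only [hA] at h5 ⊢
      linarith
    have h8 : 2 * κ * A (n + L) ≤ h (n + L) := by
      have : κ * (A (n + L)) ≤ κ * (2 * M * h (n + L)) := by gcongr
      have e : κ * (2 * M * h (n + L)) = h (n + L) / 2 := by
        calc _ = 2 * (κ * M) * h (n + L) := by ring
          _ = _ := by rw [hκM]; ring
      linarith
    nlinarith
  -- The weight `t ^ η` costs at most the factor `(κ ^ L) ^ η` per `L` levels, close to `1` for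
  -- small `η`. So `A t ^ η` still grows geometrically, although convergence of the perturbed series
  -- would bound it.
  obtain ⟨η, hη0, hη⟩ : ∃ η > (0 : ℝ), 1 + κ / 2 < (1 + κ) * (κ ^ L) ^ η := by
    have ht : Tendsto (fun η : ℝ => (1 + κ) * (κ ^ L) ^ η) (𝓝[>] 0) (𝓝 ((1 + κ) * (κ ^ L) ^ (0 : ℝ))) := by
      refine Tendsto.mono_left ?_ nhdsWithin_le_nhds
      exact ((Real.continuous_const_rpow (pow_pos hκ0 L).ne').tendsto 0).const_mul _
    rw [Real.rpow_zero, mul_one] at ht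
    obtain ⟨η, h1, h2⟩ := ((ht.eventually_const_lt (by linarith : 1 + κ / 2 < 1 + κ)).and
      self_mem_nhdsWithin).exists
    exact ⟨η, h2, h1⟩
  refine ⟨η, hη0, fun hs => ?_⟩
  have hstep : ∀ k, (1 + κ / 2) ^ k * (A n₀ * t n₀ ^ η) ≤ A (n₀ + k * L) * t (n₀ + k * L) ^ η := by
    intro k
    induction k with
    | zero => simp
    | succ k ih =>
      have h1 := hgrow (n₀ + k * L) (by omega)
      have h2 := hql (n₀ + k * L) (by omega) L
      have h3 := hApos (n₀ + k * L) (by omega)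
      have e : n₀ + (k + 1) * L = n₀ + k * L + L := by ring
      have h4 := (D.t_pos (n₀ + k * L))
      rw [e]
      calc (1 + κ / 2) ^ (k + 1) * (A n₀ * t n₀ ^ η)
          = (1 + κ / 2) * ((1 + κ / 2) ^ k * (A n₀ * t n₀ ^ η)) := by ring
        _ ≤ ((1 + κ) * (κ ^ L) ^ η) * (A (n₀ + k * L) * t (n₀ + k * L) ^ η) := by
            refine mul_le_mul hη.le ih ?_ (by positivity)
            have := hApos n₀ le_rfl
            have := D.t_pos n₀
            positivity
        _ = ((1 + κ) * A (n₀ + k * L)) * (κ ^ L * t (n₀ + k * L)) ^ η := by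
            rw [Real.mul_rpow (by positivity) h4.le]; ring
        _ ≤ _ := by
            have h5 : 0 ≤ A (n₀ + k * L + L) := zero_le_one.trans (hApos _ (by omega))
            gcongr
  have hbd : ∀ n, A n * t n ^ η ≤ ∑' j, b j * t j ^ η := fun n =>
    (D.sum_mul_le_sum_mul_rpow hη0.le n).trans (hs.sum_le_tsum _ fun j _ =>
      mul_nonneg (D.b_pos j).le (Real.rpow_nonneg (D.t_pos j).le _))
  have hinf : Tendsto (fun k : ℕ => (1 + κ / 2) ^ k * (A n₀ * t n₀ ^ η)) atTop atTop := by
    refine (tendsto_pow_atTop_atTop_of_one_lt (by linarith)).atTop_mul_const ?_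
    have := hApos n₀ le_rfl
    have := D.t_pos n₀
    positivity
  obtain ⟨k, hk⟩ := (hinf.eventually_gt_atTop (∑' j, b j * t j ^ η)).exists
  exact absurd ((hstep k).trans (hbd _)) (not_le.2 hk)

/-- Sum `h (j + 1) ≤ ρ h j + b j` and absorb `ρ ∑ h` into the left side. -/
lemma summable_h (hb : Summable b) : Summable h := by
  refine summable_of_sum_range_le (c := (h 0 + ∑' j, b j) / (1 - ρ)) D.h_nonneg fun n => ?_
  have h1 := D.ratio_lt_one
  rw [le_div_iff₀ (by linarith)]
  have h2 : ∑ j ∈ Finset.range (n + 1), h j ≤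
      h 0 + (ρ * ∑ j ∈ Finset.range n, h j + ∑' j, b j) := by
    rw [Finset.sum_range_succ', add_comm]
    gcongr
    calc ∑ j ∈ Finset.range n, h (j + 1) ≤ ∑ j ∈ Finset.range n, (ρ * h j + b j) :=
          Finset.sum_le_sum fun j _ => D.h_succ_le j
      _ ≤ _ := by
          rw [Finset.sum_add_distrib, Finset.mul_sum]
          gcongr
          exact hb.sum_le_tsum _ fun j _ => (D.b_pos j).le
  rw [Finset.sum_range_succ] at h2
  have := D.h_nonneg n
  linarith

/-- If the sums over levels are controlled by the boundary terms and converge, then they converge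
exponentially, hence also after a small perturbation of the exponent. -/
lemma summable_of_convergent (hb : Summable b) {M : ℝ} (hM : 1 ≤ M) {K : ℕ}
    (hMK : ∀ k n, K ≤ k → k < n →
      ∑ j ∈ Finset.range n, b j - ∑ j ∈ Finset.range k, b j ≤ M * (h k + h n)) :
    ∃ η > (0 : ℝ), η < 1 ∧ Summable fun j => b j * t j ^ (-η) := by
  set R : ℕ → ℝ := fun n => ∑' j, b j - ∑ j ∈ Finset.range n, b j with hR
  have hR0 : ∀ n, 0 ≤ R n := fun n => sub_nonneg.2 (hb.sum_le_tsum _ fun j _ => (D.b_pos j).le)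
  have hRs : ∀ n, R (n + 1) = R n - b n := fun n => by
    simp only [hR, Finset.sum_range_succ]; ring
  have hh0 := (D.summable_h hb).tendsto_atTop_zero
  have hRM : ∀ k, K ≤ k → R k ≤ M * h k := fun k hk => by
    have h1 : Tendsto (fun n => ∑ j ∈ Finset.range n, b j - ∑ j ∈ Finset.range k, b j) atTop
        (𝓝 (R k)) := hb.hasSum.tendsto_sum_nat.sub_const _
    have h2 : Tendsto (fun n => M * (h k + h n)) atTop (𝓝 (M * h k)) := by
      simpa using (hh0.const_add (h k)).const_mul M
    exact le_of_tendsto_of_tendsto h1 h2 ((eventually_gt_atTop k).mono fun n hn => hMK k n hk hn)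
  -- Boundary term plus tail. It decreases by a fixed factor `σ < 1` at every level, because `h k ≥
  -- Φ k / (M + 1)`, and by the factor `(M + 1) q` where the values drop by `q`.
  set Φ : ℕ → ℝ := fun n => h n + R n with hΦ
  have hΦ0 : ∀ n, 0 ≤ Φ n := fun n => add_nonneg (D.h_nonneg n) (hR0 n)
  set σ : ℝ := 1 - (1 - ρ) / (M + 1) with hσ
  have hρ := D.ratio_lt_one
  have hρ0 := D.rho_pos
  have hσ1 : σ < 1 := by
    have : 0 < (1 - ρ) / (M + 1) := div_pos (by linarith) (by linarith)
    linarith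
  have hstep1 : ∀ k, K ≤ k → Φ (k + 1) ≤ σ * Φ k := fun k hk => by
    have h1 := hRM k hk
    have h2 := D.h_nonneg k
    have h3 := D.b_pos k
    have h4 : Φ (k + 1) ≤ Φ k - (1 - ρ) * h k := by
      have : h (k + 1) ≤ ρ * h k + b k := D.h_succ_le k
      simp only [hΦ, hRs]
      linarith
    have h5 : Φ k / (M + 1) ≤ h k := by
      rw [div_le_iff₀ (by linarith)]
      simp only [hΦ]
      linarith
    have h6 : (1 - ρ) * (Φ k / (M + 1)) ≤ (1 - ρ) * h k :=
      mul_le_mul_of_nonneg_left h5 (by linarith)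
    calc Φ (k + 1) ≤ Φ k - (1 - ρ) * (Φ k / (M + 1)) := by linarith
      _ = σ * Φ k := by rw [hσ]; ring
  have hstep2 : ∀ k, K ≤ k → Φ (k + 1) ≤ (M + 1) * (t (k + 1) / t k) * Φ k := fun k hk => by
    have h1 := hRM (k + 1) (by omega)
    have h2 : b k ≤ R k := by
      have := hR0 (k + 1)
      rw [hRs] at this
      linarith
    have h3 := (D.ratio_pos k).le
    calc Φ (k + 1) ≤ (M + 1) * h (k + 1) := by simp only [hΦ]; linarith
      _ = (M + 1) * (t (k + 1) / t k) * (h k + b k) := by rw [D.step]; ring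
      _ ≤ _ := by
          have : 0 ≤ (M + 1) * (t (k + 1) / t k) := mul_nonneg (by linarith) h3
          simp only [hΦ]
          gcongr
  -- The threshold between the two estimates: for `q ≤ w` one has `(M + 1) q ≤ √q ≤ q ^ η` as `η ≤ 1
  -- / 2`, and for `q ≥ w` one has `σ < w ^ η ≤ q ^ η`. Either way `Φ` decreases at least as fast as
  -- `t ^ η`.
  set w : ℝ := 1 / (M + 1) ^ 2 with hw
  have hw0 : 0 < w := by positivity
  obtain ⟨η, hη0, hη1, hη⟩ : ∃ η > (0 : ℝ), η ≤ 1 / 2 ∧ σ < w ^ η := by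
    have ht : Tendsto (fun η : ℝ => w ^ η) (𝓝[>] 0) (𝓝 (w ^ (0 : ℝ))) :=
      Tendsto.mono_left ((Real.continuous_const_rpow hw0.ne').tendsto 0) nhdsWithin_le_nhds
    rw [Real.rpow_zero] at ht
    obtain ⟨η, ⟨h1, h2⟩, h3⟩ := (((ht.eventually_const_lt hσ1).and self_mem_nhdsWithin).and
      (nhdsWithin_le_nhds (Iic_mem_nhds (by norm_num : (0 : ℝ) < 1 / 2)))).exists
    exact ⟨η, h2, h3, h1⟩
  have hstep : ∀ k, K ≤ k → Φ (k + 1) ≤ (t (k + 1) / t k) ^ η * Φ k := fun k hk => by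
    set q := t (k + 1) / t k with hq
    have hq0 : 0 < q := D.ratio_pos k
    have hq1 : q ≤ 1 := (D.ratio_le k).trans hρ.le
    rcases le_total q w with h1 | h1
    · refine (hstep2 k hk).trans (mul_le_mul_of_nonneg_right ?_ (hΦ0 k))
      calc (M + 1) * q ≤ q ^ (1 / 2 : ℝ) := by
            rw [← Real.sqrt_eq_rpow]
            refine Real.le_sqrt_of_sq_le ?_
            have : q * (M + 1) ^ 2 ≤ 1 := by
              rwa [hw, le_div_iff₀ (by positivity)] at h1
            nlinarith
        _ ≤ q ^ η := Real.rpow_le_rpow_of_exponent_ge hq0 hq1 hη1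
    · refine (hstep1 k hk).trans (mul_le_mul_of_nonneg_right ?_ (hΦ0 k))
      exact hη.le.trans (Real.rpow_le_rpow hw0.le h1 hη0.le)
  have hbd : ∀ l, Φ (K + l) ≤ Φ K / t K ^ η * t (K + l) ^ η := fun l => by
    induction l with
    | zero => rw [add_zero, div_mul_cancel₀ _ (Real.rpow_pos_of_pos (D.t_pos K) _).ne']
    | succ l ih =>
      have h1 := hstep (K + l) (by omega)
      have h2 := D.t_pos (K + l)
      have h3 := D.t_pos (K + l + 1)
      rw [← add_assoc]
      calc Φ (K + l + 1) ≤ (t (K + l + 1) / t (K + l)) ^ η * Φ (K + l) := h1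
        _ ≤ (t (K + l + 1) / t (K + l)) ^ η * (Φ K / t K ^ η * t (K + l) ^ η) := by gcongr
        _ = _ := by
            rw [Real.div_rpow h3.le h2.le]
            have := (Real.rpow_pos_of_pos h2 η).ne'
            field_simp
  -- Half of the decay `t ^ η` pays for the perturbation; the remaining `t ^ (η / 2)` is
  -- geometrically small.
  refine ⟨η / 2, by positivity, by linarith, ?_⟩
  have hC0 : 0 ≤ Φ K / t K ^ η := div_nonneg (hΦ0 K) (Real.rpow_nonneg (D.t_pos K).le _)
  have hgeo : Summable fun j : ℕ => Φ K / t K ^ η * ((ρ ^ (η / 2)) ^ j * t 0 ^ (η / 2)) := by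
    refine ((summable_geometric_of_lt_one (Real.rpow_nonneg hρ0.le _) ?_).mul_right _).mul_left _
    exact Real.rpow_lt_one hρ0.le hρ (by positivity)
  refine Summable.of_norm_bounded_eventually_nat hgeo ?_
  filter_upwards [eventually_ge_atTop K] with j hj
  obtain ⟨l, rfl⟩ := Nat.exists_eq_add_of_le hj
  have htp := D.t_pos (K + l)
  have hb0 := D.b_pos (K + l)
  rw [Real.norm_of_nonneg (by positivity)]
  have h2 : b (K + l) ≤ Φ (K + l) := by
    have := hR0 (K + l + 1)
    rw [hRs] at this
    have := D.h_nonneg (K + l)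
    simp only [hΦ]
    linarith
  calc b (K + l) * t (K + l) ^ (-(η / 2))
      ≤ (Φ K / t K ^ η * t (K + l) ^ η) * t (K + l) ^ (-(η / 2)) := by
        gcongr; exact h2.trans (hbd l)
    _ = Φ K / t K ^ η * t (K + l) ^ (η / 2) := by
        rw [mul_assoc, ← Real.rpow_add htp]
        congr 2
        ring
    _ ≤ Φ K / t K ^ η * (ρ ^ (K + l) * t 0) ^ (η / 2) := by
        gcongr
        exact D.t_le _
    _ = _ := by
        rw [Real.mul_rpow (by positivity) (D.t_pos 0).le, ← Real.rpow_natCast ρ,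
          ← Real.rpow_mul hρ0.le, mul_comm ((K + l : ℕ) : ℝ), Real.rpow_mul hρ0.le,
          Real.rpow_natCast]

/-- At the critical exponent there are arbitrarily late stretches of levels over which the sum is
large compared with the boundary terms. -/
theorem exists_stretch (h1 : ∀ η > (0 : ℝ), Summable fun j => b j * t j ^ η)
    (h2 : ∀ η > (0 : ℝ), η < 1 → ¬ Summable fun j => b j * t j ^ (-η)) (M : ℝ) (K : ℕ) :
    ∃ k n, K ≤ k ∧ k < n ∧
      M * (h k + h n) < ∑ j ∈ Finset.range n, b j - ∑ j ∈ Finset.range k, b j := by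
  by_contra! hc
  have hc' : ∀ k n, K ≤ k → k < n →
      ∑ j ∈ Finset.range n, b j - ∑ j ∈ Finset.range k, b j ≤ max M 1 * (h k + h n) :=
    fun k n hk hn => (hc k n hk hn).trans (mul_le_mul_of_nonneg_right (le_max_left _ _)
      (add_nonneg (D.h_nonneg k) (D.h_nonneg n)))
  -- Without a stretch, whichever of convergence and divergence holds at this exponent persists at a
  -- neighbouring one, against criticality.
  by_cases hb : Summable b
  · obtain ⟨η, hη, hη1, hs⟩ := D.summable_of_convergent hb (le_max_right M 1) hc'
    exact h2 η hη hη1 hs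
  · obtain ⟨η, hη, hs⟩ := D.not_summable_of_divergent hb (le_max_right M 1)
      fun n hn => hc' K n le_rfl hn
    exact hs (h1 η hη)

end LevelData
end Critical
end FractalNCG

namespace FractalNCG

/-! ### Singular values of diagonal operators -/

lemma isSingularValueSeq_iff_of_isPositive {H : Type} [NormedAddCommGroup H]
    [InnerProductSpace ℂ H] [CompleteSpace H] {T : H →L[ℂ] H} (hT : T.IsPositive) {μ : ℕ → ℝ} :
    IsSingularValueSeq T μ ↔ Antitone μ ∧ Tendsto μ atTop (𝓝 0) ∧
      ∀ s : ℝ, 0 < s → {n | μ n = s}.encard =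
        Cardinal.toENat (Module.rank ℂ (Module.End.eigenspace (T : H →ₗ[ℂ] H) (s : ℂ))) := by
  rw [IsSingularValueSeq,
    CFC.abs_of_nonneg T ((ContinuousLinearMap.nonneg_iff_isPositive _).2 hT)]

section LevelDiagonal

variable {ι : Type}

/-- The eigenvectors are the vectors supported on `{c = s}`, and on a finite set every function is
square summable. -/
lemma toENat_rank_eigenspace_realDiag (c : ι → ℝ) (hc : ∃ C : ℝ, ∀ i, ‖(c i : ℂ)‖ ≤ C) {s : ℝ}
    (hs : {i | c i = s}.Finite) :
    Cardinal.toENat (Module.rank ℂ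
      (Module.End.eigenspace (realDiag c hc : L2 ι →ₗ[ℂ] L2 ι) (s : ℂ))) =
        {i | c i = s}.encard := by
  classical
  have hfin : Finite {i | c i = s} := hs
  have hfint : Fintype {i | c i = s} := Fintype.ofFinite _
  have hmem : ∀ ξ : L2 ι, ξ ∈ Module.End.eigenspace (realDiag c hc : L2 ι →ₗ[ℂ] L2 ι) (s : ℂ) ↔
      ∀ i, c i ≠ s → ξ i = 0 := by
    intro ξ
    rw [Module.End.mem_eigenspace_iff]
    have : (realDiag c hc : L2 ι →ₗ[ℂ] L2 ι) ξ = (s : ℂ) • ξ ↔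
        ∀ i, (c i : ℂ) * ξ i = (s : ℂ) * ξ i := by
      constructor
      · intro h i
        exact congrArg (fun η : L2 ι => η i) h
      · intro h
        ext i
        exact h i
    rw [this]
    refine forall_congr' fun i => ?_
    rw [mul_eq_mul_right_iff, Complex.ofReal_inj]
    tauto
  have hmemℓp : ∀ f : {i | c i = s} → ℂ,
      Memℓp (fun i => if h : c i = s then f ⟨i, h⟩ else 0) 2 := by
    intro f
    rw [memℓp_gen_iff (by simp)]
    refine summable_of_hasFiniteSupport (hs.subset fun i hi => ?_)
    by_contra h
    have h' : ¬ c i = s := h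
    exact hi (by simp [h'])
  let e : Module.End.eigenspace (realDiag c hc : L2 ι →ₗ[ℂ] L2 ι) (s : ℂ) ≃ₗ[ℂ]
      ({i | c i = s} → ℂ) :=
    { toFun := fun ξ i => (ξ : L2 ι) i
      map_add' := fun ξ η => by ext i; rfl
      map_smul' := fun a ξ => by ext i; rfl
      invFun := fun f => ⟨⟨fun i => if h : c i = s then f ⟨i, h⟩ else 0, hmemℓp f⟩, (hmem _).2 fun i hi => dif_neg hi⟩
      left_inv := fun ξ => by
        ext i
        by_cases h : c i = s
        · exact dif_pos h
        · rw [(hmem _).1 ξ.2 i h]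
          exact dif_neg h
      right_inv := fun f => by
        ext i
        exact dif_pos i.2 }
  rw [e.rank_eq, rank_fun', Set.encard_eq_coe_toFinset_card, Cardinal.toENat_nat,
    Set.toFinset_card]

variable {ℓ : ι → ℕ} {m : ℕ → ℕ} {t : ℕ → ℝ}

lemma encard_levelSet (hm : ∀ n, {i | ℓ i = n}.encard = m n) (ht : StrictAnti t) (n : ℕ) :
    {i | t (ℓ i) = t n}.encard = m n := by
  rw [← hm n]
  congr 1
  ext i
  exact ht.injective.eq_iff

lemma finite_levelSet (hm : ∀ n, {i | ℓ i = n}.encard = m n) (ht : StrictAnti t) (s : ℝ) :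
    {i | t (ℓ i) = s}.Finite := by
  by_cases hs : ∃ n, t n = s
  · obtain ⟨n, rfl⟩ := hs
    exact Set.finite_of_encard_eq_coe (encard_levelSet hm ht n)
  · convert Set.finite_empty
    ext i
    simp only [Set.mem_ofPred_eq, Set.mem_empty_iff_false, iff_false]
    exact fun h => hs ⟨_, h⟩

/-- The number of terms on the levels below `n`. -/
def levelSum (m : ℕ → ℕ) (n : ℕ) : ℕ := ∑ j ∈ Finset.range n, m j

lemma levelSum_succ (m : ℕ → ℕ) (n : ℕ) : levelSum m (n + 1) = levelSum m n + m n :=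
  Finset.sum_range_succ _ _

lemma levelSum_mono (m : ℕ → ℕ) : Monotone (levelSum m) :=
  monotone_nat_of_le_succ fun n => by rw [levelSum_succ]; exact Nat.le_add_right _ _

lemma le_levelSum (hm0 : ∀ n, 0 < m n) (n : ℕ) : n ≤ levelSum m n := by
  induction n with
  | zero => simp
  | succ n ih => rw [levelSum_succ]; have := hm0 n; omega

lemma exists_lt_levelSum (hm0 : ∀ n, 0 < m n) (k : ℕ) : ∃ n, k < levelSum m (n + 1) :=
  ⟨k, le_levelSum hm0 (k + 1)⟩

/-- The level of the `k`-th term. -/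
def levelIndex (hm0 : ∀ n, 0 < m n) (k : ℕ) : ℕ := Nat.find (exists_lt_levelSum hm0 k)

lemma levelIndex_eq_iff (hm0 : ∀ n, 0 < m n) (k n : ℕ) :
    levelIndex hm0 k = n ↔ levelSum m n ≤ k ∧ k < levelSum m (n + 1) := by
  rw [levelIndex, Nat.find_eq_iff]
  constructor
  · rintro ⟨h1, h2⟩
    refine ⟨?_, h1⟩
    cases n with
    | zero => simp [levelSum]
    | succ n => exact not_lt.1 (h2 n (by omega))
  · rintro ⟨h1, h2⟩
    exact ⟨h2, fun j hj => not_lt.2 ((levelSum_mono m (by omega)).trans h1)⟩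

lemma levelIndex_mono (hm0 : ∀ n, 0 < m n) : Monotone (levelIndex hm0) := fun _ _ hkl =>
  Nat.find_mono fun _ h => hkl.trans_lt h

lemma sum_levelIndex (hm0 : ∀ n, 0 < m n) (t : ℕ → ℝ) (n : ℕ) :
    ∑ k ∈ Finset.range (levelSum m n), t (levelIndex hm0 k) =
      ∑ j ∈ Finset.range n, (m j : ℝ) * t j := by
  induction n with
  | zero => simp [levelSum]
  | succ n ih =>
    rw [Finset.sum_range_succ, ← ih, levelSum_succ, Finset.sum_range_add]
    congr 1
    rw [Finset.sum_congr rfl fun k hk => by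
      rw [(levelIndex_eq_iff hm0 (levelSum m n + k) n).2 ⟨Nat.le_add_right _ _, by
        rw [levelSum_succ]; have := Finset.mem_range.1 hk; omega⟩]]
    simp

lemma isSingularValueSeq_levelIndex (hm0 : ∀ n, 0 < m n)
    (hm : ∀ n, {i | ℓ i = n}.encard = m n) (ht : StrictAnti t) (ht0 : ∀ n, 0 < t n)
    (htlim : Tendsto t atTop (𝓝 0)) (hc : ∃ C : ℝ, ∀ i, ‖(t (ℓ i) : ℂ)‖ ≤ C) :
    IsSingularValueSeq (realDiag (fun i => t (ℓ i)) hc) fun k => t (levelIndex hm0 k) := by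
  rw [isSingularValueSeq_iff_of_isPositive (isPositive_realDiag (fun i => (ht0 _).le) hc)]
  refine ⟨fun k l hkl => ht.antitone (levelIndex_mono hm0 hkl), htlim.comp ?_, fun s _ => ?_⟩
  · refine tendsto_atTop_mono (fun n => ?_) (tendsto_atTop_atTop.2 fun b =>
      ⟨levelSum m b, fun k hk => ?_⟩ : Tendsto (levelIndex hm0) atTop atTop)
    · exact le_rfl
    · have := (levelIndex_mono hm0) hk
      rwa [(levelIndex_eq_iff hm0 (levelSum m b) b).2 ⟨le_rfl, by
        rw [levelSum_succ]; have := hm0 b; omega⟩] at this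
  · rw [toENat_rank_eigenspace_realDiag _ _ (finite_levelSet hm ht s)]
    by_cases hs : ∃ n, t n = s
    · obtain ⟨n, rfl⟩ := hs
      rw [encard_levelSet hm ht n]
      have : {k | t (levelIndex hm0 k) = t n} =
          (Finset.Ico (levelSum m n) (levelSum m (n + 1)) : Set ℕ) := by
        ext k
        rw [Set.mem_ofPred_eq, ht.injective.eq_iff, levelIndex_eq_iff]
        simp
      rw [this, Set.encard_coe_eq_coe_finsetCard, Nat.card_Ico, levelSum_succ]
      simp
    · have h1 : {k | t (levelIndex hm0 k) = s} = ∅ :=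
        Set.eq_empty_iff_forall_notMem.2 fun k hk => hs ⟨_, hk⟩
      have h2 : {i | t (ℓ i) = s} = ∅ :=
        Set.eq_empty_iff_forall_notMem.2 fun k hk => hs ⟨_, hk⟩
      rw [h1, h2, Set.encard_empty, Set.encard_empty]

lemma isCompactOperator_level (hm : ∀ n, {i | ℓ i = n}.encard = m n) (ht0 : ∀ n, 0 < t n)
    (htlim : Tendsto t atTop (𝓝 0)) (hc : ∃ C : ℝ, ∀ i, ‖(t (ℓ i) : ℂ)‖ ≤ C) :
    IsCompactOperator (realDiag (fun i => t (ℓ i)) hc) := by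
  refine isCompactOperator_weighted _ _ hc fun ε hε => ?_
  obtain ⟨n, hn⟩ := eventually_atTop.1 (htlim.eventually_lt_const hε)
  refine ((Set.finite_lt_nat n).biUnion fun j _ =>
    Set.finite_of_encard_eq_coe (hm j)).subset fun i hi => ?_
  simp only [Set.mem_iUnion, Set.mem_ofPred_eq, exists_prop, exists_eq_right']
  by_contra! h
  rw [Set.mem_ofPred_eq, Complex.norm_real, Real.norm_of_nonneg (ht0 _).le] at hi
  exact absurd hi (not_le.2 (hn _ h))

/-- The partial sums of the singular values are bounded by the sum of the series, hence are `o(log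
n)`. -/
lemma inLogIdealZero_of_summable (hm0 : ∀ n, 0 < m n)
    (hm : ∀ n, {i | ℓ i = n}.encard = m n) (ht : StrictAnti t) (ht0 : ∀ n, 0 < t n)
    (htlim : Tendsto t atTop (𝓝 0)) (hc : ∃ C : ℝ, ∀ i, ‖(t (ℓ i) : ℂ)‖ ≤ C)
    (hs : Summable fun j => (m j : ℝ) * t j) :
    InLogIdealZero (realDiag (fun i => t (ℓ i)) hc) := by
  refine ⟨isCompactOperator_level hm ht0 htlim hc, _,
    isSingularValueSeq_levelIndex hm0 hm ht ht0 htlim hc, ?_⟩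
  have hbd : (fun n : ℕ => ∑ k ∈ Finset.range n, t (levelIndex hm0 k)) =O[atTop]
      fun _ => (1 : ℝ) := by
    refine Asymptotics.isBigO_of_le' (c := ∑' j, (m j : ℝ) * t j) _ fun n => ?_
    rw [Real.norm_of_nonneg (Finset.sum_nonneg fun k _ => (ht0 _).le), norm_one, mul_one]
    calc ∑ k ∈ Finset.range n, t (levelIndex hm0 k)
        ≤ ∑ k ∈ Finset.range (levelSum m n), t (levelIndex hm0 k) :=
          Finset.sum_le_sum_of_subset_of_nonneg (Finset.range_mono (le_levelSum hm0 n))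
            fun k _ _ => (ht0 _).le
      _ = ∑ j ∈ Finset.range n, (m j : ℝ) * t j := sum_levelIndex hm0 t n
      _ ≤ _ := hs.sum_le_tsum _ fun j _ => mul_nonneg (Nat.cast_nonneg _) (ht0 j).le
  refine hbd.trans_isLittleO ?_
  refine (Asymptotics.isLittleO_const_left.2 (Or.inr ?_))
  exact tendsto_norm_atTop_atTop.comp (Real.tendsto_log_atTop.comp tendsto_natCast_atTop_atTop)

/-- The first `m n` singular values are all at least `t n`: if `μ k < t n` with `k < m n`,
monotonicity would leave only indices below `k` for the eigenvalue `t n` of multiplicity `m n`. The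
growth condition at index `m n` then gives the bound. -/
lemma InLogIdealZero.eventually_le (hm : ∀ n, {i | ℓ i = n}.encard = m n) (ht : StrictAnti t)
    (ht0 : ∀ n, 0 < t n) (hc : ∃ C : ℝ, ∀ i, ‖(t (ℓ i) : ℂ)‖ ≤ C)
    (h : InLogIdealZero (realDiag (fun i => t (ℓ i)) hc)) :
    ∃ N, ∀ n, N ≤ m n → (m n : ℝ) * t n ≤ Real.log (m n) := by
  obtain ⟨-, μ, hμ, ho⟩ := h
  rw [isSingularValueSeq_iff_of_isPositive (isPositive_realDiag (fun i => (ht0 _).le) hc)] at hμ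
  obtain ⟨hanti, hlim, hcard⟩ := hμ
  obtain ⟨N, hN⟩ := eventually_atTop.1 (ho.bound one_pos)
  refine ⟨max N 1, fun n hn => ?_⟩
  have h1 := hN (m n) ((le_max_left _ _).trans hn)
  have h2 : ∀ k < m n, t n ≤ μ k := by
    intro k hk
    by_contra! hlt
    have h3 := hcard (t n) (ht0 n)
    rw [toENat_rank_eigenspace_realDiag _ _ (finite_levelSet hm ht _),
      encard_levelSet hm ht n] at h3
    have h4 : {l | μ l = t n} ⊆ (Finset.range k : Set ℕ) := by
      intro l hl
      rw [Finset.coe_range, Set.mem_Iio]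
      by_contra! hkl
      have := hanti hkl
      rw [Set.mem_ofPred_eq] at hl
      linarith
    have h5 := Set.encard_le_encard h4
    rw [h3, Set.encard_coe_eq_coe_finsetCard, Finset.card_range] at h5
    exact absurd (by exact_mod_cast h5) (not_le.2 hk)
  have h3 : (m n : ℝ) * t n ≤ ∑ k ∈ Finset.range (m n), μ k := by
    rw [← nsmul_eq_mul]
    simpa using Finset.card_nsmul_le_sum (Finset.range (m n)) μ (t n)
      fun k hk => h2 k (Finset.mem_range.1 hk)
  have h4 : 0 ≤ Real.log (m n) := Real.log_nonneg (by exact_mod_cast (le_max_right _ _).trans hn)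
  rw [one_mul, Real.norm_of_nonneg h4] at h1
  exact h3.trans ((le_abs_self _).trans h1)

end LevelDiagonal
end FractalNCG

namespace FractalNCG

/-! ### Ky Fan sums of level-diagonal operators and a singular trace at a critical exponent. -/

section LevelTrace

variable {ι : Type} {ℓ : ι → ℕ} {m : ℕ → ℕ} {t : ℕ → ℝ}

/-- The indices of level less than `n`. -/
def lowLevels (hm : ∀ n, {i | ℓ i = n}.encard = m n) (n : ℕ) : Finset ι :=
  ((Set.finite_lt_nat n).biUnion fun j _ => Set.finite_of_encard_eq_coe (hm j)).toFinset

lemma mem_lowLevels (hm : ∀ n, {i | ℓ i = n}.encard = m n) {n : ℕ} {i : ι} :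
    i ∈ lowLevels hm n ↔ ℓ i < n := by
  simp [lowLevels]

lemma sum_lowLevels (hm : ∀ n, {i | ℓ i = n}.encard = m n) (f : ℕ → ℝ) (n : ℕ) :
    ∑ i ∈ lowLevels hm n, f (ℓ i) = ∑ j ∈ Finset.range n, (m j : ℝ) * f j := by
  classical
  induction n with
  | zero =>
    have : lowLevels hm 0 = ∅ := by ext i; simp [mem_lowLevels]
    simp [this]
  | succ n ih =>
    set s := (Set.finite_of_encard_eq_coe (hm n)).toFinset with hs
    have hcard : s.card = m n := by
      have := hm n
      rw [← (Set.finite_of_encard_eq_coe (hm n)).coe_toFinset, Set.encard_coe_eq_coe_finsetCard]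
        at this
      exact_mod_cast this
    have hunion : lowLevels hm (n + 1) = lowLevels hm n ∪ s := by
      ext i
      simp only [Finset.mem_union, mem_lowLevels, hs, Set.Finite.mem_toFinset, Set.mem_ofPred_eq]
      omega
    have hdisj : Disjoint (lowLevels hm n) s := by
      rw [Finset.disjoint_left]
      intro i hi
      rw [mem_lowLevels] at hi
      simp only [hs, Set.Finite.mem_toFinset, Set.mem_ofPred_eq]
      omega
    rw [hunion, Finset.sum_union hdisj, ih, Finset.sum_range_succ]
    congr 1
    rw [Finset.sum_congr rfl (g := fun _ => f n), Finset.sum_const, hcard, nsmul_eq_mul]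
    intro i hi
    simp only [hs, Set.Finite.mem_toFinset, Set.mem_ofPred_eq] at hi
    rw [hi]

lemma card_lowLevels (hm : ∀ n, {i | ℓ i = n}.encard = m n) (n : ℕ) :
    (lowLevels hm n).card = levelSum m n := by
  have := sum_lowLevels hm (fun _ => 1) n
  simp only [Finset.sum_const, nsmul_eq_mul, mul_one] at this
  rw [levelSum]
  exact_mod_cast this

open Classical in
/-- The basis vectors of `ℓ²(ι)` of level less than `n`. -/
def lowBasis (hm : ∀ n, {i | ℓ i = n}.encard = m n) (n : ℕ) : Finset (L2 ι) :=
  (lowLevels hm n).image fun i => lp.single 2 i 1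

open Classical in
lemma single_injective : Function.Injective fun i : ι => (lp.single 2 i 1 : L2 ι) := by
  intro i j h
  by_contra hij
  have := congrArg (fun η : L2 ι => η i) h
  simp [hij] at this

open Classical in
lemma orthonormal_single : Orthonormal ℂ fun i : ι => (lp.single 2 i 1 : L2 ι) := by
  rw [orthonormal_iff_ite]
  intro i j
  rw [lp.inner_single_left]
  by_cases h : i = j
  · subst h; simp
  · simp [h]

lemma isOrthoSystem_lowBasis (hm : ∀ n, {i | ℓ i = n}.encard = m n) (n : ℕ) :
    IsOrthoSystem (levelSum m n) (lowBasis hm n) := by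
  classical
  refine ⟨Finset.card_image_le.trans (card_lowLevels hm n).le, ?_⟩
  have hmem : ∀ v : lowBasis hm n, ∃ i, (lp.single 2 i 1 : L2 ι) = v := fun v => by
    obtain ⟨i, -, hi⟩ := Finset.mem_image.1 v.2
    exact ⟨i, hi⟩
  choose f hf using hmem
  have := (orthonormal_single (ι := ι)).comp f fun v w hvw => Subtype.ext (by
    rw [← hf v, ← hf w, hvw])
  have e : (Subtype.val : lowBasis hm n → L2 ι) = (fun i => (lp.single 2 i 1 : L2 ι)) ∘ f :=
    funext fun v => (hf v).symm
  rw [e]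
  exact this

lemma le_kyFan_level (hm : ∀ n, {i | ℓ i = n}.encard = m n)
    (hc : ∃ C : ℝ, ∀ i, ‖(t (ℓ i) : ℂ)‖ ≤ C) (n : ℕ) :
    ∑ j ∈ Finset.range n, (m j : ℝ) * t j ≤
      kyFan (realDiag (fun i => t (ℓ i)) hc) (levelSum m n) := by
  classical
  refine le_trans ?_ (diagSum_le_kyFan _ (isOrthoSystem_lowBasis hm n))
  rw [← sum_lowLevels hm t n, diagSum, lowBasis, Finset.sum_image single_injective.injOn]
  refine Finset.sum_le_sum fun i _ => ?_
  rw [ContinuousLinearMap.reApplyInnerSelf_apply, ← inner_conj_symm, lp.inner_single_left]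
  simp

/-- A vector orthogonal to the basis vectors of levels below `n` only sees entries that are at most
`t n`. -/
lemma boundedOffDim_level (hm : ∀ n, {i | ℓ i = n}.encard = m n) (ht : Antitone t)
    (hc : ∃ C : ℝ, ∀ i, ‖(t (ℓ i) : ℂ)‖ ≤ C) (n : ℕ) :
    BoundedOffDim (realDiag (fun i => t (ℓ i)) hc) (levelSum m n) (t n) := by
  classical
  refine ⟨Submodule.span ℂ (lowBasis hm n : Set (L2 ι)), FiniteDimensional.span_finset ℂ _,
    (finrank_span_finset_le_card _).trans (isOrthoSystem_lowBasis hm n).1, fun ξ hξ => ?_⟩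
  have h0 : ∀ i, ℓ i < n → ξ i = 0 := by
    intro i hi
    have := (Submodule.mem_orthogonal _ _).1 hξ (lp.single 2 i 1) (Submodule.subset_span
      (Finset.mem_coe.2 (Finset.mem_image_of_mem _ ((mem_lowLevels hm).2 hi))))
    rw [lp.inner_single_left] at this
    simpa using this
  have h1 : HasSum (fun i => ‖ξ i‖ ^ 2) (‖ξ‖ ^ 2) := by
    have := lp.hasSum_norm (p := 2) (by simp) ξ
    simpa using this
  refine hasSum_le (fun i => ?_) (hasSum_reApplyInnerSelf_realDiag _ hc ξ) (h1.mul_left (t n))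
  by_cases hi : ℓ i < n
  · simp [h0 i hi]
  · have := ht (not_lt.1 hi)
    gcongr

/-- Level `n` adds `m n` singular values of size at most `t n`. With `le_kyFan_level`, the Ky Fan
sums at the ends of levels are known exactly. -/
lemma kyFan_level_le (hm : ∀ n, {i | ℓ i = n}.encard = m n) (ht : Antitone t) (ht0 : ∀ n, 0 < t n)
    (hc : ∃ C : ℝ, ∀ i, ‖(t (ℓ i) : ℂ)‖ ≤ C) (n : ℕ) :
    kyFan (realDiag (fun i => t (ℓ i)) hc) (levelSum m n) ≤
      ∑ j ∈ Finset.range n, (m j : ℝ) * t j := by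
  induction n with
  | zero => simp [levelSum, kyFan_zero_right]
  | succ n ih =>
    rw [levelSum_succ, Finset.sum_range_succ]
    exact (kyFan_add_nat_le (ht0 n).le (boundedOffDim_level hm ht hc n) (m n)).trans
      (by gcongr)

/-- A diagonal operator at a critical exponent is singularly traceable. -/
theorem exists_singularTrace_level (hm0 : ∀ n, 0 < m n) (hm : ∀ n, {i | ℓ i = n}.encard = m n)
    (ht0 : ∀ n, 0 < t n) {ρ : ℝ} (hρ : ρ < 1) (htρ : ∀ n, t (n + 1) / t n ≤ ρ)
    (hc : ∃ C : ℝ, ∀ i, ‖(t (ℓ i) : ℂ)‖ ≤ C)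
    (h1 : ∀ η > (0 : ℝ), Summable fun j => (m j : ℝ) * t j * t j ^ η)
    (h2 : ∀ η > (0 : ℝ), η < 1 → ¬ Summable fun j => (m j : ℝ) * t j * t j ^ (-η)) :
    ∃ τ : (L2 ι →L[ℂ] L2 ι) → ℝ≥0∞, IsSingularTrace τ ∧
      τ (realDiag (fun i => t (ℓ i)) hc) = 1 := by
  have D : LevelData (fun j => (m j : ℝ) * t j) (fun j => (levelSum m j : ℝ) * t j) t ρ :=
    { b_pos := fun j => mul_pos (by exact_mod_cast hm0 j) (ht0 j)
      h_nonneg := fun j => mul_nonneg (Nat.cast_nonneg _) (ht0 j).le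
      t_pos := ht0
      step := fun j => by
        have := (ht0 j).ne'
        rw [levelSum_succ]
        push_cast
        field_simp
      ratio_le := htρ
      ratio_lt_one := hρ }
  have ht := D.t_antitone
  -- Moving the lower end from `Q (a k)` to `k * Q (a k)` loses at most `(k - 1) Q (a k) t (a k)`.
  -- Out of the factor `(k + 1)²` at least `k (k + 1)` survives this loss, so the quotient required
  -- by `IsAdapted` is at most `1 / (k + 1)`.
  have hex := fun k : ℕ => D.exists_stretch h1 h2 ((k + 1 : ℝ) ^ 2) k
  choose a b hka hab hM using hex
  set T := realDiag (fun i => t (ℓ i)) hc with hT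
  set Q := levelSum m with hQ
  have hinc : ∀ k : ℕ, 1 ≤ k → 0 < (Q (b k) : ℝ) * t (b k) ∧
      (k : ℝ) * (k + 1) * (Q (a k) * t (a k) + Q (b k) * t (b k)) <
        kyFanIncrement (fun k => k * Q (a k)) (fun k => k * Q (b k)) T k := by
    intro k hk
    have e1 : kyFan T (Q (b k)) ≤ kyFan T (k * Q (b k)) :=
      kyFan_mono T (Nat.le_mul_of_pos_left _ hk)
    have e2 := le_kyFan_level hm hc (b k)
    have e3 := kyFan_level_le hm ht ht0 hc (a k)
    have e4 := kyFan_add_nat_le (ht0 (a k)).le (boundedOffDim_level hm ht hc (a k))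
      (k * Q (a k) - Q (a k))
    have hle : Q (a k) ≤ k * Q (a k) := Nat.le_mul_of_pos_left _ hk
    rw [Nat.add_sub_cancel' hle, Nat.cast_sub hle, Nat.cast_mul] at e4
    have h3 := hM k
    have hb1 : 1 ≤ Q (b k) := le_trans (by have := hab k; omega) (le_levelSum hm0 (b k))
    have hpb : 0 < (Q (b k) : ℝ) * t (b k) := mul_pos (by exact_mod_cast hb1) (ht0 _)
    have hpa : 0 ≤ (Q (a k) : ℝ) * t (a k) := mul_nonneg (Nat.cast_nonneg _) (ht0 _).le
    refine ⟨hpb, ?_⟩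
    have hk0 : (0 : ℝ) ≤ k := Nat.cast_nonneg k
    have hkb := mul_nonneg hk0 hpb.le
    simp only [kyFanIncrement]
    nlinarith
  have hA : IsAdapted Q t a b T :=
    { monotone := levelSum_mono m
      pos := ht0
      unbounded := (eventually_ge_atTop 1).mono fun j hj => hj.trans (le_levelSum hm0 j)
      le := hka
      lt := fun k => (hab k).le
      mem := ⟨1, 1, zero_le_one, Eventually.of_forall fun j => by
        rw [one_mul, one_mul]; exact boundedOffDim_level hm ht hc j⟩
      increment_pos := (eventually_ge_atTop 1).mono fun k hk => by
        obtain ⟨h3, h4⟩ := hinc k hk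
        have hpa : 0 ≤ (Q (a k) : ℝ) * t (a k) := mul_nonneg (Nat.cast_nonneg _) (ht0 _).le
        exact lt_of_le_of_lt (by positivity) h4
      tendsto := by
        refine squeeze_zero' ?_ ?_ (tendsto_one_div_add_atTop_nhds_zero_nat (𝕜 := ℝ))
        · filter_upwards [eventually_ge_atTop 1] with k hk
          obtain ⟨h3, h4⟩ := hinc k hk
          have hpa : 0 ≤ (Q (a k) : ℝ) * t (a k) := mul_nonneg (Nat.cast_nonneg _) (ht0 _).le
          exact div_nonneg (by positivity) (le_trans (by positivity) h4.le)
        · filter_upwards [eventually_ge_atTop 1] with k hk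
          obtain ⟨h3, h4⟩ := hinc k hk
          have hpa : 0 ≤ (Q (a k) : ℝ) * t (a k) := mul_nonneg (Nat.cast_nonneg _) (ht0 _).le
          rw [div_le_div_iff₀ (lt_of_le_of_lt (by positivity) h4) (by positivity)]
          linarith }
  exact hA.exists_singularTrace

end LevelTrace
end FractalNCG

namespace FractalNCG
namespace LimitSystem

/-! ### The spectral dimension -/

variable {N : ℕ} (S : LimitSystem N)

/-- The number of words of length `n`. -/
def numWords (n : ℕ) : ℕ := ∏ k ∈ Finset.range n, S.p k

/-- The contraction parameter of the words of length `n`. -/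
def scale (lam : ℕ → ℝ) (n : ℕ) : ℝ := ∏ k ∈ Finset.range n, lam k

/-- The eigenvalue of `|D|^{-α}` on level `n`, where `r` is the distance of the initial points. -/
def levelValue (lam : ℕ → ℝ) (r α : ℝ) (n : ℕ) : ℝ := (scale lam n * r) ^ α

lemma numWords_pos (n : ℕ) : 0 < S.numWords n := Finset.prod_pos fun k _ => S.p_pos k

lemma numWords_succ (n : ℕ) : S.numWords (n + 1) = S.numWords n * S.p n :=
  Finset.prod_range_succ _ _

lemma numWords_mono : Monotone S.numWords := monotone_nat_of_le_succ fun n => by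
  rw [numWords_succ]; exact Nat.le_mul_of_pos_right _ (S.p_pos n)

lemma scale_succ (lam : ℕ → ℝ) (n : ℕ) : scale lam (n + 1) = scale lam n * lam n :=
  Finset.prod_range_succ _ _

lemma card_words (n : ℕ) : Fintype.card ((k : Fin n) → Fin (S.p k)) = S.numWords n := by
  rw [Fintype.card_pi, numWords, Finset.prod_range]
  simp

lemma encard_level (n : ℕ) :
    {i : S.Word × Bool | i.1.1 = n}.encard = ((2 * S.numWords n : ℕ) : ℕ∞) := by
  have h : {i : S.Word × Bool | i.1.1 = n} =
      Set.range fun z : ((k : Fin n) → Fin (S.p k)) × Bool => ((⟨n, z.1⟩, z.2) : S.Word × Bool) := by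
    ext ⟨⟨k, σ⟩, b⟩
    constructor
    · rintro rfl
      exact ⟨(σ, b), rfl⟩
    · rintro ⟨⟨τ, b'⟩, h⟩
      simp only [Prod.mk.injEq, Sigma.mk.injEq] at h
      exact h.1.1.symm
  rw [h, ← Set.image_univ, Function.Injective.encard_image, Set.encard_univ,
    ENat.card_eq_coe_fintype_card, Fintype.card_prod, card_words, Fintype.card_bool, mul_comm]
  rintro ⟨σ, b⟩ ⟨τ, b'⟩ h
  simp only [Prod.mk.injEq, Sigma.mk.injEq, heq_eq_eq, true_and] at h
  simp [h]

section Ratio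

variable {S} {lam : ℕ → ℝ} (hlam : ∀ n j, S.ratio n j = lam n)
include hlam

lemma lam_pos (n : ℕ) : 0 < lam n := by
  rw [← hlam n ⟨0, S.p_pos n⟩]
  exact S.ratio_pos _ _

lemma exists_lam_le : ∃ c, 0 < c ∧ c < 1 ∧ ∀ n, lam n ≤ c := by
  obtain ⟨c, hc1, hc⟩ := S.ratio_bound
  have h : ∀ n, lam n ≤ c := fun n => by
    rw [← hlam n ⟨0, S.p_pos n⟩]
    exact hc _ _
  exact ⟨c, (lam_pos hlam 0).trans_le (h 0), hc1, h⟩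

lemma scale_pos (n : ℕ) : 0 < scale lam n := Finset.prod_pos fun k _ => lam_pos hlam k

lemma exists_scale_le : ∃ c, 0 < c ∧ c < 1 ∧ ∀ n, scale lam n ≤ c ^ n := by
  obtain ⟨c, hc0, hc1, hc⟩ := exists_lam_le hlam
  refine ⟨c, hc0, hc1, fun n => ?_⟩
  calc scale lam n ≤ ∏ _k ∈ Finset.range n, c :=
        Finset.prod_le_prod (fun k _ => (lam_pos hlam k).le) fun k _ => hc k
    _ = c ^ n := by simp

lemma tendsto_scale : Tendsto (scale lam) atTop (𝓝 0) := by
  obtain ⟨c, hc0, hc1, hc⟩ := exists_scale_le hlam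
  exact squeeze_zero (fun n => (scale_pos hlam n).le) hc
    (tendsto_pow_atTop_nhds_zero_of_lt_one hc0.le hc1)

lemma dist_wordMap (n : ℕ) (σ : (k : Fin n) → Fin (S.p k)) (x y : EuclideanSpace ℝ (Fin N)) :
    dist (S.wordMap n σ x) (S.wordMap n σ y) = scale lam n * dist x y := by
  induction n generalizing x y with
  | zero => simp [wordMap, scale]
  | succ n ih =>
    simp only [wordMap, Function.comp_apply]
    rw [ih, S.dist_eq, hlam, scale_succ, mul_assoc]

variable {r α : ℝ}

lemma levelValue_pos (hr : 0 < r) (n : ℕ) : 0 < levelValue lam r α n :=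
  Real.rpow_pos_of_pos (mul_pos (scale_pos hlam n) hr) _

lemma levelValue_succ_div (hr : 0 < r) (n : ℕ) :
    levelValue lam r α (n + 1) / levelValue lam r α n = lam n ^ α := by
  have h1 := scale_pos hlam n
  have h2 := lam_pos hlam n
  rw [levelValue, levelValue, ← Real.div_rpow (mul_pos (scale_pos hlam _) hr).le
    (mul_pos h1 hr).le, scale_succ]
  congr 1
  field_simp

lemma exists_ratio_levelValue_le (hr : 0 < r) (hα : 0 < α) : ∃ ρ : ℝ, 0 < ρ ∧ ρ < 1 ∧
    ∀ n, levelValue lam r α (n + 1) / levelValue lam r α n ≤ ρ := by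
  obtain ⟨c, hc0, hc1, hc⟩ := exists_lam_le hlam
  refine ⟨c ^ α, Real.rpow_pos_of_pos hc0 _, Real.rpow_lt_one hc0.le hc1 hα, fun n => ?_⟩
  rw [levelValue_succ_div hlam hr]
  exact Real.rpow_le_rpow (lam_pos hlam n).le (hc n) hα.le

lemma levelValue_strictAnti (hr : 0 < r) (hα : 0 < α) : StrictAnti (levelValue lam r α) := by
  obtain ⟨ρ, -, hρ, h⟩ := exists_ratio_levelValue_le (r := r) hlam hr hα
  refine strictAnti_nat_of_succ_lt fun n => ?_
  have := (h n).trans_lt hρ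
  rwa [div_lt_one (levelValue_pos hlam hr n)] at this

lemma tendsto_levelValue (hα : 0 < α) : Tendsto (levelValue lam r α) atTop (𝓝 0) := by
  have h := ((tendsto_scale hlam).mul_const r).rpow_const (p := α) (Or.inr hα.le)
  rwa [zero_mul, Real.zero_rpow hα.ne'] at h

lemma levelValue_rpow (hr : 0 < r) (α β : ℝ) (n : ℕ) :
    levelValue lam r α n ^ β = levelValue lam r (α * β) n := by
  rw [levelValue, levelValue, ← Real.rpow_mul (mul_pos (scale_pos hlam n) hr).le]

lemma levelValue_mul (hr : 0 < r) (α β : ℝ) (n : ℕ) :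
    levelValue lam r α n * levelValue lam r β n = levelValue lam r (α + β) n := by
  rw [levelValue, levelValue, levelValue, ← Real.rpow_add (mul_pos (scale_pos hlam n) hr)]

lemma levelValue_eq_mul (hr : 0 < r) (n : ℕ) :
    levelValue lam r α n = r ^ α * scale lam n ^ α := by
  rw [levelValue, Real.mul_rpow (scale_pos hlam n).le hr.le, mul_comm]

/-- The quotient whose upper limit is the dimension. -/
def dimensionQuotient (S : LimitSystem N) (lam : ℕ → ℝ) (n : ℕ) : ℝ :=
  (∑ k ∈ Finset.range n, Real.log (S.p k)) / ∑ k ∈ Finset.range n, Real.log (1 / lam k)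

lemma dimensionQuotient_eq (n : ℕ) :
    dimensionQuotient S lam n = Real.log (S.numWords n) / Real.log (scale lam n)⁻¹ := by
  rw [dimensionQuotient, numWords, scale, Nat.cast_prod, Real.log_prod fun k _ => by
    have := S.p_pos k; positivity, ← Finset.prod_inv_distrib,
    Real.log_prod fun k _ => (inv_pos.2 (lam_pos hlam k)).ne']
  simp only [one_div]

lemma log_scale_inv_pos {n : ℕ} (hn : 0 < n) : 0 < Real.log (scale lam n)⁻¹ := by
  obtain ⟨c, hc0, hc1, hc⟩ := exists_scale_le hlam
  refine Real.log_pos ((one_lt_inv₀ (scale_pos hlam n)).2 ((hc n).trans_lt ?_))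
  exact pow_lt_one₀ hc0.le hc1 hn.ne'

/-- For `u` strictly between the limsup and `s`, eventually `P_n ≤ scale ^ (-u)`; the terms are then
at most a constant times `scale ^ (s - u)`, which decays geometrically. -/
lemma summable_of_limsup_lt {s : ℝ} (hr : 0 < r)
    (h : limsup (fun n => ENNReal.ofReal (dimensionQuotient S lam n)) atTop < ENNReal.ofReal s) :
    Summable fun n => ((2 * S.numWords n : ℕ) : ℝ) * levelValue lam r s n := by
  obtain ⟨u, hu1, hu2⟩ := exists_between h
  lift u to ℝ≥0 using hu2.ne_top
  have hus : (u : ℝ) < s := by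
    rw [← ENNReal.ofReal_coe_nnreal] at hu2
    exact (ENNReal.ofReal_lt_ofReal_iff_of_nonneg u.coe_nonneg).1 hu2
  have hev := eventually_lt_of_limsup_lt hu1
  obtain ⟨c, hc0, hc1, hc⟩ := exists_scale_le hlam
  have hg : Summable fun n : ℕ => (2 * r ^ s) * (c ^ (s - u)) ^ n :=
    (summable_geometric_of_lt_one (Real.rpow_nonneg hc0.le _)
      (Real.rpow_lt_one hc0.le hc1 (by linarith))).mul_left _
  refine Summable.of_norm_bounded_eventually_nat hg ?_
  filter_upwards [hev, eventually_gt_atTop 0] with n hn hn0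
  have hs0 := scale_pos hlam n
  have hP : (0 : ℝ) < S.numWords n := by exact_mod_cast S.numWords_pos n
  rw [Real.norm_of_nonneg (mul_nonneg (Nat.cast_nonneg _) (levelValue_pos hlam hr n).le),
    levelValue_eq_mul hlam hr]
  have h1 : dimensionQuotient S lam n < u := by
    rw [← ENNReal.ofReal_coe_nnreal] at hn
    by_contra! hc
    exact absurd hn (not_lt.2 (ENNReal.ofReal_le_ofReal hc))
  rw [dimensionQuotient_eq hlam, div_lt_iff₀ (log_scale_inv_pos hlam hn0)] at h1
  have h2 : (S.numWords n : ℝ) ≤ ((scale lam n) ^ (u : ℝ))⁻¹ := by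
    rw [← Real.inv_rpow hs0.le, ← Real.log_le_log_iff hP (Real.rpow_pos_of_pos (inv_pos.2 hs0) _),
      Real.log_rpow (inv_pos.2 hs0)]
    exact h1.le
  calc ((2 * S.numWords n : ℕ) : ℝ) * (r ^ s * scale lam n ^ s)
      = 2 * r ^ s * (S.numWords n * scale lam n ^ s) := by push_cast; ring
    _ ≤ 2 * r ^ s * (((scale lam n) ^ (u : ℝ))⁻¹ * scale lam n ^ s) := by gcongr
    _ = 2 * r ^ s * scale lam n ^ (s - u) := by
        rw [Real.rpow_sub hs0, div_eq_inv_mul]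
    _ ≤ 2 * r ^ s * (c ^ n) ^ (s - u) := by
        exact mul_le_mul_of_nonneg_left (Real.rpow_le_rpow hs0.le (hc n) (by linarith))
          (by positivity)
    _ = _ := by
        rw [← Real.rpow_natCast, ← Real.rpow_mul hc0.le, mul_comm (n : ℝ), Real.rpow_mul hc0.le,
          Real.rpow_natCast]

end Ratio

variable {S} {lam : ℕ → ℝ} (hlam : ∀ n j, S.ratio n j = lam n)
  {V : Set (EuclideanSpace ℝ (Fin N))} (hV : S.IsCountablyRamifiedOSC V)
  {x y : EuclideanSpace ℝ (Fin N)} (hx : x ∈ V) (hy : y ∈ V) (hxy : x ≠ y)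
include hlam

omit hlam in
lemma absPowNeg_spectralTriple {α : ℝ} (hα : 0 < α) :
    (spectralTriple hV hx hy hxy).absPowNeg α =
      realDiag (ι := S.Word × Bool) (fun i : S.Word × Bool => S.gap x y i.1 ^ α)
      (bounded_rpow (ι := S.Word × Bool) (c := fun i : S.Word × Bool => S.gap x y i.1)
        (fun i => S.gap_nonneg x y i.1) (S.gap_bounded x y) hα.le) := by
  have h1 : (spectralTriple hV hx hy hxy).inv =
    weighted S.swap (fun i => ((S.gap x y i.1 : ℝ) : ℂ)) (S.gap_bounded x y) := rfl
  exact SpectralTriple.absPowNeg_eq_realDiag (ι := S.Word × Bool) (spectralTriple hV hx hy hxy)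
    S.swap (c := fun i : S.Word × Bool => S.gap x y i.1) (fun i => S.gap_nonneg x y i.1)
    (fun _ => rfl) (S.gap_bounded x y) h1 hα

lemma gap_rpow (α : ℝ) (σ : S.Word) : S.gap x y σ ^ α = levelValue lam (dist x y) α σ.1 := by
  rw [gap, dist_wordMap hlam, levelValue]

lemma bounded_levelValue {α : ℝ} (hα : 0 < α) :
    ∃ C : ℝ, ∀ i : S.Word × Bool, ‖((levelValue lam (dist x y) α i.1.1 : ℝ) : ℂ)‖ ≤ C := by
  simpa only [gap_rpow hlam] using
    bounded_rpow (fun i : S.Word × Bool => S.gap_nonneg x y i.1) (S.gap_bounded x y) hα.le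

lemma absPowNeg_eq {α : ℝ} (hα : 0 < α) :
    (spectralTriple hV hx hy hxy).absPowNeg α =
      realDiag (fun i : S.Word × Bool => levelValue lam (dist x y) α i.1.1)
        (bounded_levelValue hlam hα) := by
  rw [absPowNeg_spectralTriple hV hx hy hxy hα]
  congr 1
  funext i
  exact gap_rpow hlam α i.1

lemma inLogIdealZero_absPowNeg {s : ℝ} (hs : 0 < s)
    (h : Summable fun n => ((2 * S.numWords n : ℕ) : ℝ) * levelValue lam (dist x y) s n) :
    InLogIdealZero ((spectralTriple hV hx hy hxy).absPowNeg s) := by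
  have hc := bounded_levelValue (S := S) (x := x) (y := y) hlam hs
  have he := absPowNeg_eq hlam hV hx hy hxy hs
  have hr := dist_pos.2 hxy
  rw [he]
  exact inLogIdealZero_of_summable (fun n => Nat.mul_pos two_pos (S.numWords_pos n))
    S.encard_level (levelValue_strictAnti hlam hr hs) (fun n => levelValue_pos hlam hr n)
    (tendsto_levelValue hlam hs) hc h

/-- Otherwise, for some `u > s`, infinitely often `P_n ≥ scale ^ (-u)`, hence `P_n scale ^ s ≥ P_n ^
(1 - s / u)`. A positive power of `P_n` cannot stay below its logarithm. -/
lemma limsup_le_of_inLogIdealZero {s : ℝ} (hs : 0 < s)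
    (h : InLogIdealZero ((spectralTriple hV hx hy hxy).absPowNeg s)) :
    limsup (fun n => ENNReal.ofReal (dimensionQuotient S lam n)) atTop ≤ ENNReal.ofReal s := by
  have hc := bounded_levelValue (S := S) (x := x) (y := y) hlam hs
  have he := absPowNeg_eq hlam hV hx hy hxy hs
  have hr := dist_pos.2 hxy
  set r := dist x y with hrd
  rw [he] at h
  obtain ⟨M, hM⟩ := h.eventually_le S.encard_level (levelValue_strictAnti hlam hr hs)
    (fun n => levelValue_pos hlam hr n) hc
  by_contra! hlt
  obtain ⟨u, hu1, hu2⟩ := exists_between hlt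
  lift u to ℝ≥0 using hu2.ne_top
  have hsu : s < u := by
    rw [← ENNReal.ofReal_coe_nnreal] at hu1
    exact (ENNReal.ofReal_lt_ofReal_iff_of_nonneg hs.le).1 hu1
  have hu0 : (0 : ℝ) < u := hs.trans hsu
  have hfreq := frequently_lt_of_lt_limsup (by isBoundedDefault) hu2
  set θ : ℝ := 1 - s / u with hθ
  have hθ0 : 0 < θ := by
    have : s / u < 1 := (div_lt_one hu0).2 hsu
    linarith
  -- the logarithm grows slower than any power
  have hlog : ∀ᶠ z : ℝ in atTop, Real.log (2 * z) < 2 * r ^ s * z ^ θ ∧ (M : ℝ) ≤ 2 * z := by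
    refine Eventually.and ?_ ?_
    · have h2 : (fun z : ℝ => Real.log z) =o[atTop] fun z => z ^ θ := isLittleO_log_rpow_atTop hθ0
      have h3 : Tendsto (fun z : ℝ => 2 * z) atTop atTop := tendsto_id.const_mul_atTop two_pos
      have h4 := (h2.comp_tendsto h3).bound (c := 2 * r ^ s / 2 ^ θ / 2) (by positivity)
      filter_upwards [h4, eventually_ge_atTop 1] with z hz hz1
      simp only [Function.comp_apply] at hz
      rw [Real.norm_of_nonneg (Real.log_nonneg (by linarith)),
        Real.norm_of_nonneg (by positivity)] at hz
      refine hz.trans_lt ?_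
      rw [Real.mul_rpow (by norm_num) (by linarith)]
      have : (0 : ℝ) < 2 ^ θ := by positivity
      have h5 : 0 < 2 * r ^ s * z ^ θ := by positivity
      calc 2 * r ^ s / 2 ^ θ / 2 * (2 ^ θ * z ^ θ) = (2 * r ^ s * z ^ θ) / 2 := by field_simp
        _ < _ := by linarith
    · filter_upwards [eventually_ge_atTop (M : ℝ)] with z hz
      have : (0 : ℝ) ≤ M := Nat.cast_nonneg M
      linarith
  obtain ⟨z₀, hz₀⟩ := eventually_atTop.1 hlog
  -- Along the chosen indices `P_n` exceeds `scale ^ (-u)`, which tends to infinity; so the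
  -- asymptotic comparison with the logarithm applies.
  have hbig : ∀ᶠ n in atTop, z₀ ≤ ((scale lam n) ^ (u : ℝ))⁻¹ := by
    have h1 : Tendsto (fun n => ((scale lam n) ^ (u : ℝ))⁻¹) atTop atTop := by
      refine tendsto_inv_nhdsGT_zero.comp (tendsto_nhdsWithin_iff.2 ⟨?_, ?_⟩)
      · have := (tendsto_scale hlam).rpow_const (p := (u : ℝ)) (Or.inr hu0.le)
        rwa [Real.zero_rpow hu0.ne'] at this
      · exact Eventually.of_forall fun n => Real.rpow_pos_of_pos (scale_pos hlam n) _
    exact h1.eventually_ge_atTop z₀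
  obtain ⟨n, hn, hn0, hnz⟩ :=
    (hfreq.and_eventually ((eventually_gt_atTop 0).and hbig)).exists
  have hs0 := scale_pos hlam n
  have hP : (0 : ℝ) < S.numWords n := by exact_mod_cast S.numWords_pos n
  have h1 : (u : ℝ) < dimensionQuotient S lam n := by
    rw [← ENNReal.ofReal_coe_nnreal] at hn
    exact (ENNReal.ofReal_lt_ofReal_iff_of_nonneg u.coe_nonneg).1 hn
  rw [dimensionQuotient_eq hlam, lt_div_iff₀ (log_scale_inv_pos hlam hn0)] at h1
  have h2 : ((scale lam n) ^ (u : ℝ))⁻¹ ≤ S.numWords n := by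
    rw [← Real.inv_rpow hs0.le, ← Real.log_le_log_iff (Real.rpow_pos_of_pos (inv_pos.2 hs0) _) hP,
      Real.log_rpow (inv_pos.2 hs0)]
    exact h1.le
  obtain ⟨h3, h4⟩ := hz₀ _ (hnz.trans h2)
  have h5 := hM n (by exact_mod_cast h4)
  rw [levelValue_eq_mul hlam hr] at h5
  push_cast at h5
  have h6 : (S.numWords n : ℝ) ^ (-(s / u)) ≤ scale lam n ^ s := by
    have h7 : (S.numWords n : ℝ) ^ (-(s / u)) ≤ (((scale lam n) ^ (u : ℝ))⁻¹) ^ (-(s / u)) :=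
      Real.rpow_le_rpow_of_nonpos (inv_pos.2 (Real.rpow_pos_of_pos hs0 _)) h2
        (neg_nonpos.2 (by positivity))
    refine h7.trans (le_of_eq ?_)
    rw [← Real.rpow_neg hs0.le, ← Real.rpow_mul hs0.le]
    congr 1
    field_simp
  have h8 : 2 * r ^ s * (S.numWords n : ℝ) ^ θ ≤ 2 * S.numWords n * (r ^ s * scale lam n ^ s) := by
    rw [hθ, sub_eq_add_neg, Real.rpow_add hP, Real.rpow_one]
    calc _ = 2 * r ^ s * S.numWords n * (S.numWords n : ℝ) ^ (-(s / u)) := by ring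
      _ ≤ 2 * r ^ s * S.numWords n * scale lam n ^ s := by gcongr
      _ = _ := by ring
  linarith

theorem dimension_eq :
    (spectralTriple hV hx hy hxy).dimension =
      limsup (fun n => ENNReal.ofReal (dimensionQuotient S lam n)) atTop := by
  refine le_antisymm (le_of_forall_gt fun b hb => ?_) ?_
  · obtain ⟨u, hu1, hu2⟩ := exists_between hb
    lift u to ℝ≥0 using hu2.ne_top
    rw [← ENNReal.ofReal_coe_nnreal] at hu1
    have hu0 : (0 : ℝ) < u := by
      by_contra! h0
      rw [ENNReal.ofReal_of_nonpos h0] at hu1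
      exact not_lt_bot hu1
    refine lt_of_le_of_lt ?_ hu2
    rw [← ENNReal.ofReal_coe_nnreal]
    exact iInf_le_of_le _ (iInf_le_of_le hu0 (iInf_le_of_le
      (inLogIdealZero_absPowNeg hlam hV hx hy hxy hu0
        (summable_of_limsup_lt hlam (dist_pos.2 hxy) hu1)) le_rfl))
  · exact le_iInf fun s => le_iInf fun hs => le_iInf fun h =>
      limsup_le_of_inLogIdealZero hlam hV hx hy hxy hs h

/-- Weighting by the power `η` of the eigenvalue shifts the exponent from `d` to `d (1 + η)`. The
series converges above `d` by the limsup formula, and diverges below `d` since convergence would put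
a smaller power into the ideal; `η < 1` keeps the lower exponents positive. -/
theorem exists_trace_dimension (hfin : (spectralTriple hV hx hy hxy).dimension < ⊤)
    (hpos : 0 < (spectralTriple hV hx hy hxy).dimension) :
    ∃ τ, (spectralTriple hV hx hy hxy).IsTraceOfExponent
      (spectralTriple hV hx hy hxy).dimension.toReal τ := by
  set d := (spectralTriple hV hx hy hxy).dimension.toReal with hd
  have hd0 : 0 < d := ENNReal.toReal_pos hpos.ne' hfin.ne
  have hr := dist_pos.2 hxy
  have hc := bounded_levelValue (S := S) (x := x) (y := y) hlam hd0
  have he := absPowNeg_eq hlam hV hx hy hxy hd0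
  obtain ⟨ρ, -, hρ, hratio⟩ := exists_ratio_levelValue_le (r := dist x y) hlam hr hd0
  have hterm : ∀ η : ℝ, (fun j => ((2 * S.numWords j : ℕ) : ℝ) * levelValue lam (dist x y) d j *
      levelValue lam (dist x y) d j ^ η) =
      fun j => ((2 * S.numWords j : ℕ) : ℝ) * levelValue lam (dist x y) (d + d * η) j := by
    intro η
    funext j
    rw [levelValue_rpow hlam hr, mul_assoc, levelValue_mul hlam hr]
  obtain ⟨τ, h1, h2⟩ := exists_singularTrace_level
    (fun n => Nat.mul_pos two_pos (S.numWords_pos n)) S.encard_level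
    (fun n => levelValue_pos hlam hr n) hρ hratio hc (fun η hη => by
      rw [hterm]
      refine summable_of_limsup_lt hlam hr ?_
      rw [← dimension_eq hlam hV hx hy hxy, ← ENNReal.ofReal_toReal hfin.ne, ← hd]
      have := mul_pos hd0 hη
      exact (ENNReal.ofReal_lt_ofReal_iff (by linarith)).2 (by linarith)) (fun η hη hη1 hs => by
      rw [hterm] at hs
      have h3 : 0 < d + d * -η := by nlinarith
      have h4 : (spectralTriple hV hx hy hxy).dimension ≤ ENNReal.ofReal (d + d * -η) :=
        iInf_le_of_le _ (iInf_le_of_le h3 (iInf_le_of_le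
          (inLogIdealZero_absPowNeg hlam hV hx hy hxy h3 hs) le_rfl))
      have h5 := ENNReal.toReal_mono ENNReal.ofReal_ne_top h4
      rw [ENNReal.toReal_ofReal h3.le, ← hd] at h5
      nlinarith)
  exact ⟨τ, hd0, h1, by rw [he]; exact h2⟩

end LimitSystem
end FractalNCG

namespace FractalNCG
namespace LimitSystem

/-! ### The pieces of a limit fractal -/

variable {N : ℕ} {S : LimitSystem N}

lemma exists_antilipschitzWith_wordMap (n : ℕ) (σ : (k : Fin n) → Fin (S.p k)) :
    ∃ K : ℝ≥0, AntilipschitzWith K (S.wordMap n σ) ∧ Continuous (S.wordMap n σ) := by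
  induction n with
  | zero => exact ⟨1, AntilipschitzWith.id, continuous_id⟩
  | succ n ih =>
    obtain ⟨K, hK, hc⟩ := ih fun k => σ k.castSucc
    have h0 := S.ratio_pos n (σ (Fin.last n))
    have h1 : AntilipschitzWith (⟨S.ratio n (σ (Fin.last n)), h0.le⟩⁻¹ : ℝ≥0)
        (S.w n (σ (Fin.last n))) := AntilipschitzWith.of_le_mul_dist fun u v => by
      rw [S.dist_eq]
      exact (inv_mul_cancel_left₀ h0.ne' _).ge
    exact ⟨_, hK.comp h1, hc.comp (S.continuous_w _ _)⟩

lemma continuous_wordMap (n : ℕ) (σ : (k : Fin n) → Fin (S.p k)) : Continuous (S.wordMap n σ) :=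
  (exists_antilipschitzWith_wordMap n σ).choose_spec.2

lemma injective_wordMap (n : ℕ) (σ : (k : Fin n) → Fin (S.p k)) :
    Function.Injective (S.wordMap n σ) :=
  (exists_antilipschitzWith_wordMap n σ).choose_spec.1.injective

lemma injective_w (n : ℕ) (j : Fin (S.p n)) : Function.Injective (S.w n j) := fun u v h => by
  have h1 := S.dist_eq n j u v
  rw [h, dist_self, eq_comm, mul_eq_zero, or_iff_right (S.ratio_pos n j).ne'] at h1
  exact dist_eq_zero.1 h1

lemma measurableEmbedding_wordMap (n : ℕ) (σ : (k : Fin n) → Fin (S.p k)) :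
    MeasurableEmbedding (S.wordMap n σ) :=
  (continuous_wordMap n σ).measurableEmbedding (injective_wordMap n σ)

lemma measurableEmbedding_w (n : ℕ) (j : Fin (S.p n)) : MeasurableEmbedding (S.w n j) :=
  (S.continuous_w n j).measurableEmbedding (injective_w n j)

variable (S) in
/-- The piece `w_σ(V̄)`. -/
def piece (V : Set (EuclideanSpace ℝ (Fin N))) (n : ℕ) (σ : (k : Fin n) → Fin (S.p k)) :
    Set (EuclideanSpace ℝ (Fin N)) := S.wordMap n σ '' closure V

variable {V : Set (EuclideanSpace ℝ (Fin N))}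

namespace IsCountablyRamifiedOSC

variable (hV : S.IsCountablyRamifiedOSC V)
include hV

lemma isCompact_closure : IsCompact (closure V) := hV.bounded.isCompact_closure

lemma isCompact_piece (n : ℕ) (σ : (k : Fin n) → Fin (S.p k)) : IsCompact (S.piece V n σ) :=
  hV.isCompact_closure.image (continuous_wordMap n σ)

lemma measurableSet_piece (n : ℕ) (σ : (k : Fin n) → Fin (S.p k)) :
    MeasurableSet (S.piece V n σ) := (hV.isCompact_piece n σ).measurableSet

omit hV in
lemma image_closure_subset_closure_image (n : ℕ) (j : Fin (S.p n)) :
    S.w n j '' closure V ⊆ closure (S.w n j '' V) :=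
  _root_.image_closure_subset_closure_image (S.continuous_w n j)

lemma image_closure_subset (n : ℕ) (j : Fin (S.p n)) : S.w n j '' closure V ⊆ closure V :=
  (image_closure_subset_closure_image n j).trans (closure_mono (hV.image_subset n j))

lemma w_mem {n : ℕ} {j : Fin (S.p n)} {u : EuclideanSpace ℝ (Fin N)} (hu : u ∈ closure V) :
    S.w n j u ∈ closure V := hV.image_closure_subset n j ⟨u, hu, rfl⟩

lemma wordMap_mem_piece {n m : ℕ} (h : n ≤ m) (σ : (k : Fin m) → Fin (S.p k))
    {u : EuclideanSpace ℝ (Fin N)} (hu : u ∈ closure V) :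
    S.wordMap m σ u ∈ S.piece V n fun k => σ (k.castLE h) := by
  induction m, h using Nat.le_induction generalizing u with
  | base => exact ⟨u, hu, rfl⟩
  | succ m h ih => exact ih (fun k => σ k.castSucc) (hV.w_mem hu)

lemma piece_succ_subset (n : ℕ) (σ : (k : Fin (n + 1)) → Fin (S.p k)) :
    S.piece V (n + 1) σ ⊆ S.piece V n fun k : Fin n => σ k.castSucc := by
  rintro _ ⟨u, hu, rfl⟩
  exact hV.wordMap_mem_piece n.le_succ σ hu

lemma piece_subset (n : ℕ) (σ : (k : Fin n) → Fin (S.p k)) : S.piece V n σ ⊆ closure V := by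
  rintro _ ⟨u, hu, rfl⟩
  simpa [piece, wordMap] using hV.wordMap_mem_piece n.zero_le σ hu

/-- If the words differ before their last letter, their pieces lie in larger pieces with countable
overlap, by induction. If they differ only in the last letter, the overlap sits inside the image of
a countable set from the open set condition. -/
lemma countable_piece_inter {n : ℕ} {σ τ : (k : Fin n) → Fin (S.p k)} (h : σ ≠ τ) :
    (S.piece V n σ ∩ S.piece V n τ).Countable := by
  induction n with
  | zero => exact absurd (Subsingleton.elim σ τ) h
  | succ n ih =>
    by_cases h1 : (fun k : Fin n => σ k.castSucc) = fun k : Fin n => τ k.castSucc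
    · have h2 : σ (Fin.last n) ≠ τ (Fin.last n) := fun h2 => h (by
        funext k
        induction k using Fin.lastCases with
        | last => exact h2
        | cast k => exact congrFun h1 k)
      have h3 := (hV.countable_inter n _ _ h2).image (S.wordMap n fun k => σ k.castSucc)
      refine h3.mono ?_
      rintro _ ⟨⟨u, hu, rfl⟩, v, hv, he⟩
      have he' : S.wordMap n (fun k => τ k.castSucc) (S.w n (τ (Fin.last n)) v) =
        S.wordMap n (fun k => σ k.castSucc) (S.w n (σ (Fin.last n)) u) := he
      rw [← h1] at he'
      refine ⟨S.w n (σ (Fin.last n)) u, ⟨image_closure_subset_closure_image _ _ ⟨u, hu, rfl⟩, ?_⟩,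
        rfl⟩
      rw [← injective_wordMap _ _ he']
      exact image_closure_subset_closure_image _ _ ⟨v, hv, rfl⟩
    · exact (ih h1).mono (Set.inter_subset_inter (hV.piece_succ_subset n σ)
        (hV.piece_succ_subset n τ))

lemma aedisjoint_piece (ν : Measure (EuclideanSpace ℝ (Fin N))) [NullSingletonClass ν] (n : ℕ) :
    Pairwise (Function.onFun (AEDisjoint ν) (S.piece V n)) :=
  fun _ _ h => (hV.countable_piece_inter h).measure_zero ν

end IsCountablyRamifiedOSC

lemma coe_iterW (n : ℕ) (K : TopologicalSpace.NonemptyCompacts (EuclideanSpace ℝ (Fin N))) :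
    (S.iterW n K : Set (EuclideanSpace ℝ (Fin N))) =
      ⋃ σ : (k : Fin n) → Fin (S.p k), S.wordMap n σ '' K := by
  induction n generalizing K with
  | zero =>
    ext z
    simp [iterW, wordMap]
  | succ n ih =>
    change (S.iterW n (S.W n K) : Set (EuclideanSpace ℝ (Fin N))) = _
    rw [ih]
    ext z
    simp only [Set.mem_iUnion]
    constructor
    · rintro ⟨σ, u, hu, rfl⟩
      obtain ⟨j, v, hv, rfl⟩ := Set.mem_iUnion.1 hu
      refine ⟨Fin.snoc (α := fun k : Fin (n + 1) => Fin (S.p k)) σ j, v, hv, ?_⟩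
      simp [wordMap]
    · rintro ⟨σ, u, hu, rfl⟩
      exact ⟨fun k => σ k.castSucc, S.w n (σ (Fin.last n)) u,
        Set.mem_iUnion.2 ⟨_, u, hu, rfl⟩, rfl⟩

namespace IsCountablyRamifiedOSC

variable (hV : S.IsCountablyRamifiedOSC V)
  {F : TopologicalSpace.NonemptyCompacts (EuclideanSpace ℝ (Fin N))}
include hV

/-- The closure of `V` as a non-empty compact set. -/
def closureCompacts : TopologicalSpace.NonemptyCompacts (EuclideanSpace ℝ (Fin N)) :=
  ⟨⟨closure V, hV.isCompact_closure⟩, hV.nonempty.closure⟩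

lemma coe_iterW_closure (n : ℕ) :
    (S.iterW n hV.closureCompacts : Set (EuclideanSpace ℝ (Fin N))) = ⋃ σ, S.piece V n σ :=
  coe_iterW n _

lemma iUnion_piece_anti : Antitone fun n => ⋃ σ, S.piece V n σ :=
  antitone_nat_of_succ_le fun n => Set.iUnion_subset fun σ =>
    (hV.piece_succ_subset n σ).trans (Set.subset_iUnion (S.piece V n) _)

/-- The iterates of `V̄` form a decreasing sequence of compact sets, so their Hausdorff limit is
their intersection. -/
lemma mem_limitFractal_iff (hF : S.IsLimitFractal F) (z : EuclideanSpace ℝ (Fin N)) :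
    z ∈ (F : Set (EuclideanSpace ℝ (Fin N))) ↔ ∀ n, z ∈ ⋃ σ, S.piece V n σ := by
  have ht := tendsto_iff_edist_tendsto_0.1 (hF hV.closureCompacts)
  have he : ∀ n, edist (S.iterW n hV.closureCompacts) F =
      Metric.hausdorffEDist (⋃ σ, S.piece V n σ) (F : Set (EuclideanSpace ℝ (Fin N))) := by
    intro n
    rw [← hV.coe_iterW_closure]
    rfl
  simp only [he] at ht
  constructor
  · intro hz n
    have hc : IsClosed (⋃ σ, S.piece V n σ) :=
      (isCompact_iUnion fun σ => hV.isCompact_piece n σ).isClosed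
    rw [← hc.closure_eq, Metric.mem_closure_iff_infEDist_zero]
    refine le_antisymm (ge_of_tendsto ht ?_) bot_le
    filter_upwards [eventually_ge_atTop n] with m hm
    refine (Metric.infEDist_anti (hV.iUnion_piece_anti hm)).trans ?_
    rw [Metric.hausdorffEDist_comm]
    exact Metric.infEDist_le_hausdorffEDist_of_mem hz
  · intro hz
    rw [← F.isCompact.isClosed.closure_eq, Metric.mem_closure_iff_infEDist_zero]
    exact le_antisymm (ge_of_tendsto' ht fun n => Metric.infEDist_le_hausdorffEDist_of_mem (hz n))
      bot_le

end IsCountablyRamifiedOSC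

/-! ### Volume estimates -/

/-- If each point lies in at most `M` of the sets, then the measures of the sets add up to at most
`M` times the total mass. -/
lemma sum_measure_le {X κ : Type*} [MeasurableSpace X] [Fintype κ] (ν : Measure X) {A : κ → Set X}
    (hA : ∀ k, MeasurableSet (A k)) {M : ℕ} (hM : ∀ z, {k | z ∈ A k}.ncard ≤ M) :
    ∑ k, ν (A k) ≤ M * ν Set.univ := by
  classical
  have h : ∀ z, ∑ k, (A k).indicator (fun _ => (1 : ℝ≥0∞)) z ≤ M := fun z => by
    simp only [Set.indicator_apply, Finset.sum_boole]
    rw [← Set.ncard_coe_finset]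
    simpa using hM z
  calc ∑ k, ν (A k) = ∑ k, ∫⁻ z, (A k).indicator (fun _ => 1) z ∂ν :=
        Finset.sum_congr rfl fun k _ => (lintegral_indicator_one (hA k)).symm
    _ = ∫⁻ z, ∑ k, (A k).indicator (fun _ => 1) z ∂ν :=
        (lintegral_finsetSum _ fun k _ => measurable_const.indicator (hA k)).symm
    _ ≤ ∫⁻ _, M ∂ν := lintegral_mono h
    _ = M * ν Set.univ := lintegral_const _

instance isAddHaarMeasure_hausdorffMeasure_euclideanSpace :
    (μH[N] : Measure (EuclideanSpace ℝ (Fin N))).IsAddHaarMeasure := by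
  simpa using isAddHaarMeasure_hausdorffMeasure (E := EuclideanSpace ℝ (Fin N))

section Ratio

variable {lam : ℕ → ℝ} (hlam : ∀ n j, S.ratio n j = lam n)
include hlam

lemma antilipschitzWith_wordMap (n : ℕ) (σ : (k : Fin n) → Fin (S.p k)) :
    AntilipschitzWith (scale lam n).toNNReal⁻¹ (S.wordMap n σ) :=
  AntilipschitzWith.of_le_mul_dist fun u v => by
    have h0 := scale_pos hlam n
    rw [dist_wordMap hlam, NNReal.coe_inv, Real.coe_toNNReal _ h0.le, inv_mul_cancel_left₀ h0.ne']

lemma le_hausdorffMeasure_wordMap_image (n : ℕ) (σ : (k : Fin n) → Fin (S.p k))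
    (B : Set (EuclideanSpace ℝ (Fin N))) :
    ENNReal.ofReal (scale lam n ^ N) * μH[N] B ≤ μH[N] (S.wordMap n σ '' B) := by
  have h0 := scale_pos hlam n
  have h := (antilipschitzWith_wordMap hlam n σ).le_hausdorffMeasure_image (Nat.cast_nonneg N) B
  have h1 : (scale lam n).toNNReal ≠ 0 := by simpa using h0
  rw [ENNReal.rpow_natCast, ENNReal.coe_inv h1, ← ENNReal.inv_pow] at h
  rw [ENNReal.ofReal_pow h0.le]
  refine (mul_le_mul_right h _).trans (le_of_eq ?_)
  rw [← mul_assoc]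
  change (((scale lam n).toNNReal : ℝ≥0∞)) ^ N * _ * _ = _
  rw [ENNReal.mul_inv_cancel (pow_ne_zero _ (by exact_mod_cast h1))
    (ENNReal.pow_ne_top ENNReal.coe_ne_top), one_mul]

variable (hV : S.IsCountablyRamifiedOSC V) (hN : 0 < N)
include hV hN

/-- The images of `V` overlap in countable sets, which are null in positive dimension, so their
volumes add up. -/
lemma card_mul_le_hausdorffMeasure {n : ℕ} (T : Finset ((k : Fin n) → Fin (S.p k)))
    {B : Set (EuclideanSpace ℝ (Fin N))} (hB : ∀ σ ∈ T, S.wordMap n σ '' V ⊆ B) :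
    (T.card : ℝ≥0∞) * (ENNReal.ofReal (scale lam n ^ N) * μH[N] V) ≤ μH[N] B := by
  have : NullSingletonClass (μH[N] : Measure (EuclideanSpace ℝ (Fin N))) :=
    Measure.nullSingletonClass_hausdorff _ (by exact_mod_cast hN)
  calc (T.card : ℝ≥0∞) * (ENNReal.ofReal (scale lam n ^ N) * μH[N] V)
      = ∑ _σ ∈ T, ENNReal.ofReal (scale lam n ^ N) * μH[N] V := by
        rw [Finset.sum_const, nsmul_eq_mul]
    _ ≤ ∑ σ ∈ T, μH[N] (S.wordMap n σ '' V) :=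
        Finset.sum_le_sum fun σ _ => le_hausdorffMeasure_wordMap_image hlam n σ V
    _ = μH[N] (⋃ σ ∈ T, S.wordMap n σ '' V) := by
        refine (measure_biUnion_finset₀ (fun σ _ τ _ h => ?_) fun σ _ =>
          ((measurableEmbedding_wordMap n σ).measurableSet_image.2
            hV.isOpen.measurableSet).nullMeasurableSet).symm
        exact (hV.aedisjoint_piece _ n h).mono (Set.image_mono subset_closure)
          (Set.image_mono subset_closure)
    _ ≤ μH[N] B := measure_mono (Set.iUnion₂_subset hB)

lemma numWords_mul_scale_pow_le (n : ℕ) : S.numWords n * scale lam n ^ N ≤ 1 := by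
  have h0 := scale_pos hlam n
  have h := card_mul_le_hausdorffMeasure hlam hV hN (n := n) Finset.univ (B := V) fun σ _ => by
    rintro _ ⟨u, hu, rfl⟩
    exact hV.wordMap_mem n σ hu
  rw [Finset.card_univ, card_words, ← mul_assoc] at h
  have hV0 : μH[N] V ≠ 0 := (hV.isOpen.measure_pos _ hV.nonempty).ne'
  have hV1 : μH[N] V ≠ ⊤ := hV.bounded.measure_lt_top.ne
  have h2 : (S.numWords n : ℝ≥0∞) * ENNReal.ofReal (scale lam n ^ N) ≤ 1 := by
    rw [← ENNReal.mul_le_mul_iff_left hV0 hV1, one_mul]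
    exact h
  rw [← ENNReal.ofReal_natCast, ← ENNReal.ofReal_mul (Nat.cast_nonneg _), ← ENNReal.ofReal_one] at h2
  exact (ENNReal.ofReal_le_ofReal_iff zero_le_one).1 h2

/-- If the piece of `σ` contains `z`, then `w_σ(V)` lies in the ball about `z` of radius `scale *
diam V̄` and has volume at least `scale ^ N` times that of `V`. The scale cancels in the comparison,
so the bound is uniform in the level. -/
lemma exists_ncard_piece_le : ∃ M : ℕ, ∀ n z, {σ | z ∈ S.piece V n σ}.ncard ≤ M := by
  classical
  have hV0 : μH[N] V ≠ 0 := (hV.isOpen.measure_pos _ hV.nonempty).ne'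
  have hV1 : μH[N] V ≠ ⊤ := hV.bounded.measure_lt_top.ne
  set D := Metric.diam (closure V)
  set b : ℝ≥0∞ := μH[N] (Metric.ball (0 : EuclideanSpace ℝ (Fin N)) 1)
  set C : ℝ≥0∞ := ENNReal.ofReal (D ^ N) * b / μH[N] V
  have hC : C ≠ ⊤ := ENNReal.div_ne_top
    (ENNReal.mul_ne_top ENNReal.ofReal_ne_top Metric.isBounded_ball.measure_lt_top.ne) hV0
  obtain ⟨M, hM⟩ := ENNReal.exists_nat_gt hC
  refine ⟨M, fun n z => ?_⟩
  have h0 := scale_pos hlam n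
  set T : Finset ((k : Fin n) → Fin (S.p k)) := {σ | z ∈ S.piece V n σ} with hT
  have h := card_mul_le_hausdorffMeasure hlam hV hN T
    (B := Metric.closedBall z (scale lam n * D)) fun σ hσ => by
      rintro _ ⟨u, hu, rfl⟩
      obtain ⟨v, hv, rfl⟩ := (Finset.mem_filter.1 hσ).2
      rw [Metric.mem_closedBall, dist_wordMap hlam]
      exact mul_le_mul_of_nonneg_left (Metric.dist_le_diam_of_mem hV.isCompact_closure.isBounded
        (subset_closure hu) hv) h0.le
  rw [Measure.addHaar_closedBall _ _ (mul_nonneg h0.le Metric.diam_nonneg),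
    finrank_euclideanSpace_fin, mul_pow, ENNReal.ofReal_mul (pow_pos h0 N).le, mul_left_comm,
    mul_assoc, ENNReal.mul_le_mul_iff_right (by simpa using pow_pos h0 N)
      ENNReal.ofReal_ne_top] at h
  have h2 : (T.card : ℝ≥0∞) < M :=
    ((ENNReal.le_div_iff_mul_le (Or.inl hV0) (Or.inl hV1)).2 h).trans_lt hM
  have h3 : {σ | z ∈ S.piece V n σ} = (T : Set ((k : Fin n) → Fin (S.p k))) := by simp [hT]
  rw [h3, Set.ncard_coe_finset]
  exact_mod_cast h2.le

end Ratio

/-! ### Finiteness of the spectral dimension. -/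

section Dimension

variable {lam : ℕ → ℝ} (hlam : ∀ n j, S.ratio n j = lam n) (hV : S.IsCountablyRamifiedOSC V)
  {x y : EuclideanSpace ℝ (Fin N)} (hx : x ∈ V) (hy : y ∈ V) (hxy : x ≠ y)
include hlam

omit hlam in
lemma pos_of_ne {x y : EuclideanSpace ℝ (Fin N)} (hxy : x ≠ y) : 0 < N := by
  rcases Nat.eq_zero_or_pos N with rfl | h
  · exact absurd (Subsingleton.elim x y) hxy
  · exact h

/-- At exponent `N + 1` the volume bound `P_n scale ^ N ≤ 1` leaves a spare factor `scale`, which is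
geometrically small. -/
theorem dimension_lt_top : (spectralTriple hV hx hy hxy).dimension < ⊤ := by
  have hr := dist_pos.2 hxy
  have hN1 : (0 : ℝ) < (N + 1 : ℕ) := by positivity
  refine lt_of_le_of_lt (iInf_le_of_le ((N + 1 : ℕ) : ℝ) (iInf_le_of_le hN1 (iInf_le_of_le
    (inLogIdealZero_absPowNeg hlam hV hx hy hxy hN1 ?_) le_rfl))) ENNReal.ofReal_lt_top
  obtain ⟨c, hc0, hc1, hc⟩ := exists_scale_le hlam
  refine Summable.of_nonneg_of_le (fun n => mul_nonneg (Nat.cast_nonneg _)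
    (levelValue_pos hlam hr n).le) (fun n => ?_)
    ((summable_geometric_of_lt_one hc0.le hc1).mul_left (2 * dist x y ^ (N + 1)))
  have h0 := scale_pos hlam n
  have h1 := numWords_mul_scale_pow_le hlam hV (pos_of_ne hxy) n
  rw [levelValue, Real.rpow_natCast, mul_pow, pow_succ (scale lam n)]
  push_cast
  calc 2 * (S.numWords n : ℝ) * (scale lam n ^ N * scale lam n * dist x y ^ (N + 1))
      = 2 * dist x y ^ (N + 1) * (S.numWords n * scale lam n ^ N * scale lam n) := by ring
    _ ≤ 2 * dist x y ^ (N + 1) * (1 * c ^ n) := by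
        gcongr
        exact hc n
    _ = _ := by rw [one_mul]

end Dimension

end LimitSystem
end FractalNCG

namespace FractalNCG
namespace LimitSystem

/-! ### Invariant measures: uniqueness -/

variable {N : ℕ} {S : LimitSystem N} {V : Set (EuclideanSpace ℝ (Fin N))}
  {F : TopologicalSpace.NonemptyCompacts (EuclideanSpace ℝ (Fin N))}
  {ν : Measure (EuclideanSpace ℝ (Fin N))}

/-- Invariance changes only the letter after a common prefix; induction on the length changes all
letters. -/
lemma IsInvariantOn.measure_wordMap_image_eq (hν : S.IsInvariantOn V F ν)
    (hV : S.IsCountablyRamifiedOSC V) {n : ℕ} (σ τ : (k : Fin n) → Fin (S.p k))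
    {B : Set (EuclideanSpace ℝ (Fin N))} (hB : MeasurableSet B) (hBV : B ⊆ closure V) :
    ν (S.wordMap n σ '' B) = ν (S.wordMap n τ '' B) := by
  induction n generalizing B with
  | zero => rw [Subsingleton.elim σ τ]
  | succ n ih =>
    have h1 := ih (fun k => σ k.castSucc) (fun k => τ k.castSucc)
      ((measurableEmbedding_w n (σ (Fin.last n))).measurableSet_image.2 hB)
      ((Set.image_mono hBV).trans (hV.image_closure_subset n _))
    have h2 := hν.2 ⟨n, fun k => τ k.castSucc⟩ (σ (Fin.last n)) (τ (Fin.last n)) B hB hBV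
    rw [← Set.image_comp, ← Set.image_comp] at h1
    exact h1.trans h2

lemma measure_iUnion_piece [IsProbabilityMeasure ν] (hV : S.IsCountablyRamifiedOSC V)
    (hF : S.IsLimitFractal F) (hν : ν (F : Set (EuclideanSpace ℝ (Fin N)))ᶜ = 0) (n : ℕ) :
    ν (⋃ σ, S.piece V n σ) = 1 := by
  have h1 := (prob_compl_eq_zero_iff F.isCompact.measurableSet).1 hν
  exact le_antisymm prob_le_one (h1 ▸ measure_mono fun z hz =>
    (hV.mem_limitFractal_iff hF z).1 hz n)

/-- Write `z = w_σ(b)`. The `P_n` points `w_τ(b)` have equal mass, and at most `M` of them coincide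
at any given point because `w_τ(b)` lies in the piece of `τ`. -/
lemma IsInvariantOn.numWords_mul_measure_singleton_le [IsProbabilityMeasure ν]
    (hν : S.IsInvariantOn V F ν) (hV : S.IsCountablyRamifiedOSC V) (hF : S.IsLimitFractal F)
    {M : ℕ} (hM : ∀ n z, {σ | z ∈ S.piece V n σ}.ncard ≤ M) (n : ℕ)
    (z : EuclideanSpace ℝ (Fin N)) : S.numWords n * ν {z} ≤ M := by
  by_cases hz : z ∈ (F : Set (EuclideanSpace ℝ (Fin N)))
  · obtain ⟨σ, b, hb, rfl⟩ := Set.mem_iUnion.1 ((hV.mem_limitFractal_iff hF z).1 hz n)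
    have h1 : ∀ τ, ν {S.wordMap n τ b} = ν {S.wordMap n σ b} := fun τ => by
      have := hν.measure_wordMap_image_eq hV τ σ (measurableSet_singleton b)
        (Set.singleton_subset_iff.2 hb)
      rwa [Set.image_singleton, Set.image_singleton] at this
    have h2 := sum_measure_le ν (A := fun τ => {S.wordMap n τ b})
      (fun τ => measurableSet_singleton _) (M := M) fun u =>
        (Set.ncard_le_ncard (fun τ hτ => by
          rw [Set.mem_ofPred_eq, Set.mem_singleton_iff] at hτ
          exact ⟨b, hb, hτ.symm⟩) (Set.toFinite _)).trans (hM n u)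
    rwa [Finset.sum_congr rfl fun τ _ => h1 τ, Finset.sum_const, Finset.card_univ, card_words,
      nsmul_eq_mul, measure_univ, mul_one] at h2
  · have : ν {z} = 0 := measure_mono_null (Set.singleton_subset_iff.2 hz) hν.1
    simp [this]

lemma nullSingletonClass_of_mul_le {M : ℕ} (hP : Tendsto S.numWords atTop atTop)
    (h : ∀ n z, S.numWords n * ν {z} ≤ M) : NullSingletonClass ν where
  measure_singleton z := by
    by_contra h0
    have h1 : ∀ n, (S.numWords n : ℝ≥0∞) ≤ M / ν {z} := fun n =>
      (ENNReal.le_div_iff_mul_le (Or.inl h0) (Or.inr (ENNReal.natCast_ne_top M))).2 (h n z)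
    obtain ⟨K, hK⟩ := ENNReal.exists_nat_gt (ENNReal.div_ne_top (ENNReal.natCast_ne_top M) h0)
    obtain ⟨n, hn⟩ := (hP.eventually_ge_atTop K).exists
    exact absurd ((Nat.cast_le.2 hn).trans (h1 n)) (not_le.2 hK)

/-- A measure that is equidistributed over the pieces of each level. -/
structure IsEquidistributed (S : LimitSystem N) (V : Set (EuclideanSpace ℝ (Fin N)))
    (ν : Measure (EuclideanSpace ℝ (Fin N))) : Prop where
  aedisjoint : ∀ n, Pairwise (Function.onFun (AEDisjoint ν) (S.piece V n))
  measure_iUnion : ∀ n, ν (⋃ σ, S.piece V n σ) = 1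
  measure_piece : ∀ n σ, ν.real (S.piece V n σ) = (S.numWords n : ℝ)⁻¹

/-- Without atoms the countable overlaps are null, so the `P_n` pieces of equal measure share the
total mass `1`. -/
lemma IsInvariantOn.isEquidistributed [IsProbabilityMeasure ν] [NullSingletonClass ν]
    (hν : S.IsInvariantOn V F ν) (hV : S.IsCountablyRamifiedOSC V) (hF : S.IsLimitFractal F) :
    IsEquidistributed S V ν where
  aedisjoint := hV.aedisjoint_piece ν
  measure_iUnion := measure_iUnion_piece hV hF hν.1
  measure_piece n σ := by
    have h1 := measure_iUnion_piece hV hF hν.1 n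
    have h0 : ∀ τ, ν (S.piece V n τ) = ν (S.piece V n σ) := fun τ =>
      hν.measure_wordMap_image_eq hV τ σ isClosed_closure.measurableSet subset_rfl
    rw [measure_iUnion₀ (hV.aedisjoint_piece ν n)
      fun σ => (hV.measurableSet_piece n σ).nullMeasurableSet, tsum_fintype,
      Finset.sum_congr rfl fun τ _ => h0 τ, Finset.sum_const, Finset.card_univ,
      card_words, nsmul_eq_mul] at h1
    have h2 := congrArg ENNReal.toReal h1
    rw [ENNReal.toReal_mul, ENNReal.toReal_natCast, ENNReal.toReal_one] at h2
    exact eq_inv_of_mul_eq_one_right h2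

/-- The mean value of `g` over the points `w_σ(x)` of level `n`. -/
def levelMean (S : LimitSystem N) (x : EuclideanSpace ℝ (Fin N))
    (g : EuclideanSpace ℝ (Fin N) → ℝ) (n : ℕ) : ℝ :=
  (S.numWords n : ℝ)⁻¹ * ∑ σ : (k : Fin n) → Fin (S.p k), g (S.wordMap n σ x)

lemma eventually_abs_sub_wordMap_le (hV : S.IsCountablyRamifiedOSC V)
    {g : EuclideanSpace ℝ (Fin N) → ℝ} (hg : ContinuousOn g (closure V)) {ε : ℝ} (hε : 0 < ε) :
    ∀ᶠ n in atTop, ∀ σ, ∀ a ∈ S.piece V n σ, ∀ b ∈ S.piece V n σ, |g a - g b| ≤ ε := by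
  have hu := hV.isCompact_closure.uniformContinuousOn_of_continuous hg
  obtain ⟨δ, hδ, h⟩ := Metric.uniformContinuousOn_iff.1 hu ε hε
  obtain ⟨c, hc1, hc⟩ := S.ratio_bound
  have hc0 : 0 ≤ c := (S.ratio_pos 0 ⟨0, S.p_pos 0⟩).le.trans (hc _ _)
  have ht : Tendsto (fun n : ℕ => c ^ n * Metric.diam (closure V)) atTop (𝓝 0) := by
    simpa using (tendsto_pow_atTop_nhds_zero_of_lt_one hc0 hc1).mul_const (Metric.diam (closure V))
  filter_upwards [ht.eventually_lt_const hδ] with n hn σ a ha b hb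
  refine (h a (hV.piece_subset n σ ha) b (hV.piece_subset n σ hb) ?_).le
  obtain ⟨u, hu, rfl⟩ := ha
  obtain ⟨v, hv, rfl⟩ := hb
  refine ((S.wordMap_dist_le hc0 hc n σ u v).trans ?_).trans_lt hn
  exact mul_le_mul_of_nonneg_left
    (Metric.dist_le_diam_of_mem hV.isCompact_closure.isBounded hu hv) (pow_nonneg hc0 n)

lemma IsEquidistributed.closure_ae_eq_univ [IsProbabilityMeasure ν]
    (hν : IsEquidistributed S V ν) (hV : S.IsCountablyRamifiedOSC V) :
    closure V =ᵐ[ν] (Set.univ : Set (EuclideanSpace ℝ (Fin N))) := by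
  refine (ae_eq_univ_iff_measure_eq isClosed_closure.nullMeasurableSet).2
    (le_antisymm (measure_mono (Set.subset_univ _)) ?_)
  rw [measure_univ, ← hν.measure_iUnion 0]
  exact measure_mono (Set.iUnion_subset (hV.piece_subset 0))

/-- On each piece of a late level `g` is within `ε / 2` of its value at `w_σ(x)`, and the pieces all
have mass `1 / P_n`. -/
lemma IsEquidistributed.tendsto_levelMean [IsProbabilityMeasure ν]
    (hν : IsEquidistributed S V ν) (hV : S.IsCountablyRamifiedOSC V)
    {x : EuclideanSpace ℝ (Fin N)} (hx : x ∈ closure V) {g : EuclideanSpace ℝ (Fin N) → ℝ}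
    (hg : ContinuousOn g (closure V)) :
    Tendsto (levelMean S x g) atTop (𝓝 (∫ z in closure V, g z ∂ν)) := by
  rw [Metric.tendsto_nhds]
  intro ε hε
  filter_upwards [eventually_abs_sub_wordMap_le hV hg (half_pos hε)] with n hn
  have hint : IntegrableOn g (closure V) ν := hg.integrableOn_compact hV.isCompact_closure
  have hsub : (⋃ σ, S.piece V n σ) ⊆ closure V := Set.iUnion_subset (hV.piece_subset n)
  have hm : MeasurableSet (⋃ σ, S.piece V n σ) := .iUnion (hV.measurableSet_piece n)
  have hae : closure V =ᵐ[ν] (⋃ σ, S.piece V n σ : Set _) := by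
    have h1 : (⋃ σ, S.piece V n σ) =ᵐ[ν] (Set.univ : Set (EuclideanSpace ℝ (Fin N))) :=
      (ae_eq_univ_iff_measure_eq hm.nullMeasurableSet).2
        ((hν.measure_iUnion n).trans measure_univ.symm)
    exact (hν.closure_ae_eq_univ hV).trans h1.symm
  have hP : (0 : ℝ) < S.numWords n := by exact_mod_cast S.numWords_pos n
  have hpiece : ∀ σ, |∫ z in S.piece V n σ, g z ∂ν - (S.numWords n : ℝ)⁻¹ * g (S.wordMap n σ x)| ≤
      ε / 2 * (S.numWords n : ℝ)⁻¹ := fun σ => by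
    have h1 : (S.numWords n : ℝ)⁻¹ * g (S.wordMap n σ x) =
        ∫ _ in S.piece V n σ, g (S.wordMap n σ x) ∂ν := by
      rw [setIntegral_const, hν.measure_piece, smul_eq_mul]
    rw [h1, ← integral_sub (hint.mono_set (hV.piece_subset n σ)) integrableOn_const,
      ← hν.measure_piece n σ]
    rw [← Real.norm_eq_abs]
    refine norm_setIntegral_le_of_norm_le_const (measure_lt_top _ _) fun z hz => ?_
    rw [Real.norm_eq_abs]
    exact hn σ z hz _ ⟨x, hx, rfl⟩
  rw [setIntegral_congr_set hae, integral_iUnion_ae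
    (fun σ => (hV.measurableSet_piece n σ).nullMeasurableSet) (hν.aedisjoint n)
    (hint.mono_set hsub), tsum_fintype, levelMean, dist_comm, Real.dist_eq, Finset.mul_sum,
    ← Finset.sum_sub_distrib]
  calc _ ≤ ∑ σ : (k : Fin n) → Fin (S.p k), ε / 2 * (S.numWords n : ℝ)⁻¹ :=
        (Finset.abs_sum_le_sum_abs _ _).trans (Finset.sum_le_sum fun σ _ => hpiece σ)
    _ = ε / 2 := by
        rw [Finset.sum_const, Finset.card_univ, card_words, nsmul_eq_mul]
        field_simp
    _ < ε := half_lt_self hε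

/-- The level means do not involve the measure, yet determine the integrals of bounded continuous
functions. -/
lemma IsEquidistributed.eq [IsProbabilityMeasure ν] {μ : Measure (EuclideanSpace ℝ (Fin N))}
    [IsProbabilityMeasure μ] (hν : IsEquidistributed S V ν) (hμ : IsEquidistributed S V μ)
    (hV : S.IsCountablyRamifiedOSC V) : ν = μ := by
  obtain ⟨x, hx⟩ := hV.nonempty
  refine ext_of_forall_integral_eq_of_IsFiniteMeasure fun g => ?_
  have h1 := hν.tendsto_levelMean hV (subset_closure hx) (g := g) g.continuous.continuousOn
  have h2 := hμ.tendsto_levelMean hV (subset_closure hx) (g := g) g.continuous.continuousOn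
  rw [setIntegral_congr_set (hν.closure_ae_eq_univ hV), setIntegral_univ] at h1
  rw [setIntegral_congr_set (hμ.closure_ae_eq_univ hV), setIntegral_univ] at h2
  exact tendsto_nhds_unique h1 h2

end LimitSystem
end FractalNCG

namespace FractalNCG
namespace LimitSystem

/-! ### Permutations of the letters and infinite words -/

variable {N : ℕ} (S : LimitSystem N)

instance (n : ℕ) : NeZero (S.p n) := ⟨(S.p_pos n).ne'⟩

variable {S}

/-- The permutations of the letters that exchange the letters of `σ` and `τ`. -/
def letterSwap {n : ℕ} (σ τ : (k : Fin n) → Fin (S.p k)) (k : ℕ) : Equiv.Perm (Fin (S.p k)) :=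
  if h : k < n then Equiv.swap (σ ⟨k, h⟩) (τ ⟨k, h⟩) else Equiv.refl _

lemma letterSwap_of_le {n : ℕ} (σ τ : (k : Fin n) → Fin (S.p k)) {k : ℕ} (h : n ≤ k)
    (j : Fin (S.p k)) : letterSwap σ τ k j = j := by
  rw [letterSwap, dif_neg (not_lt.2 h), Equiv.refl_apply]

lemma letterSwap_eq_iff {n : ℕ} (σ τ : (k : Fin n) → Fin (S.p k)) (k : Fin n) (j : Fin (S.p k)) :
    letterSwap σ τ k j = τ k ↔ j = σ k := by
  rw [letterSwap, dif_pos k.2, Equiv.swap_apply_eq_iff, Equiv.swap_apply_right]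

variable {V : Set (EuclideanSpace ℝ (Fin N))}
  {F : TopologicalSpace.NonemptyCompacts (EuclideanSpace ℝ (Fin N))}

/-- The points `w_{ω|n}(x)` move by geometrically small steps, and the starting point is forgotten
in the limit. Measurability holds since each approximation depends on finitely many letters. -/
lemma exists_code (hV : S.IsCountablyRamifiedOSC V) :
    ∃ code : ((k : ℕ) → Fin (S.p k)) → EuclideanSpace ℝ (Fin N), Measurable code ∧
      ∀ (ω : (k : ℕ) → Fin (S.p k)) (u : EuclideanSpace ℝ (Fin N)), u ∈ closure V →
        Tendsto (fun n => S.wordMap n (fun k => ω k) u) atTop (𝓝 (code ω)) := by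
  obtain ⟨c, hc1, hc⟩ := S.ratio_bound
  have hc0 : 0 ≤ c := (S.ratio_pos 0 ⟨0, S.p_pos 0⟩).le.trans (hc _ _)
  set D := Metric.diam (closure V)
  have hD : ∀ {u v}, u ∈ closure V → v ∈ closure V → dist u v ≤ D := fun hu hv =>
    Metric.dist_le_diam_of_mem hV.isCompact_closure.isBounded hu hv
  have ht : Tendsto (fun n : ℕ => c ^ n * D) atTop (𝓝 0) := by
    simpa using (tendsto_pow_atTop_nhds_zero_of_lt_one hc0 hc1).mul_const D
  obtain ⟨x, hx⟩ := hV.nonempty.closure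
  have hlim : ∀ ω : (k : ℕ) → Fin (S.p k), ∃ z,
      Tendsto (fun n => S.wordMap n (fun k => ω k) x) atTop (𝓝 z) := fun ω => by
    refine cauchySeq_tendsto_of_complete (cauchySeq_of_le_geometric c D hc1 fun n => ?_)
    refine (S.wordMap_dist_le hc0 hc n (fun k => ω k) x (S.w n (ω n) x)).trans ?_
    rw [mul_comm]
    exact mul_le_mul_of_nonneg_right (hD hx (hV.w_mem hx)) (pow_nonneg hc0 n)
  choose code hcode using hlim
  refine ⟨code, ?_, fun ω u hu => ?_⟩
  · refine measurable_of_tendsto_metrizable (f := fun n ω => S.wordMap n (fun k => ω k) x)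
      (fun n => ?_) (tendsto_pi_nhds.2 hcode)
    exact (measurable_of_countable fun σ : (k : Fin n) → Fin (S.p k) => S.wordMap n σ x).comp
      (measurable_pi_lambda _ fun k => measurable_pi_apply _)
  · refine (hcode ω).congr_dist (squeeze_zero (fun _ => dist_nonneg) (fun n => ?_) ht)
    exact (S.wordMap_dist_le hc0 hc n _ x u).trans
      (mul_le_mul_of_nonneg_left (hD hx hu) (pow_nonneg hc0 n))

section Code

variable {code : ((k : ℕ) → Fin (S.p k)) → EuclideanSpace ℝ (Fin N)}
  (hcode : ∀ (ω : (k : ℕ) → Fin (S.p k)) (u : EuclideanSpace ℝ (Fin N)), u ∈ closure V →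
    Tendsto (fun n => S.wordMap n (fun k => ω k) u) atTop (𝓝 (code ω)))
include hcode

lemma code_mem_piece (hV : S.IsCountablyRamifiedOSC V) (ω : (k : ℕ) → Fin (S.p k)) (n : ℕ) :
    code ω ∈ S.piece V n fun k => ω k := by
  obtain ⟨x, hx⟩ := hV.nonempty.closure
  refine (hV.isCompact_piece n _).isClosed.mem_of_tendsto (hcode ω x hx) ?_
  filter_upwards [eventually_ge_atTop n] with m hm
  exact hV.wordMap_mem_piece hm (fun k => ω k) hx

omit hcode in
lemma exists_wordMap_eq {ω ω' : (k : ℕ) → Fin (S.p k)} {n m : ℕ} (h : ∀ k, n ≤ k → ω' k = ω k)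
    (hm : n ≤ m) (u : EuclideanSpace ℝ (Fin N)) :
    ∃ z, S.wordMap m (fun k => ω k) u = S.wordMap n (fun k => ω k) z ∧
      S.wordMap m (fun k => ω' k) u = S.wordMap n (fun k => ω' k) z := by
  induction m, hm using Nat.le_induction generalizing u with
  | base => exact ⟨u, rfl, rfl⟩
  | succ m hm ih =>
    obtain ⟨z, h1, h2⟩ := ih (S.w m (ω m) u)
    refine ⟨z, h1, ?_⟩
    rw [← h m hm] at h2
    exact h2

/-- Beyond letter `n` both words apply the same maps, and the two prefix maps are similarities of
equal ratio. So the distance of the `m`-th approximation of `ω` to `w_{ω|n}(b)` equals the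
corresponding distance for `ω'`, and both tend to `0`. -/
lemma code_eq_wordMap (hV : S.IsCountablyRamifiedOSC V) {lam : ℕ → ℝ}
    (hlam : ∀ n j, S.ratio n j = lam n) {ω ω' : (k : ℕ) → Fin (S.p k)} {n : ℕ}
    (h : ∀ k, n ≤ k → ω' k = ω k) {b : EuclideanSpace ℝ (Fin N)}
    (hb : code ω = S.wordMap n (fun k => ω k) b) : code ω' = S.wordMap n (fun k => ω' k) b := by
  obtain ⟨x, hx⟩ := hV.nonempty.closure
  have h1 := (hcode ω x hx).dist (tendsto_const_nhds (x := S.wordMap n (fun k => ω k) b))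
  have h2 := (hcode ω' x hx).dist (tendsto_const_nhds (x := S.wordMap n (fun k => ω' k) b))
  rw [hb, dist_self] at h1
  refine dist_eq_zero.1 (tendsto_nhds_unique h2 (h1.congr' ?_))
  filter_upwards [eventually_ge_atTop n] with m hm
  obtain ⟨z, h3, h4⟩ := exists_wordMap_eq h hm x
  rw [h3, h4, dist_wordMap hlam, dist_wordMap hlam]

end Code

/-! ### The uniform distribution on infinite words and the existence of an invariant measure. -/

variable (S) in
/-- The uniform distribution on the letters. -/
def letterMeasure (n : ℕ) : Measure (Fin (S.p n)) := (PMF.uniformOfFintype (Fin (S.p n))).toMeasure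

instance (n : ℕ) : IsProbabilityMeasure (S.letterMeasure n) :=
  PMF.toMeasure.isProbabilityMeasure _

lemma letterMeasure_singleton (n : ℕ) (j : Fin (S.p n)) :
    S.letterMeasure n {j} = (S.p n : ℝ≥0∞)⁻¹ := by
  rw [letterMeasure, PMF.toMeasure_apply_singleton _ _ (measurableSet_singleton j),
    PMF.uniformOfFintype_apply, Fintype.card_fin]

lemma map_letterMeasure (n : ℕ) (e : Equiv.Perm (Fin (S.p n))) :
    (S.letterMeasure n).map e = S.letterMeasure n := by
  refine Measure.ext_of_singleton fun j => ?_
  rw [Measure.map_apply (measurable_of_countable _) (measurableSet_singleton j),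
    letterMeasure_singleton]
  have h : e ⁻¹' {j} = {e.symm j} := by
    ext i
    simp [Equiv.eq_symm_apply]
  rw [h, letterMeasure_singleton]

variable (S) in
/-- The uniform distribution on the infinite words. -/
def addressMeasure : Measure ((k : ℕ) → Fin (S.p k)) := Measure.infinitePi S.letterMeasure

instance : IsProbabilityMeasure S.addressMeasure := by
  unfold addressMeasure; infer_instance

lemma addressMeasure_prefix (n : ℕ) (σ : (k : Fin n) → Fin (S.p k)) :
    S.addressMeasure {ω | (fun k : Fin n => ω k) = σ} = (S.numWords n : ℝ≥0∞)⁻¹ := by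
  have h : {ω : (k : ℕ) → Fin (S.p k) | (fun k : Fin n => ω k) = σ} =
      Set.pi (Finset.range n : Set ℕ) fun k => {j | ∀ h : k < n, j = σ ⟨k, h⟩} := by
    ext ω
    simp only [Set.mem_ofPred_eq, Set.mem_pi, Finset.coe_range, Set.mem_Iio]
    exact ⟨fun h k hk hk' => congrFun h ⟨k, hk⟩, fun h => funext fun k => h k k.2 k.2⟩
  rw [h, addressMeasure, Measure.infinitePi_pi _ fun _ _ => Set.Finite.measurableSet (Set.toFinite _),
    numWords, Nat.cast_prod, ENNReal.prod_inv_distrib (fun k _ _ _ _ =>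
      Or.inl (by exact_mod_cast (S.p_pos k).ne'))]
  refine Finset.prod_congr rfl fun k hk => ?_
  rw [← letterMeasure_singleton k (σ ⟨k, Finset.mem_range.1 hk⟩)]
  congr 1
  ext j
  simp [Finset.mem_range.1 hk]

lemma addressMeasure_preimage (e : (k : ℕ) → Equiv.Perm (Fin (S.p k)))
    {Y : Set ((k : ℕ) → Fin (S.p k))} (hY : MeasurableSet Y) :
    S.addressMeasure ((fun ω k => e k (ω k)) ⁻¹' Y) = S.addressMeasure Y := by
  have h : S.addressMeasure.map (fun ω k => e k (ω k)) = S.addressMeasure := by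
    rw [addressMeasure, Measure.infinitePi_map_pi _ fun _ => measurable_of_countable _]
    simp only [map_letterMeasure]
  have hm : Measurable fun (ω : (k : ℕ) → Fin (S.p k)) k => e k (ω k) :=
    measurable_pi_lambda _ fun k => (measurable_of_countable (e k)).comp (measurable_pi_apply k)
  rw [← Measure.map_apply hm hY, h]

lemma measurable_prefix (n : ℕ) :
    Measurable fun (ω : (k : ℕ) → Fin (S.p k)) (k : Fin n) => ω k :=
  measurable_pi_lambda _ fun _ => measurable_pi_apply _

/-- The measure is the image of the uniform distribution on infinite words under the coding map;
exchanging letters in a prefix preserves that distribution. -/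
theorem exists_isInvariantOn (hV : S.IsCountablyRamifiedOSC V) {lam : ℕ → ℝ}
    (hlam : ∀ n j, S.ratio n j = lam n) (hF : S.IsLimitFractal F)
    (hP : Tendsto S.numWords atTop atTop) {M : ℕ}
    (hM : ∀ n z, {σ | z ∈ S.piece V n σ}.ncard ≤ M) :
    ∃ μ, IsProbabilityMeasure μ ∧ S.IsInvariantOn V F μ := by
  classical
  obtain ⟨code, hmeas, hcode⟩ := exists_code hV
  have hprob : IsProbabilityMeasure (S.addressMeasure.map code) :=
    Measure.isProbabilityMeasure_map hmeas.aemeasurable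
  have hatom : NullSingletonClass (S.addressMeasure.map code) := by
    refine nullSingletonClass_of_mul_le hP (M := M) fun n z => ?_
    set T : Finset ((k : Fin n) → Fin (S.p k)) := {σ | z ∈ S.piece V n σ} with hT
    have hT' : T.card ≤ M := by
      rw [← Set.ncard_coe_finset]
      simpa [hT] using hM n z
    -- A code of `z` must begin with one of the at most `M` words of length `n` whose piece contains
    -- `z`.
    have h1 : code ⁻¹' {z} ⊆ ⋃ σ ∈ T, {ω | (fun k : Fin n => ω k) = σ} := fun ω hω => by
      refine Set.mem_iUnion₂.2 ⟨fun k => ω k, Finset.mem_filter.2 ⟨Finset.mem_univ _, ?_⟩, rfl⟩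
      rw [← (hω : code ω = z)]
      exact code_mem_piece hcode hV ω n
    rw [Measure.map_apply hmeas (measurableSet_singleton z)]
    have hP0 : (S.numWords n : ℝ≥0∞) ≠ 0 := by exact_mod_cast (S.numWords_pos n).ne'
    calc (S.numWords n : ℝ≥0∞) * S.addressMeasure (code ⁻¹' {z})
        ≤ S.numWords n * ∑ σ ∈ T, S.addressMeasure {ω | (fun k : Fin n => ω k) = σ} := by
          gcongr
          exact (measure_mono h1).trans (measure_biUnion_finset_le _ _)
      _ = T.card := by
          simp only [addressMeasure_prefix, Finset.sum_const, nsmul_eq_mul]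
          rw [mul_left_comm, ENNReal.mul_inv_cancel hP0 (ENNReal.natCast_ne_top _), mul_one]
      _ ≤ M := by exact_mod_cast hT'
  -- A word with another prefix that is coded into `w_τ(B)` is coded into a countable overlap of
  -- pieces, and the image measure has no atoms.
  have hcount : ∀ (n : ℕ) (τ : (k : Fin n) → Fin (S.p k)) (B : Set (EuclideanSpace ℝ (Fin N))),
      MeasurableSet B → B ⊆ closure V → S.addressMeasure.map code (S.wordMap n τ '' B) =
        S.addressMeasure ({ω | (fun k : Fin n => ω k) = τ} ∩ code ⁻¹' (S.wordMap n τ '' B)) := by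
    intro n τ B hB hBV
    have hX := (measurableEmbedding_wordMap n τ).measurableSet_image.2 hB
    rw [Measure.map_apply hmeas hX]
    refine le_antisymm ?_ (measure_mono Set.inter_subset_right)
    have hnull : S.addressMeasure (code ⁻¹' (⋃ ρ ∈ {ρ | ρ ≠ τ}, S.piece V n ρ ∩ S.piece V n τ)) =
        0 := by
      have hc : (⋃ ρ ∈ {ρ | ρ ≠ τ}, S.piece V n ρ ∩ S.piece V n τ).Countable :=
        (Set.to_countable _).biUnion fun _ hρ => hV.countable_piece_inter hρ
      rw [← Measure.map_apply hmeas hc.measurableSet]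
      exact hc.measure_zero _
    rw [← add_zero (S.addressMeasure (_ ∩ _)), ← hnull]
    refine (measure_mono fun ω hω => ?_).trans (measure_union_le _ _)
    by_cases h : (fun k : Fin n => ω k) = τ
    · exact Or.inl ⟨h, hω⟩
    · exact Or.inr (Set.mem_iUnion₂.2 ⟨_, h, code_mem_piece hcode hV ω n,
        Set.image_mono hBV hω⟩)
  have hinv : ∀ (n : ℕ) (σ τ : (k : Fin n) → Fin (S.p k)) (B : Set (EuclideanSpace ℝ (Fin N))),
      MeasurableSet B → B ⊆ closure V → S.addressMeasure.map code (S.wordMap n σ '' B) =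
        S.addressMeasure.map code (S.wordMap n τ '' B) := by
    intro n σ τ B hB hBV
    have hX := (measurableEmbedding_wordMap n τ).measurableSet_image.2 hB
    have h1 : MeasurableSet ({ω : (k : ℕ) → Fin (S.p k) | (fun k : Fin n => ω k) = τ} ∩
        code ⁻¹' (S.wordMap n τ '' B)) :=
      (measurable_prefix n (measurableSet_singleton τ)).inter (hmeas hX)
    rw [hcount n σ B hB hBV, hcount n τ B hB hBV, ← addressMeasure_preimage (letterSwap σ τ) h1]
    congr 1
    ext ω
    have hpre : (fun k : Fin n => letterSwap σ τ k (ω k)) = τ ↔ (fun k : Fin n => ω k) = σ := by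
      simp only [funext_iff, letterSwap_eq_iff]
    have htail : ∀ k, n ≤ k → letterSwap σ τ k (ω k) = ω k := fun k hk => letterSwap_of_le σ τ hk _
    simp only [Set.mem_inter_iff, Set.mem_ofPred_eq, Set.mem_preimage, hpre]
    refine and_congr_right fun h => ⟨?_, ?_⟩
    · rintro ⟨b, hb, he⟩
      refine ⟨b, hb, ?_⟩
      have h1 := code_eq_wordMap hcode hV hlam htail (b := b) (by rw [h]; exact he.symm)
      rw [hpre.2 h] at h1
      exact h1.symm
    · rintro ⟨b, hb, he⟩
      refine ⟨b, hb, ?_⟩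
      have h1 := code_eq_wordMap hcode hV hlam (fun k hk => (htail k hk).symm) (b := b)
        (by rw [hpre.2 h]; exact he.symm)
      rw [h] at h1
      exact h1.symm
  refine ⟨S.addressMeasure.map code, hprob, ?_, fun σ i j B hB hBV => ?_⟩
  · rw [Measure.map_apply hmeas F.isCompact.measurableSet.compl]
    refine measure_mono_null (fun ω hω => hω ?_) measure_empty
    exact (hV.mem_limitFractal_iff hF _).2 fun n =>
      Set.mem_iUnion.2 ⟨_, code_mem_piece hcode hV ω n⟩
  · have h := hinv (σ.1 + 1) (Fin.snoc (α := fun k : Fin (σ.1 + 1) => Fin (S.p k)) σ.2 i)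
      (Fin.snoc (α := fun k : Fin (σ.1 + 1) => Fin (S.p k)) σ.2 j) B hB hBV
    simpa [wordMap] using h

end LimitSystem
end FractalNCG

namespace FractalNCG

/-! ### Singular traces of diagonal operators -/

section DiagTrace

variable {ι : Type}

/-- Non-negative bounded functions. -/
structure NonnegBdd (c : ι → ℝ) : Prop where
  nonneg : ∀ i, 0 ≤ c i
  bounded : ∃ C : ℝ, ∀ i, ‖(c i : ℂ)‖ ≤ C

/-- The value of `τ` at the diagonal operator with entries `c`. -/
def diagTrace (τ : (L2 ι →L[ℂ] L2 ι) → ℝ≥0∞) (c : ι → ℝ) : ℝ≥0∞ :=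
  ⨅ h : ∃ C : ℝ, ∀ i, ‖(c i : ℂ)‖ ≤ C, τ (realDiag c h)

lemma diagTrace_eq (τ : (L2 ι →L[ℂ] L2 ι) → ℝ≥0∞) {c : ι → ℝ}
    (h : ∃ C : ℝ, ∀ i, ‖(c i : ℂ)‖ ≤ C) : diagTrace τ c = τ (realDiag c h) := iInf_pos h

namespace NonnegBdd

variable {c d : ι → ℝ}

lemma add (hc : NonnegBdd c) (hd : NonnegBdd d) : NonnegBdd fun i => c i + d i :=
  ⟨fun i => add_nonneg (hc.1 i) (hd.1 i), bounded_add hc.2 hd.2⟩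

lemma mul (hc : NonnegBdd c) (hd : NonnegBdd d) : NonnegBdd fun i => c i * d i :=
  ⟨fun i => mul_nonneg (hc.1 i) (hd.1 i), bounded_mul hc.2 hd.2⟩

lemma const {a : ℝ} (ha : 0 ≤ a) : NonnegBdd fun _ : ι => a :=
  ⟨fun _ => ha, ‖(a : ℂ)‖, fun _ => le_rfl⟩

lemma mono (hd : NonnegBdd d) (h0 : ∀ i, 0 ≤ c i) (h : ∀ i, c i ≤ d i) : NonnegBdd c :=
  ⟨h0, bounded_of_abs_le hd.2 fun i => by
    rw [abs_of_nonneg (h0 i), abs_of_nonneg (hd.1 i)]; exact h i⟩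

lemma indicator (hc : NonnegBdd c) (s : Set ι) : NonnegBdd (s.indicator c) :=
  hc.mono (fun _ => Set.indicator_nonneg (fun i _ => hc.1 i) _)
    fun i => Set.indicator_le_self' (fun i _ => hc.1 i) i

lemma sum {κ : Type*} (s : Finset κ) {c : κ → ι → ℝ} (hc : ∀ k ∈ s, NonnegBdd (c k)) :
    NonnegBdd fun i => ∑ k ∈ s, c k i := by
  classical
  induction s using Finset.induction_on with
  | empty => simpa using const le_rfl
  | insert a s ha ih =>
    simp only [Finset.sum_insert ha]
    exact (hc a (Finset.mem_insert_self a s)).add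
      (ih fun k hk => hc k (Finset.mem_insert_of_mem hk))

end NonnegBdd

namespace IsSingularTrace

variable {τ : (L2 ι →L[ℂ] L2 ι) → ℝ≥0∞} (hτ : IsSingularTrace τ) {c d : ι → ℝ}
include hτ

lemma diagTrace_add (hc : NonnegBdd c) (hd : NonnegBdd d) :
    diagTrace τ (fun i => c i + d i) = diagTrace τ c + diagTrace τ d := by
  rw [diagTrace_eq τ (hc.add hd).2, diagTrace_eq τ hc.2, diagTrace_eq τ hd.2,
    ← hτ.map_add _ _ (isPositive_realDiag hc.1 hc.2) (isPositive_realDiag hd.1 hd.2),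
    ← realDiag_add]

lemma diagTrace_const_mul {a : ℝ} (ha : 0 ≤ a) (hc : NonnegBdd c) :
    diagTrace τ (fun i => a * c i) = ENNReal.ofReal a * diagTrace τ c := by
  have h : realDiag (fun i => a * c i) ((NonnegBdd.const ha).mul hc).2 =
      ((a.toNNReal : ℝ) : ℂ) • realDiag c hc.2 := by
    rw [Real.coe_toNNReal a ha]
    ext ξ i
    change ((a * c i : ℝ) : ℂ) * ξ i = (a : ℂ) * (c i * ξ i)
    rw [Complex.ofReal_mul, mul_assoc]
  rw [diagTrace_eq τ ((NonnegBdd.const ha).mul hc).2, diagTrace_eq τ hc.2, h,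
    hτ.map_smul _ _ (isPositive_realDiag hc.1 hc.2), ENNReal.ofReal]

lemma diagTrace_mono (hd : NonnegBdd d) (h0 : ∀ i, 0 ≤ c i) (h : ∀ i, c i ≤ d i) :
    diagTrace τ c ≤ diagTrace τ d := by
  have hc := hd.mono h0 h
  have h1 : NonnegBdd fun i => d i - c i :=
    hd.mono (fun i => sub_nonneg.2 (h i)) fun i => sub_le_self _ (h0 i)
  have h2 := hτ.diagTrace_add hc h1
  simp only [add_sub_cancel] at h2
  rw [h2]
  exact le_self_add

lemma diagTrace_comp (e : Equiv.Perm ι) (hc : NonnegBdd c) :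
    diagTrace τ (fun i => c (e i)) = diagTrace τ c := by
  rw [diagTrace_eq τ (bounded_comp hc.2 e), diagTrace_eq τ hc.2]
  exact hτ.realDiag_comp e hc.1 hc.2

lemma diagTrace_eq_zero (hc : NonnegBdd c) {s : Set ι} (hs : s.Finite) (hcs : ∀ i ∉ s, c i = 0) :
    diagTrace τ c = 0 := by
  rw [diagTrace_eq τ hc.2]
  exact hτ.realDiag_eq_zero hc.1 hc.2 hs hcs

lemma diagTrace_sum {κ : Type*} (s : Finset κ) {c : κ → ι → ℝ} (hc : ∀ k ∈ s, NonnegBdd (c k)) :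
    diagTrace τ (fun i => ∑ k ∈ s, c k i) = ∑ k ∈ s, diagTrace τ (c k) := by
  classical
  induction s using Finset.induction_on with
  | empty =>
    refine hτ.diagTrace_eq_zero (NonnegBdd.sum ∅ hc) Set.finite_empty fun i _ => ?_
    simp
  | insert a s ha ih =>
    have h1 := fun k hk => hc k (Finset.mem_insert_of_mem hk)
    simp only [Finset.sum_insert ha]
    rw [hτ.diagTrace_add (hc a (Finset.mem_insert_self a s)) (NonnegBdd.sum s h1), ih h1]

/-- Finitely many indices are invisible to a singular trace: the indicator part absorbs the excess
on `s` and has trace zero. -/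
lemma diagTrace_le_of_finite (hd : NonnegBdd d) (h0 : ∀ i, 0 ≤ c i) {s : Set ι} (hs : s.Finite)
    {C : ι → ℝ} (hC : NonnegBdd C) (hsC : ∀ i, c i ≤ C i) (h : ∀ i ∉ s, c i ≤ d i) :
    diagTrace τ c ≤ diagTrace τ d := by
  have h1 : diagTrace τ (s.indicator C) = 0 := hτ.diagTrace_eq_zero (hC.indicator s) hs
    fun i hi => Set.indicator_of_notMem hi _
  rw [← add_zero (diagTrace τ d), ← h1, ← hτ.diagTrace_add hd (hC.indicator s)]
  refine hτ.diagTrace_mono (hd.add (hC.indicator s)) h0 fun i => ?_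
  by_cases hi : i ∈ s
  · rw [Set.indicator_of_mem hi]
    linarith [hd.1 i, hsC i]
  · rw [Set.indicator_of_notMem hi, add_zero]
    exact h i hi

end IsSingularTrace

/-! ### Singular traces vanish if the multiplicities are bounded -/

lemma exists_perm_comp {ℓ : ι → ℕ} (hfin : ∀ n, {i | ℓ i = n}.Finite) (s : Equiv.Perm ℕ)
    (hs : ∀ n, {i | ℓ i = s n}.ncard = {i | ℓ i = n}.ncard) :
    ∃ e : Equiv.Perm ι, ∀ i, ℓ (e i) = s (ℓ i) := by
  have hF : ∀ n, Nonempty ({i // ℓ i = n} ≃ {i // ℓ i = s n}) := fun n => by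
    have : Finite {i // ℓ i = n} := (hfin n).to_subtype
    have : Finite {i // ℓ i = s n} := (hfin (s n)).to_subtype
    exact Finite.card_eq.1 (hs n).symm
  have F := fun n => (hF n).some
  refine ⟨(Equiv.sigmaFiberEquiv ℓ).symm.trans ((Equiv.sigmaCongr s F).trans
    (Equiv.sigmaFiberEquiv ℓ)), fun i => ?_⟩
  exact (F (ℓ i) ⟨i, rfl⟩).2

/-- The involution of `ℕ` exchanging `a + 2 k` and `a + 2 k + 1`. -/
def pairSwap (a : ℕ) : Equiv.Perm ℕ :=
  Function.Involutive.toPerm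
    (fun n => if n < a then n else if Even (n - a) then n + 1 else n - 1) fun n => by
      grind

lemma pairSwap_apply (a n : ℕ) :
    pairSwap a n = if n < a then n else if Even (n - a) then n + 1 else n - 1 := rfl

lemma IsSingularTrace.diagTrace_level_eq_zero {τ : (L2 ι →L[ℂ] L2 ι) → ℝ≥0∞}
    (hτ : IsSingularTrace τ) {ℓ : ι → ℕ} (hfin : ∀ n, {i | ℓ i = n}.Finite) {a : ℕ}
    (hcard : ∀ n, a ≤ n → {i | ℓ i = n}.ncard = {i | ℓ i = a}.ncard) {t : ℕ → ℝ}
    (ht0 : ∀ n, 0 ≤ t n) {ρ : ℝ} (hρ0 : 0 ≤ ρ) (hρ1 : ρ < 1) (ht : ∀ n, t (n + 1) ≤ ρ * t n)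
    (htop : diagTrace τ (fun i => t (ℓ i)) ≠ ⊤) : diagTrace τ (fun i => t (ℓ i)) = 0 := by
  classical
  have hanti : Antitone t := antitone_nat_of_succ_le fun n =>
    (ht n).trans (mul_le_of_le_one_left (ht0 n) hρ1.le)
  have hb : NonnegBdd fun i => t (ℓ i) :=
    (NonnegBdd.const (ht0 0)).mono (fun i => ht0 _) fun i => hanti (Nat.zero_le _)
  -- The part of the operator on levels `b, b + 2, b + 4, …`. Exchanging neighbouring levels gives
  -- `τ(E (b + 1)) ≤ ρ τ(E b)`, while `E a` and `E (a + 2)` differ on one finite level only. So `τ(E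
  -- a) ≤ ρ τ(E a)`, and a finite trace must vanish.
  set E : ℕ → ι → ℝ := fun b i => if b ≤ ℓ i ∧ Even (ℓ i - b) then t (ℓ i) else 0 with hE
  have hE0 : ∀ b, NonnegBdd (E b) := fun b => hb.mono
    (fun i => by simp only [hE]; split_ifs; exacts [ht0 _, le_rfl])
    fun i => by simp only [hE]; split_ifs; exacts [le_rfl, ht0 _]
  have hstep : ∀ b, a ≤ b → diagTrace τ (E (b + 1)) ≤ ENNReal.ofReal ρ * diagTrace τ (E b) := by
    intro b hb'
    obtain ⟨e, he⟩ := exists_perm_comp hfin (pairSwap b) fun n => by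
      rw [pairSwap_apply]
      by_cases h1 : n < b
      · rw [if_pos h1]
      · rw [if_neg h1]
        split_ifs with h2
        · rw [hcard _ (by omega), hcard n (by omega)]
        · have : n - b ≠ 0 := fun h => h2 (by simp [h])
          rw [hcard _ (by omega), hcard n (by omega)]
    rw [← hτ.diagTrace_comp e (hE0 b), ← hτ.diagTrace_const_mul hρ0
      ⟨fun i => (hE0 b).1 (e i), bounded_comp (hE0 b).2 e⟩]
    refine hτ.diagTrace_mono ((NonnegBdd.const hρ0).mul
      ⟨fun i => (hE0 b).1 (e i), bounded_comp (hE0 b).2 e⟩) (hE0 _).1 fun i => ?_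
    by_cases h : b + 1 ≤ ℓ i ∧ Even (ℓ i - (b + 1))
    · have h1 : pairSwap b (ℓ i) = ℓ i - 1 := by
        rw [pairSwap_apply]; grind
      have h2 : b ≤ ℓ i - 1 ∧ Even (ℓ i - 1 - b) := by grind
      simp only [hE, he, h1, if_pos h, if_pos h2]
      have h3 := ht (ℓ i - 1)
      rwa [Nat.sub_add_cancel (by omega)] at h3
    · simp only [hE, if_neg h]
      exact mul_nonneg hρ0 ((hE0 b).1 (e i))
  have hskip : diagTrace τ (E a) ≤ diagTrace τ (E (a + 2)) :=
    hτ.diagTrace_le_of_finite (hE0 _) (hE0 a).1 (hfin a) hb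
      (fun i => by simp only [hE]; split_ifs; exacts [le_rfl, ht0 _]) fun i hi => by
        rw [Set.mem_ofPred_eq] at hi
        by_cases h : a ≤ ℓ i ∧ Even (ℓ i - a)
        · have h2 : a + 2 ≤ ℓ i ∧ Even (ℓ i - (a + 2)) := by grind
          simp only [hE, if_pos h, if_pos h2, le_refl]
        · simp only [hE, if_neg h]
          exact (hE0 (a + 2)).1 i
  have hEtop : diagTrace τ (E a) ≠ ⊤ := ne_top_of_le_ne_top htop
    (hτ.diagTrace_mono hb (hE0 a).1 fun i => by
      simp only [hE]; split_ifs; exacts [le_rfl, ht0 _])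
  have hEa : diagTrace τ (E a) = 0 := by
    by_contra h0
    have h1 : diagTrace τ (E a) ≤ ENNReal.ofReal ρ * diagTrace τ (E a) :=
      hskip.trans ((hstep (a + 1) (by omega)).trans (mul_le_mul_right (((hstep a le_rfl)).trans
        (mul_le_of_le_one_left zero_le (ENNReal.ofReal_le_one.2 hρ1.le))) _))
    have h2 : ENNReal.ofReal ρ * diagTrace τ (E a) < 1 * diagTrace τ (E a) :=
      ENNReal.mul_lt_mul_left h0 hEtop (ENNReal.ofReal_lt_one.2 hρ1)
    rw [one_mul] at h2
    exact absurd h1 (not_le.2 h2)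
  have hEa1 : diagTrace τ (E (a + 1)) = 0 := by
    have := hstep a le_rfl
    rwa [hEa, mul_zero, nonpos_iff_eq_zero] at this
  have hlow : {i | ℓ i < a}.Finite := by
    have h1 : {i | ℓ i < a} = ⋃ n ∈ Finset.range a, {i | ℓ i = n} := by
      ext i
      simp
    rw [h1]
    exact (Finset.range a).finite_toSet.biUnion fun n _ => hfin n
  rw [← nonpos_iff_eq_zero]
  calc diagTrace τ (fun i => t (ℓ i)) ≤ diagTrace τ (fun i => E a i + E (a + 1) i) :=
        hτ.diagTrace_le_of_finite ((hE0 a).add (hE0 (a + 1))) hb.1 hlow hb (fun _ => le_rfl)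
          fun i hi => by
            rw [Set.mem_ofPred_eq, not_lt] at hi
            by_cases h : Even (ℓ i - a)
            · simp only [hE, if_pos (And.intro hi h)]
              linarith [(hE0 (a + 1)).1 i]
            · have h2 : a + 1 ≤ ℓ i ∧ Even (ℓ i - (a + 1)) := by grind
              have h3 := (hE0 a).1 i
              simp only [hE, if_pos h2] at h3 ⊢
              linarith
    _ = 0 := by rw [hτ.diagTrace_add (hE0 a) (hE0 (a + 1)), hEa, hEa1, add_zero]

end DiagTrace

end FractalNCG

namespace FractalNCG
namespace LimitSystem

/-! ### Hausdorff-Besicovitch functionals of limit fractals -/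

variable {N : ℕ} {S : LimitSystem N} {V : Set (EuclideanSpace ℝ (Fin N))}

variable (S) in
/-- The indices of the words that begin with `σ`. -/
def cylinderIndices (n : ℕ) (σ : (k : Fin n) → Fin (S.p k)) : Set (S.Word × Bool) :=
  {i | ∃ h : n ≤ i.1.1, (fun k : Fin n => i.1.2 (k.castLE h)) = σ}

/-- The permutation of the words that permutes the letters. -/
def wordPerm (e : (k : ℕ) → Equiv.Perm (Fin (S.p k))) : Equiv.Perm (S.Word × Bool) :=
  (Equiv.sigmaCongrRight fun m => Equiv.piCongrRight fun k : Fin m => e k).prodCongr (Equiv.refl _)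

lemma wordPerm_mem_cylinderIndices {n : ℕ} (σ τ : (k : Fin n) → Fin (S.p k)) (i : S.Word × Bool) :
    wordPerm (letterSwap σ τ) i ∈ S.cylinderIndices n τ ↔ i ∈ S.cylinderIndices n σ := by
  refine exists_congr fun h => ?_
  rw [funext_iff, funext_iff]
  exact forall_congr' fun k => letterSwap_eq_iff σ τ k _

lemma finite_level (n : ℕ) : {i : S.Word × Bool | i.1.1 = n}.Finite :=
  Set.finite_of_encard_eq_coe (S.encard_level n)

lemma finite_level_lt (n : ℕ) : {i : S.Word × Bool | i.1.1 < n}.Finite := by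
  have h : {i : S.Word × Bool | i.1.1 < n} =
      ⋃ m ∈ Finset.range n, {i : S.Word × Bool | i.1.1 = m} := by
    ext i
    simp
  rw [h]
  exact (Finset.range n).finite_toSet.biUnion fun m _ => finite_level m

lemma sum_cylinderIndices (n : ℕ) (c : ((k : Fin n) → Fin (S.p k)) → ℝ) (w : S.Word × Bool → ℝ)
    (i : S.Word × Bool) (h : n ≤ i.1.1) :
    ∑ σ, c σ * (S.cylinderIndices n σ).indicator w i = c (fun k => i.1.2 (k.castLE h)) * w i := by
  classical
  refine (Finset.sum_eq_single (fun k : Fin n => i.1.2 (k.castLE h) : (k : Fin n) → Fin (S.p k))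
    (fun σ _ hσ => ?_) fun h => absurd (Finset.mem_univ _) h).trans ?_
  · rw [Set.indicator_of_notMem, mul_zero]
    rintro ⟨h', h1⟩
    exact hσ h1.symm
  · rw [Set.indicator_of_mem]
    exact ⟨h, rfl⟩

lemma pt_mem_piece (hV : S.IsCountablyRamifiedOSC V) {x y : EuclideanSpace ℝ (Fin N)} (hx : x ∈ V)
    (hy : y ∈ V) {n : ℕ} (i : S.Word × Bool) (h : n ≤ i.1.1) :
    S.pt x y i ∈ S.piece V n fun k => i.1.2 (k.castLE h) :=
  hV.wordMap_mem_piece h i.1.2 (subset_closure (by split_ifs <;> assumption))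

/-! ### The trace of multiplication operators as a limit of level means. -/

section Trace

variable {τ : (L2 (S.Word × Bool) →L[ℂ] L2 (S.Word × Bool)) → ℝ≥0∞} (hτ : IsSingularTrace τ)
  {t : ℕ → ℝ} (ht : NonnegBdd fun i : S.Word × Bool => t i.1.1)
  (h1 : diagTrace τ (fun i : S.Word × Bool => t i.1.1) = 1)
include hτ ht h1

/-- Letter permutations carry cylinders to each other and preserve the level, so all `P_n` cylinders
have equal trace. Together they miss only the finitely many words shorter than `n`, hence the traces
add up to `1`. -/
lemma diagTrace_cylinderIndices (n : ℕ) (σ : (k : Fin n) → Fin (S.p k)) :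
    diagTrace τ ((S.cylinderIndices n σ).indicator fun i => t i.1.1) =
      ENNReal.ofReal (S.numWords n : ℝ)⁻¹ := by
  classical
  have hb := fun ρ => ht.indicator (S.cylinderIndices n ρ)
  have heq : ∀ ρ, diagTrace τ ((S.cylinderIndices n ρ).indicator fun i => t i.1.1) =
      diagTrace τ ((S.cylinderIndices n σ).indicator fun i => t i.1.1) := fun ρ => by
    rw [← hτ.diagTrace_comp (wordPerm (letterSwap σ ρ)) (hb ρ)]
    congr 1
    funext i
    simp only [Set.indicator_apply, wordPerm_mem_cylinderIndices]
    rfl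
  have hsum : ∑ ρ, diagTrace τ ((S.cylinderIndices n ρ).indicator fun i => t i.1.1) = 1 := by
    rw [← hτ.diagTrace_sum Finset.univ fun ρ _ => hb ρ, ← h1]
    have hs : ∀ i : S.Word × Bool, n ≤ i.1.1 →
        ∑ ρ, (S.cylinderIndices n ρ).indicator (fun i => t i.1.1) i = t i.1.1 := fun i hi => by
      simpa using sum_cylinderIndices n (fun _ => 1) (fun i => t i.1.1) i hi
    have hB := NonnegBdd.sum Finset.univ fun ρ _ => hb ρ
    refine le_antisymm ?_ ?_
    · exact hτ.diagTrace_le_of_finite ht hB.1 (finite_level_lt n) hB (fun _ => le_rfl)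
        fun i hi => (hs i (not_lt.1 hi)).le
    · exact hτ.diagTrace_le_of_finite hB ht.1 (finite_level_lt n) ht (fun _ => le_rfl)
        fun i hi => (hs i (not_lt.1 hi)).ge
  rw [Finset.sum_congr rfl fun ρ _ => heq ρ, Finset.sum_const, Finset.card_univ, card_words,
    nsmul_eq_mul] at hsum
  have hP : (0 : ℝ) < S.numWords n := by exact_mod_cast S.numWords_pos n
  rw [ENNReal.ofReal_inv_of_pos hP, ENNReal.ofReal_natCast]
  exact ENNReal.eq_inv_of_mul_eq_one_left (by rw [mul_comm]; exact hsum)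

lemma diagTrace_sum_cylinderIndices (n : ℕ) {c : ((k : Fin n) → Fin (S.p k)) → ℝ}
    (hc : ∀ σ, 0 ≤ c σ) :
    diagTrace τ (fun i => ∑ σ, c σ * (S.cylinderIndices n σ).indicator (fun i => t i.1.1) i) =
      ENNReal.ofReal ((S.numWords n : ℝ)⁻¹ * ∑ σ, c σ) := by
  rw [hτ.diagTrace_sum Finset.univ fun σ _ => (NonnegBdd.const (hc σ)).mul (ht.indicator _),
    Finset.mul_sum, ENNReal.ofReal_sum_of_nonneg fun σ _ =>
      mul_nonneg (inv_nonneg.2 (Nat.cast_nonneg _)) (hc σ)]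
  refine Finset.sum_congr rfl fun σ _ => ?_
  rw [hτ.diagTrace_const_mul (hc σ) (ht.indicator _), diagTrace_cylinderIndices hτ ht h1,
    ← ENNReal.ofReal_mul (hc σ), mul_comm]

variable (hV : S.IsCountablyRamifiedOSC V) {x y : EuclideanSpace ℝ (Fin N)} (hx : x ∈ V)
  (hy : y ∈ V)
include hV hx hy

/-- Beyond level `n`, `g` differs by at most `ε` from the function equal to `g (w_σ x)` on the
cylinder of `σ`; the trace of that step function is a level mean. Shorter words form a finite set
and do not matter. -/
theorem diagTrace_eq_of_tendsto_levelMean {g : EuclideanSpace ℝ (Fin N) → ℝ}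
    (hg : ContinuousOn g (closure V)) (hg0 : ∀ z ∈ closure V, 0 ≤ g z) {I : ℝ}
    (hI : Tendsto (levelMean S x g) atTop (𝓝 I)) :
    diagTrace τ (fun i => g (S.pt x y i) * t i.1.1) = ENNReal.ofReal I := by
  classical
  have hpt : ∀ i, S.pt x y i ∈ closure V := fun i =>
    hV.piece_subset 0 _ (pt_mem_piece hV hx hy i (Nat.zero_le _))
  have hgb : NonnegBdd fun i => g (S.pt x y i) := by
    obtain ⟨C, hC⟩ := hV.isCompact_closure.exists_bound_of_continuousOn hg
    exact ⟨fun i => hg0 _ (hpt i), C, fun i => by rw [Complex.norm_real]; exact hC _ (hpt i)⟩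
  have hgt := hgb.mul ht
  have hx' := subset_closure hx
  have hgx : ∀ n (σ : (k : Fin n) → Fin (S.p k)), 0 ≤ g (S.wordMap n σ x) := fun n σ =>
    hg0 _ (hV.piece_subset n σ ⟨x, hx', rfl⟩)
  have hclose : ∀ ε > 0, ∀ᶠ n in atTop, ∀ (i : S.Word × Bool) (h : n ≤ i.1.1),
      |g (S.pt x y i) - g (S.wordMap n (fun k => i.1.2 (k.castLE h)) x)| ≤ ε := by
    intro ε hε
    filter_upwards [eventually_abs_sub_wordMap_le hV hg hε] with n hn i h
    exact hn _ _ (pt_mem_piece hV hx hy i h) _ ⟨x, hx', rfl⟩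
  have hcb : ∀ n (c : ((k : Fin n) → Fin (S.p k)) → ℝ), (∀ σ, 0 ≤ c σ) → NonnegBdd fun i =>
      ∑ σ, c σ * (S.cylinderIndices n σ).indicator (fun i => t i.1.1) i := fun n c hc =>
    NonnegBdd.sum Finset.univ fun σ _ => (NonnegBdd.const (hc σ)).mul (ht.indicator _)
  have hup : ∀ ε > 0, diagTrace τ (fun i => g (S.pt x y i) * t i.1.1) ≤ ENNReal.ofReal (I + ε) := by
    intro ε hε
    refine ge_of_tendsto (ENNReal.tendsto_ofReal (hI.add_const ε)) ?_
    filter_upwards [hclose ε hε] with n hn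
    have hP : (0 : ℝ) < S.numWords n := by exact_mod_cast S.numWords_pos n
    have h2 := diagTrace_sum_cylinderIndices hτ ht h1 n
      (c := fun σ => g (S.wordMap n σ x) + ε) fun σ => add_nonneg (hgx n σ) hε.le
    have h3 : (S.numWords n : ℝ)⁻¹ * ∑ σ : (k : Fin n) → Fin (S.p k), (g (S.wordMap n σ x) + ε) =
        levelMean S x g n + ε := by
      rw [Finset.sum_add_distrib, Finset.sum_const, Finset.card_univ, card_words, nsmul_eq_mul,
        mul_add, inv_mul_cancel_left₀ hP.ne', levelMean]
    rw [← h3, ← h2]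
    refine hτ.diagTrace_le_of_finite (hcb n _ fun σ => add_nonneg (hgx n σ) hε.le) hgt.1
      (finite_level_lt n) hgt (fun _ => le_rfl) fun i hi => ?_
    rw [sum_cylinderIndices n _ _ i (not_lt.1 hi)]
    have := abs_le.1 (hn i (not_lt.1 hi))
    exact mul_le_mul_of_nonneg_right (by linarith) (ht.1 i)
  have hlow : ∀ ε > 0, ENNReal.ofReal I ≤
      diagTrace τ (fun i => g (S.pt x y i) * t i.1.1) + ENNReal.ofReal ε := by
    intro ε hε
    refine le_of_tendsto (ENNReal.tendsto_ofReal hI) ?_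
    filter_upwards [hclose ε hε] with n hn
    have h2 := diagTrace_sum_cylinderIndices hτ ht h1 n (c := fun σ => g (S.wordMap n σ x)) (hgx n)
    have h3 := (NonnegBdd.const hε.le).mul ht
    rw [levelMean, ← h2, ← mul_one (ENNReal.ofReal ε), ← h1, ← hτ.diagTrace_const_mul hε.le ht,
      ← hτ.diagTrace_add hgt h3]
    refine hτ.diagTrace_le_of_finite (hgt.add h3) (hcb n _ (hgx n)).1 (finite_level_lt n)
      (hcb n _ (hgx n)) (fun _ => le_rfl) fun i hi => ?_
    rw [sum_cylinderIndices n _ _ i (not_lt.1 hi), ← add_mul]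
    have := abs_le.1 (hn i (not_lt.1 hi))
    exact mul_le_mul_of_nonneg_right (by linarith) (ht.1 i)
  refine le_antisymm ?_ ?_
  · refine ge_of_tendsto (x := 𝓝[>] 0) (f := fun ε : ℝ => ENNReal.ofReal (I + ε)) ?_
      (eventually_nhdsWithin_of_forall fun ε hε => hup ε hε)
    have : Tendsto (fun ε : ℝ => I + ε) (𝓝 0) (𝓝 (I + 0)) := tendsto_const_nhds.add tendsto_id
    rw [add_zero] at this
    exact (ENNReal.tendsto_ofReal this).mono_left nhdsWithin_le_nhds
  · refine ge_of_tendsto (x := 𝓝[>] 0) (f := fun ε : ℝ =>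
      diagTrace τ (fun i => g (S.pt x y i) * t i.1.1) + ENNReal.ofReal ε) ?_
      (eventually_nhdsWithin_of_forall fun ε hε => hlow ε hε)
    have : Tendsto (fun ε : ℝ => ENNReal.ofReal ε) (𝓝 0) (𝓝 (ENNReal.ofReal 0)) :=
      ENNReal.tendsto_ofReal tendsto_id
    rw [ENNReal.ofReal_zero] at this
    simpa using (this.mono_left (nhdsWithin_le_nhds (s := Set.Ioi 0))).const_add
      (diagTrace τ (fun i => g (S.pt x y i) * t i.1.1))

theorem diagTrace_eq_integral {ν : Measure (EuclideanSpace ℝ (Fin N))} [IsProbabilityMeasure ν]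
    (hν : IsEquidistributed S V ν) {h : closure V → ℝ} (hh : Continuous h) (h0 : ∀ z, 0 ≤ h z) :
    diagTrace τ (fun i => h (ptV hV hx hy i) * t i.1.1) =
      ENNReal.ofReal (∫ z, h z ∂(ν.comap Subtype.val)) := by
  -- The values outside `V̄` are irrelevant: only continuity on `V̄` is used.
  set g : EuclideanSpace ℝ (Fin N) → ℝ := Function.extend Subtype.val h 0 with hg
  have hgh : ∀ z : closure V, g z = h z := fun z => Subtype.val_injective.extend_apply h 0 z
  have hgc : ContinuousOn g (closure V) := by
    rw [continuousOn_iff_continuous_domRestrict]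
    exact hh.congr fun z => (hgh z).symm
  have hint : ∫ z in closure V, g z ∂ν = ∫ z, h z ∂(ν.comap Subtype.val) := by
    rw [← integral_subtype_comap isClosed_closure.measurableSet]
    simp only [hgh]
  rw [← hint, ← diagTrace_eq_of_tendsto_levelMean hτ ht h1 hV hx hy hgc
    (fun z hz => by rw [hgh ⟨z, hz⟩]; exact h0 _)
    (hν.tendsto_levelMean hV (subset_closure hx) hgc)]
  congr 1
  funext i
  rw [← hgh]
  rfl

end Trace

section Main

variable {lam : ℕ → ℝ} (hlam : ∀ n j, S.ratio n j = lam n)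
  (hV : S.IsCountablyRamifiedOSC V)
  {x y : EuclideanSpace ℝ (Fin N)} (hx : x ∈ V) (hy : y ∈ V) (hxy : x ≠ y)
  {α : ℝ} {τ : (L2 (S.Word × Bool) →L[ℂ] L2 (S.Word × Bool)) → ℝ≥0∞}
  (hτ : (spectralTriple hV hx hy hxy).IsTraceOfExponent α τ)
include hlam hτ

lemma nonnegBdd_levelValue : NonnegBdd fun i : S.Word × Bool =>
    levelValue lam (dist x y) α i.1.1 :=
  ⟨fun _ => (levelValue_pos hlam (dist_pos.2 hxy) _).le, bounded_levelValue hlam hτ.1⟩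

lemma diagTrace_levelValue :
    diagTrace τ (fun i : S.Word × Bool => levelValue lam (dist x y) α i.1.1) = 1 := by
  rw [diagTrace_eq τ (bounded_levelValue hlam hτ.1), ← absPowNeg_eq hlam hV hx hy hxy hτ.1]
  exact hτ.2.2

/-- The non-decreasing sequence `P_n` would otherwise be eventually constant. With constant
multiplicities and geometrically decreasing eigenvalues a finite singular trace of `|D|^{-α}` is
zero, not `1`. -/
theorem tendsto_numWords_atTop : Tendsto S.numWords atTop atTop := by
  by_contra hP
  have hbdd : BddAbove (Set.range S.numWords) := by
    by_contra h
    exact hP (tendsto_atTop_atTop_of_monotone' S.numWords_mono h)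
  obtain ⟨a, ha⟩ := Nat.sSup_mem (Set.range_nonempty _) hbdd
  have hconst : ∀ n, a ≤ n → S.numWords n = S.numWords a := fun n hn =>
    le_antisymm (ha ▸ le_csSup hbdd ⟨n, rfl⟩) (S.numWords_mono hn)
  have hcard : ∀ n, {i : S.Word × Bool | i.1.1 = n}.ncard = 2 * S.numWords n := fun n => by
    rw [Set.ncard, S.encard_level, ENat.toNat_natCast]
  have hr := dist_pos.2 hxy
  obtain ⟨ρ, hρ0, hρ1, hρ⟩ := exists_ratio_levelValue_le (r := dist x y) hlam hr hτ.1
  have h1 := diagTrace_levelValue hlam hV hx hy hxy hτ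
  have h0 := hτ.2.1.diagTrace_level_eq_zero (ℓ := fun i : S.Word × Bool => i.1.1) finite_level
    (a := a) (fun n hn => by rw [hcard, hcard, hconst n hn])
    (t := levelValue lam (dist x y) α) (fun n => (levelValue_pos hlam hr n).le) hρ0.le hρ1
    (fun n => (div_le_iff₀ (levelValue_pos hlam hr n)).1 (hρ n)) (by rw [h1]; exact ENNReal.one_ne_top)
  rw [h1] at h0
  exact one_ne_zero h0

theorem hausdorffBesicovitch_eq_integral {ν : Measure (EuclideanSpace ℝ (Fin N))}
    [IsProbabilityMeasure ν] (hν : IsEquidistributed S V ν) (f : lipschitzAlgebra hV.bounded) :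
    (spectralTriple hV hx hy hxy).hausdorffBesicovitch α τ f =
      ∫ z : closure V, f.1 z ∂(ν.comap Subtype.val) := by
  have ht := nonnegBdd_levelValue hlam hV hx hy hxy hτ
  have h1 := diagTrace_levelValue hlam hV hx hy hxy hτ
  obtain ⟨K, hK⟩ := f.2
  have hf : Continuous f.1 := hK.continuous
  have hcb : ∃ C : ℝ, ∀ i : S.Word × Bool,
      ‖f.1 (ptV hV hx hy i) * (levelValue lam (dist x y) α i.1.1 : ℂ)‖ ≤ C := by
    obtain ⟨A, hA⟩ := lipschitz_bounded hV hx hy f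
    obtain ⟨B, hB⟩ := ht.2
    refine ⟨A * B, fun i => ?_⟩
    have := (norm_nonneg _).trans (hA i)
    rw [norm_mul]
    gcongr
    exacts [hA i, hB i]
  have hop : (spectralTriple hV hx hy hxy).rep f * (spectralTriple hV hx hy hxy).absPowNeg α =
      weighted (Equiv.refl (S.Word × Bool))
        (fun i => f.1 (ptV hV hx hy i) * (levelValue lam (dist x y) α i.1.1 : ℂ)) hcb := by
    rw [absPowNeg_eq hlam hV hx hy hxy hτ.1]
    ext ξ i
    exact (mul_assoc _ _ _).symm
  have key : ∀ (u : closure V → ℝ), Continuous u → (∀ z, 0 ≤ u z) →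
      ∀ (c : S.Word × Bool → ℝ) (hc : ∃ C : ℝ, ∀ i, ‖(c i : ℂ)‖ ≤ C),
      (∀ i, c i = u (ptV hV hx hy i) * levelValue lam (dist x y) α i.1.1) →
      (τ (realDiag c hc)).toReal = ∫ z, u z ∂(ν.comap Subtype.val) := by
    intro u hu hu0 c hc h
    rw [← diagTrace_eq τ hc, funext h, diagTrace_eq_integral hτ.2.1 ht h1 hV hx hy hν hu hu0,
      ENNReal.toReal_ofReal (integral_nonneg hu0)]
  have hre : Continuous fun z => (f.1 z).re := Complex.continuous_re.comp hf
  have him : Continuous fun z => (f.1 z).im := Complex.continuous_im.comp hf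
  have hpos : ∀ i : S.Word × Bool, 0 ≤ levelValue lam (dist x y) α i.1.1 := ht.1
  have hposmul : ∀ a b : ℝ, 0 ≤ b → (a * b)⁺ = a⁺ * b := fun a b hb => by
    rw [posPart_def, posPart_def, max_mul_of_nonneg _ _ hb, zero_mul]
  have hnegmul : ∀ a b : ℝ, 0 ≤ b → (a * b)⁻ = a⁻ * b := fun a b hb => by
    rw [negPart_def, negPart_def, max_mul_of_nonneg _ _ hb, zero_mul, neg_mul]
  have hpc : ∀ {u : closure V → ℝ}, Continuous u → Continuous fun z => (u z)⁺ := fun hu => by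
    simp only [posPart_def]
    exact hu.max continuous_const
  have hnc : ∀ {u : closure V → ℝ}, Continuous u → Continuous fun z => (u z)⁻ := fun hu => by
    simp only [negPart_def]
    exact hu.neg.max continuous_const
  have : CompactSpace (closure V) := isCompact_iff_compactSpace.1 hV.isCompact_closure
  have : IsFiniteMeasure (ν.comap (Subtype.val : closure V → EuclideanSpace ℝ (Fin N))) :=
    inferInstance
  have hint : ∀ {u : closure V → ℝ}, Continuous u → Integrable u (ν.comap Subtype.val) :=
    fun hu => hu.integrable_of_hasCompactSupport (HasCompactSupport.of_compactSpace _)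
  have hdiff : ∀ {u : closure V → ℝ}, Continuous u →
      ∫ z, (u z)⁺ ∂(ν.comap Subtype.val) - ∫ z, (u z)⁻ ∂(ν.comap Subtype.val) =
        ∫ z, u z ∂(ν.comap Subtype.val) := fun {u} hu => by
    rw [← integral_sub (hint (hpc hu)) (hint (hnc hu))]
    simp only [posPart_sub_negPart]
  rw [SpectralTriple.hausdorffBesicovitch, hop, linearExtension_weighted_refl,
    key _ (hpc hre) (fun z => posPart_nonneg _) _ _ fun i => by
      rw [Complex.re_mul_ofReal, hposmul _ _ (hpos i)],
    key _ (hnc hre) (fun z => negPart_nonneg _) _ _ fun i => by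
      rw [Complex.re_mul_ofReal, hnegmul _ _ (hpos i)],
    key _ (hpc him) (fun z => posPart_nonneg _) _ _ fun i => by
      rw [Complex.im_mul_ofReal, hposmul _ _ (hpos i)],
    key _ (hnc him) (fun z => negPart_nonneg _) _ _ fun i => by
      rw [Complex.im_mul_ofReal, hnegmul _ _ (hpos i)], hdiff hre, hdiff him]
  exact integral_re_add_im (hf.integrable_of_hasCompactSupport (HasCompactSupport.of_compactSpace _))

end Main

end LimitSystem
end FractalNCG

end

theorem mainTheorem3 {N : ℕ} (S : FractalNCG.LimitSystem N)
    (lam : ℕ → ℝ) (hlam : ∀ n j, S.ratio n j = lam n)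
    (F : TopologicalSpace.NonemptyCompacts (EuclideanSpace ℝ (Fin N))) (hF : S.IsLimitFractal F)
    (V : Set (EuclideanSpace ℝ (Fin N))) (hV : S.IsCountablyRamifiedOSC V)
    (x y : EuclideanSpace ℝ (Fin N)) (hx : x ∈ V) (hy : y ∈ V) (hxy : x ≠ y) :
    -- the formula for the spectral dimension
    (FractalNCG.LimitSystem.spectralTriple hV hx hy hxy).dimension =
      limsup (fun n : ℕ => ENNReal.ofReal
        ((∑ k ∈ Finset.range n, Real.log (S.p k)) / ∑ k ∈ Finset.range n, Real.log (1 / lam k)))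
        atTop ∧
    -- the dimension is finite and, when positive, carries a Hausdorff-Besicovitch functional
    (FractalNCG.LimitSystem.spectralTriple hV hx hy hxy).dimension < ⊤ ∧
    (0 < (FractalNCG.LimitSystem.spectralTriple hV hx hy hxy).dimension →
      ∃ τ, (FractalNCG.LimitSystem.spectralTriple hV hx hy hxy).IsTraceOfExponent
        (FractalNCG.LimitSystem.spectralTriple hV hx hy hxy).dimension.toReal τ) ∧
    -- every Hausdorff-Besicovitch functional is given by the unique invariant probability measure
    ∀ α τ, (FractalNCG.LimitSystem.spectralTriple hV hx hy hxy).IsTraceOfExponent α τ →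
      ∃ μ : Measure (EuclideanSpace ℝ (Fin N)),
        (IsProbabilityMeasure μ ∧ S.IsInvariantOn V F μ) ∧
        (∀ ν : Measure (EuclideanSpace ℝ (Fin N)),
          IsProbabilityMeasure ν ∧ S.IsInvariantOn V F ν → ν = μ) ∧
        ∀ f : FractalNCG.LimitSystem.lipschitzAlgebra hV.bounded,
          (FractalNCG.LimitSystem.spectralTriple hV hx hy hxy).hausdorffBesicovitch α τ f =
            ∫ z : closure V, f.1 z ∂(μ.comap Subtype.val) := by
  have hfin := FractalNCG.LimitSystem.dimension_lt_top hlam hV hx hy hxy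
  refine ⟨FractalNCG.LimitSystem.dimension_eq hlam hV hx hy hxy, hfin,
    FractalNCG.LimitSystem.exists_trace_dimension hlam hV hx hy hxy hfin, fun α τ hτ => ?_⟩
  -- The existence of `τ` enters the study of invariant measures only here: growth of `P_n` is what
  -- excludes atoms.
  have hP := FractalNCG.LimitSystem.tendsto_numWords_atTop hlam hV hx hy hxy hτ
  obtain ⟨M, hM⟩ := FractalNCG.LimitSystem.exists_ncard_piece_le hlam hV
    (FractalNCG.LimitSystem.pos_of_ne hxy)
  have hequi : ∀ ν : Measure (EuclideanSpace ℝ (Fin N)), IsProbabilityMeasure ν →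
      S.IsInvariantOn V F ν → FractalNCG.LimitSystem.IsEquidistributed S V ν := fun ν _ hν => by
    have := FractalNCG.LimitSystem.nullSingletonClass_of_mul_le hP
      (hν.numWords_mul_measure_singleton_le hV hF hM)
    exact hν.isEquidistributed hV hF
  obtain ⟨μ, hμ, hinv⟩ := FractalNCG.LimitSystem.exists_isInvariantOn hV hlam hF hP hM
  refine ⟨μ, ⟨hμ, hinv⟩, fun ν hν => ?_, fun f =>
    FractalNCG.LimitSystem.hausdorffBesicovitch_eq_integral hlam hV hx hy hxy hτ
      (hequi μ hμ hinv) f⟩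
  have := hν.1
  exact (hequi ν hν.1 hν.2).eq (hequi μ hμ hinv) hV
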